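/- Let $A\in\mathbb R^{n\times n}$, $B\in\mathbb R^{n\times m}$, let $Q\in\mathbb R^{n\times n}$ be symmetric (possibly indefinite) and let $\mathcal L\subset\mathbb R^n$ be a subspace. For $x_0\in\mathbb R^n$ and $u\in L^m_{2,loc}(\mathbb R^+)$ let $x(\cdot)$ be the solution of $\dot x=Ax+Bu$, $x(0)=x_0$, and $J_T(x_0,u)=\int_0^T (x^\top Qx+u^\top u)\,dt$. Let $V_{\mathcal L}(x_0)$ be the infimum of $\lim_{T\to\infty}J_T(x_0,u)$ over all $u$ for which this limit exists in $\mathbb R\cup\{\pm\infty\}$ and the distance of $x(t)$ to $\mathcal L$ tends to $0$ as $t\to\infty$. Put $\phi(K)=A^\top K+KA+Q-KBB^\top K$, $\partial\Gamma=\{K=K^\top:\phi(K)=0\}$, $\Gamma_-=\{K=K^\top:\phi(K)\ge 0,\ K\le 0\}$. Assume that $(A,B)$ is stabilizable and $\Gamma_-\neq\emptyset$. **Theorem.** (1) There is a unique $K^\star\in\partial\Gamma$ with $V_{\mathcal L}(x_0)=x_0^\top K^\star x_0$ for all $x_0\in\mathbb R^n$. (2) Let $\mathcal C=\operatorname{Im}B+A\operatorname{Im}B+\dots+A^{n-1}\operatorname{Im}B$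 and let $\mathcal X_2$ be any complement, $\mathbb R^n=\mathcal C\oplus\mathcal X_2$. In coordinates adapted to this splitting (congruence for $Q$ and $K$) write $$A=\begin{bmatrix}A_1&A_{12}\\0&A_2\end{bmatrix},\quad B=\begin{bmatrix}B_1\\0\end{bmatrix},\quad Q=\begin{bmatrix}Q_1&Q_{12}\\Q_{12}^\top&Q_2\end{bmatrix},\quad K^\star=\begin{bmatrix}K_1^\star&K_{12}^\star\\(K_{12}^\star)^\top&K_2^\star\end{bmatrix},$$ and $A_1(K_1)=A_1-B_1B_1^\top K_1$. Let $n_1=\dim\mathcal C$ and let $\mathcal X^+(M),\mathcal X^0(M),\mathcal X^-(M)$ be the spectral subspaces of a real matrix $M$ for the eigenvalues with positive, zero and negative real part. The equation $A_1^\top K_1+K_1A_1+Q_1-K_1B_1B_1^\top K_1=0$ has a minimal and a maximal symmetric solution $K_1^-$, $K_1^+$. Put $\Delta_1=K_1^+-K_1^-$, let $\mathcal L_1=\mathcal L\cap\mathcal C$, viewed in $\mathbb R^{n_1}\sim\mathcal C$, and $$\mathcal N_1=\mathcal N_1(\mathcal L_1)=\Big(\bigcap_{k=0}^{n_1-1}\{x: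 A_1(K_1^-)^k x\in\mathcal L_1\cap\operatorname{Ker}K_1^-\}\Big)\cap\mathcal X^+(A_1(K_1^-)).$$ Then $\mathbb R^{n_1}=\mathcal N_1\oplus\Delta_1^{-1}(\mathcal N_1^\perp)$, where $\Delta_1^{-1}(\mathcal N_1^\perp)=\{x:\Delta_1x\in\mathcal N_1^\perp\}$. Let $P$ be the projection onto $\mathcal N_1$ along $\Delta_1^{-1}(\mathcal N_1^\perp)$, and let $\overline K_1=\gamma(\mathcal N_1):=K_1^-P+K_1^+(I-P)$, $\mathcal X_{1,1}=\mathcal X^+(A_1(\overline K_1))$, $\mathcal X_{1,2}=\mathcal X^0(A_1(\overline K_1))$, $\mathcal X_{1,3}=\mathcal X^-(A_1(\overline K_1))$. Then $\mathbb R^n=\mathcal X_{1,1}\oplus\mathcal X_{1,2}\oplus\mathcal X_{1,3}\oplus\mathcal X_2$. (3) In all coordinates adapted to such a decomposition, $K_1^\star=\overline K_1$, and $$K^\star=\begin{bmatrix}0&0&0&0\\0&K_{1,22}^-&K_{1,23}^-&K_{12,2}^\star\\0&(K_{1,23}^-)^\top&K_{1,33}^+&K_{12,3}^\star\\0&(K_{12,2}^\star)^\top&(K_{12,3}^\star)^\top&K_2^\star\end{bmatrix};$$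 in particular $K_{12,1}^\star=0$. Here $K^{\pm}_{1,ij}$ are the blocks of $K_1^\pm$. With $\overline A_{1,ii}$ the diagonal blocks of $A_1(\overline K_1)$, and $Q_{12,i}$, $A_{12,i}$ the row blocks of $Q_{12}$, $A_{12}$: * $K_{12,2}^\star$ is the unique solution $X$ of $\overline A_{1,22}^\top X+XA_2=-(Q_{12,2}+K_{1,22}^-A_{12,2}+K_{1,23}^-A_{12,3})$; * $K_{12,3}^\star$ is the unique solution $X$ of $\overline A_{1,33}^\top X+XA_2=-(Q_{12,3}+(K_{1,23}^-)^\top A_{12,2}+K_{1,33}^+A_{12,3})$; * $K_2^\star$ is the unique solution $X$ of $A_2^\top X+XA_2=(K_{12}^\star)^\top B_1B_1^\top K_{12}^\star-(K_{12}^\star)^\top A_{12}-A_{12}^\top K_{12}^\star-Q_2$, where $K_{12}^\star$ has the row blocks $0$, $K_{12,2}^\star$, $K_{12,3}^\star$. -/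

import Mathlib

open Matrix MeasureTheory Filter Topology Polynomial

noncomputable section

/-! ### The control problem -/

/-- Locally square integrable controls on `[0, ∞)` (only the values at `t ≥ 0` are ever used). -/
structure IsL2Loc {m : ℕ} (u : ℝ → Fin m → ℝ) : Prop where
  measurable : Measurable u
  integrable : ∀ T : ℝ, 0 ≤ T → IntegrableOn (fun t => u t ⬝ᵥ u t) (Set.Icc 0 T)

/-- `x` is the (Carathéodory) solution on `[0, ∞)` of `x' = A x + B u`, `x(0) = x₀`. -/
structure IsTrajectory {n m : ℕ} (A : Matrix (Fin n) (Fin n) ℝ) (B : Matrix (Fin n) (Fin m) ℝ)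
    (x₀ : Fin n → ℝ) (u : ℝ → Fin m → ℝ) (x : ℝ → Fin n → ℝ) : Prop where
  continuousOn : ContinuousOn x (Set.Ici 0)
  eq_integral : ∀ t : ℝ, 0 ≤ t → x t = x₀ + ∫ s in (0 : ℝ)..t, (A *ᵥ x s + B *ᵥ u s)

/-- The finite-horizon cost `J_T = ∫₀ᵀ (xᵀ Q x + uᵀ u) dt`. -/
def costUpTo {n m : ℕ} (Q : Matrix (Fin n) (Fin n) ℝ)
    (x : ℝ → Fin n → ℝ) (u : ℝ → Fin m → ℝ) (T : ℝ) : ℝ :=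
  ∫ t in (0 : ℝ)..T, (x t ⬝ᵥ Q *ᵥ x t + u t ⬝ᵥ u t)

/-- Minimum Euclidean distance from a point to a subspace. -/
def euclideanDist {n : ℕ} (L : Submodule ℝ (Fin n → ℝ)) (x : Fin n → ℝ) : ℝ :=
  Metric.infDist (WithLp.toLp 2 x : EuclideanSpace ℝ (Fin n))
    ((WithLp.toLp 2 : (Fin n → ℝ) → EuclideanSpace ℝ (Fin n)) '' (L : Set (Fin n → ℝ)))

/-- The set of costs `J(x₀, u) = lim J_T(x₀, u)` of all permissible controls: the limit exists in
the extended reals and the state converges to `L`. -/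
def permissibleCosts {n m : ℕ} (A : Matrix (Fin n) (Fin n) ℝ) (B : Matrix (Fin n) (Fin m) ℝ)
    (Q : Matrix (Fin n) (Fin n) ℝ) (L : Submodule ℝ (Fin n → ℝ)) (x₀ : Fin n → ℝ) : Set EReal :=
  {c | ∃ (u : ℝ → Fin m → ℝ) (x : ℝ → Fin n → ℝ), IsL2Loc u ∧ IsTrajectory A B x₀ u x ∧
      Tendsto (fun T : ℝ => ((costUpTo Q x u T : ℝ) : EReal)) atTop (𝓝 c) ∧
      Tendsto (fun t : ℝ => euclideanDist L (x t)) atTop (𝓝 0)}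

/-- The value function of the problem with stability modulo `L`. -/
def valueFunction {n m : ℕ} (A : Matrix (Fin n) (Fin n) ℝ) (B : Matrix (Fin n) (Fin m) ℝ)
    (Q : Matrix (Fin n) (Fin n) ℝ) (L : Submodule ℝ (Fin n → ℝ)) (x₀ : Fin n → ℝ) : EReal :=
  sInf (permissibleCosts A B Q L x₀)

/-- `(A, B)` is stabilizable: some feedback moves all eigenvalues to the open left half-plane. -/
def IsStabilizable {n m : ℕ} (A : Matrix (Fin n) (Fin n) ℝ) (B : Matrix (Fin n) (Fin m) ℝ) :
    Prop :=
  ∃ F : Matrix (Fin m) (Fin n) ℝ,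
    ∀ z ∈ spectrum ℂ ((A + B * F).map (algebraMap ℝ ℂ)), z.re < 0

/-- The controllable subspace `Im B + A Im B + ⋯ + Aⁿ⁻¹ Im B`. -/
def controllableSubspace {n m : ℕ} (A : Matrix (Fin n) (Fin n) ℝ) (B : Matrix (Fin n) (Fin m) ℝ) :
    Submodule ℝ (Fin n → ℝ) :=
  ⨆ k : Fin n, (LinearMap.range B.mulVecLin).map (A ^ (k : ℕ)).mulVecLin

/-! ### Riccati equation and inequality, over an arbitrary finite index type -/

section Riccati

variable {ι : Type*} [Fintype ι] {m : ℕ}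

/-- The Riccati map `φ(K) = Aᵀ K + K A + Q - K B Bᵀ K`. -/
def riccati (A : Matrix ι ι ℝ) (B : Matrix ι (Fin m) ℝ) (Q K : Matrix ι ι ℝ) : Matrix ι ι ℝ :=
  Aᵀ * K + K * A + Q - K * B * Bᵀ * K

/-- The closed-loop matrix `A(K) = A - B Bᵀ K`. -/
def closedLoop (A : Matrix ι ι ℝ) (B : Matrix ι (Fin m) ℝ) (K : Matrix ι ι ℝ) : Matrix ι ι ℝ :=
  A - B * Bᵀ * K

/-- Symmetric solutions of the algebraic Riccati inequality `φ(K) ≥ 0`. -/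
def solARI (A : Matrix ι ι ℝ) (B : Matrix ι (Fin m) ℝ) (Q : Matrix ι ι ℝ) : Set (Matrix ι ι ℝ) :=
  {K | K.IsSymm ∧ (riccati A B Q K).PosSemidef}

/-- Symmetric solutions of the algebraic Riccati equation `φ(K) = 0`. -/
def solARE (A : Matrix ι ι ℝ) (B : Matrix ι (Fin m) ℝ) (Q : Matrix ι ι ℝ) : Set (Matrix ι ι ℝ) :=
  {K | K.IsSymm ∧ riccati A B Q K = 0}

/-- Negative semidefinite solutions of the algebraic Riccati inequality. -/
def solARINeg (A : Matrix ι ι ℝ) (B : Matrix ι (Fin m) ℝ) (Q : Matrix ι ι ℝ) :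
    Set (Matrix ι ι ℝ) :=
  {K | K ∈ solARI A B Q ∧ (-K).PosSemidef}

/-- `M` is the minimal element of `S` for the order `P ≤ P' ↔ P' - P` positive semidefinite. -/
def IsMinimalElement (S : Set (Matrix ι ι ℝ)) (M : Matrix ι ι ℝ) : Prop :=
  M ∈ S ∧ ∀ K ∈ S, (K - M).PosSemidef

/-- `M` is the maximal element of `S` for the order `P ≤ P' ↔ P' - P` positive semidefinite. -/
def IsMaximalElement (S : Set (Matrix ι ι ℝ)) (M : Matrix ι ι ℝ) : Prop :=
  M ∈ S ∧ ∀ K ∈ S, (M - K).PosSemidef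

end Riccati

/-! ### Subspaces attached to a matrix -/

open Classical in
/-- The product of those monic irreducible real factors of `p` (with multiplicity) all of whose
complex roots lie in `R`. For `p` monic and `R` the set of complex numbers with negative, zero or
positive real part these are the factors of the factorization `p = p₋ p₀ p₊`. -/
def regionFactor (R : Set ℂ) (p : ℝ[X]) : ℝ[X] :=
  ((UniqueFactorizationMonoid.normalizedFactors p).filter
    (fun q => ∀ z : ℂ, aeval z q = 0 → z ∈ R)).prod

section Subspaces

variable {ι : Type*} [Fintype ι] [DecidableEq ι]

/-- The kernel of `p_R(M)`, where `p` is the characteristic polynomial of `M`. -/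
def spectralSubspace (R : Set ℂ) (M : Matrix ι ι ℝ) : Submodule ℝ (ι → ℝ) :=
  LinearMap.ker (aeval M (regionFactor R M.charpoly)).mulVecLin

/-- The spectral subspace of the eigenvalues with positive real part. -/
def specPos (M : Matrix ι ι ℝ) : Submodule ℝ (ι → ℝ) := spectralSubspace {z | 0 < z.re} M

/-- The spectral subspace of the eigenvalues on the imaginary axis. -/
def specZero (M : Matrix ι ι ℝ) : Submodule ℝ (ι → ℝ) := spectralSubspace {z | z.re = 0} M

/-- The spectral subspace of the eigenvalues with negative real part. -/
def specNeg (M : Matrix ι ι ℝ) : Submodule ℝ (ι → ℝ) := spectralSubspace {z | z.re < 0} M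

/-- `⟨V | M⟩ = V ∩ M⁻¹ V ∩ ⋯ ∩ M^{-(d-1)} V`, with `d` the dimension of the space. -/
def invariantCore (V : Submodule ℝ (ι → ℝ)) (M : Matrix ι ι ℝ) : Submodule ℝ (ι → ℝ) :=
  ⨅ k : Fin (Fintype.card ι), V.comap (M ^ (k : ℕ)).mulVecLin

/-- The orthogonal complement for the standard Euclidean inner product. -/
def orthComplement (V : Submodule ℝ (ι → ℝ)) : Submodule ℝ (ι → ℝ) where
  carrier := {x | ∀ v ∈ V, v ⬝ᵥ x = 0}
  add_mem' := by
    intro a b ha hb v hv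
    rw [dotProduct_add, ha v hv, hb v hv, add_zero]
  zero_mem' := by
    intro v _
    exact dotProduct_zero v
  smul_mem' := by
    intro c x hx v hv
    rw [dotProduct_smul, hx v hv, smul_zero]

/-- `P` is the projection onto `V` along `W`; this includes that the space is `V ⊕ W`. -/
structure IsProjectionAlong (P : Matrix ι ι ℝ) (V W : Submodule ℝ (ι → ℝ)) : Prop where
  isCompl : IsCompl V W
  apply_left : ∀ v ∈ V, P *ᵥ v = v
  apply_right : ∀ w ∈ W, P *ᵥ w = 0

/-- The subspace spanned by the standard basis vectors with index in the range of `e`. -/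
def coordSubspace {κ : Type*} (e : κ → ι) : Submodule ℝ (ι → ℝ) :=
  Submodule.span ℝ (Set.range fun k => (Pi.single (e k) 1 : ι → ℝ))

/-- `K⁻ P + K⁺ (I - P)`. -/
def projectedSolution (Km Kp P : Matrix ι ι ℝ) : Matrix ι ι ℝ := Km * P + Kp * (1 - P)

end Subspaces

/-! ### Coordinates adapted to the decomposition -/

/-- A linear change of coordinates `x = T ξ`. -/
structure CoordChange (n : ℕ) (κ : Type) [Fintype κ] [DecidableEq κ] where
  T : Matrix (Fin n) κ ℝ
  Tinv : Matrix κ (Fin n) ℝ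
  T_mul_Tinv : T * Tinv = 1
  Tinv_mul_T : Tinv * T = 1

namespace CoordChange

variable {n m : ℕ} {κ : Type} [Fintype κ] [DecidableEq κ] (c : CoordChange n κ)

/-- The system matrix in the new coordinates. -/
def sys (A : Matrix (Fin n) (Fin n) ℝ) : Matrix κ κ ℝ := c.Tinv * A * c.T

/-- The input matrix in the new coordinates. -/
def inp (B : Matrix (Fin n) (Fin m) ℝ) : Matrix κ (Fin m) ℝ := c.Tinv * B

/-- The matrix of a quadratic form in the new coordinates. -/
def form (Q : Matrix (Fin n) (Fin n) ℝ) : Matrix κ κ ℝ := c.Tᵀ * Q * c.T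

end CoordChange

section Adapted

variable {n m : ℕ} {ι₁ ι₂ : Type} [Fintype ι₁] [DecidableEq ι₁] [Fintype ι₂] [DecidableEq ι₂]

/-- `L ∩ C` as a subspace of the coordinate space of the first block of coordinates. -/
def restrictedTarget (L : Submodule ℝ (Fin n → ℝ)) (c : CoordChange n (ι₁ ⊕ ι₂)) :
    Submodule ℝ (ι₁ → ℝ) :=
  L.comap c.T.toCols₁.mulVecLin

/-- `N₁(L₁) = ⟨L₁ ∩ Ker K₁⁻ | A₁(K₁⁻)⟩ ∩ X⁺(A₁(K₁⁻))`. -/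
def undetectedSubspace (A₁ : Matrix ι₁ ι₁ ℝ) (B₁ : Matrix ι₁ (Fin m) ℝ)
    (L₁ : Submodule ℝ (ι₁ → ℝ)) (Km : Matrix ι₁ ι₁ ℝ) : Submodule ℝ (ι₁ → ℝ) :=
  invariantCore (L₁ ⊓ LinearMap.ker Km.mulVecLin) (closedLoop A₁ B₁ Km) ⊓
    specPos (closedLoop A₁ B₁ Km)

end Adapted

/-- The coordinates `c` are adapted to `ℝⁿ = X₁₁ ⊕ X₁₂ ⊕ X₁₃ ⊕ X₂`, where `C = X₁₁ ⊕ X₁₂ ⊕ X₁₃` is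
the controllable subspace and `X₁₁`, `X₁₂`, `X₁₃` are the spectral subspaces (positive, zero,
negative real part) of the closed-loop matrix `A₁(K̄₁)`, with `K̄₁ = Km P + Kp (I - P)`. Here `Km`,
`Kp` are the extremal solutions of the Riccati equation of the controllable subsystem, and `P` is
the projection onto `N₁(L₁)` along `Δ₁⁻¹(N₁(L₁)^⊥)`, `Δ₁ = Kp - Km`. -/
structure IsAdapted {n m p q r s : ℕ} (A : Matrix (Fin n) (Fin n) ℝ) (B : Matrix (Fin n) (Fin m) ℝ)
    (Q : Matrix (Fin n) (Fin n) ℝ) (L X₂ : Submodule ℝ (Fin n → ℝ))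
    (c : CoordChange n ((Fin p ⊕ Fin q ⊕ Fin r) ⊕ Fin s))
    (Km Kp P : Matrix (Fin p ⊕ Fin q ⊕ Fin r) (Fin p ⊕ Fin q ⊕ Fin r) ℝ) : Prop where
  range_first : LinearMap.range c.T.toCols₁.mulVecLin = controllableSubspace A B
  range_second : LinearMap.range c.T.toCols₂.mulVecLin = X₂
  minimal : IsMinimalElement
    (solARE (c.sys A).toBlocks₁₁ (c.inp B).toRows₁ (c.form Q).toBlocks₁₁) Km
  maximal : IsMaximalElement
    (solARE (c.sys A).toBlocks₁₁ (c.inp B).toRows₁ (c.form Q).toBlocks₁₁) Kp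
  projection : IsProjectionAlong P
    (undetectedSubspace (c.sys A).toBlocks₁₁ (c.inp B).toRows₁ (restrictedTarget L c) Km)
    ((orthComplement (undetectedSubspace (c.sys A).toBlocks₁₁ (c.inp B).toRows₁
      (restrictedTarget L c) Km)).comap (Kp - Km).mulVecLin)
  antistable : specPos (closedLoop (c.sys A).toBlocks₁₁ (c.inp B).toRows₁
    (projectedSolution Km Kp P)) = coordSubspace Sum.inl
  neutral : specZero (closedLoop (c.sys A).toBlocks₁₁ (c.inp B).toRows₁
    (projectedSolution Km Kp P)) = coordSubspace (Sum.inr ∘ Sum.inl)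
  stable : specNeg (closedLoop (c.sys A).toBlocks₁₁ (c.inp B).toRows₁
    (projectedSolution Km Kp P)) = coordSubspace (Sum.inr ∘ Sum.inr)

end

/-! Antistable motions have to be stopped at a price, except those that need no control: motions of
the uncontrolled system that stay in the target and cost nothing. In the controllable subspace these
fill `undetectedSubspace`, written N here. For K₀ in Γ₋ the minimality of `Km` gives Km ≤ K₀ ≤ 0 on
the controllable subspace, so K₀ vanishes on N, and so does Q
(`mulVec_eq_zero_of_mem_undetectedSubspace`). The whole problem therefore descends to the quotient
of the state space by N, and N lies in the target. On the quotient no undetected antistable motion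
is left, and the value is the quadratic form of the solution K whose closed loop is semistable,
which is the maximal solution (`valueFunction_eq_of_reduction`).

Upper bound: the equation with weight Q + εI has a stabilizing solution Y (Newton's iteration,
`exists_stabilizing_solution`). Its feedback drives the quotient state to 0, hence the state to the
target, at a cost of at most the form of Y, and Y tends to K as ε tends to 0
(`exists_maximal_solution`).

Lower bound (`IsCurve.frequently_le_cost`): completing squares with K₀ shows that a trajectory of
bounded cost is driven, through the closed loop A₀ of K₀, by a square integrable input. The
functionals that stay bounded along the trajectory modulo L², and those that become small modulo L²,
form subspaces invariant under A₀ᵀ. Since no antistable motion is undetected, the first subspace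
contains all antistable functionals. Flowing backwards contracts these, so the second contains them
too. A rigidity lemma for Riccati equations (`mulVec_eq_zero_of_riccati`) then puts the rows of a
square root of K - K₀ in the second subspace. Hence xᵀ(K - K₀)x is arbitrarily small at arbitrarily
late times, and completing squares with K gives the bound.

Identification of K⋆: the difference Δ of the extremal solutions intertwines their closed loops, so
K̄₁ solves the Riccati equation. Its closed loop is that of `Km` on N, which is antistable, and that
of `Kp` on Δ⁻¹(N^⊥), which is semistable. So N is its antistable subspace, and modulo N it is
semistable. Uniqueness of semistable solutions identifies it with the first block of the quotient
solution. The remaining blocks satisfy Sylvester equations, uniquely solvable because the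
uncontrollable part is stable by stabilizability and the diagonal blocks of the closed loop involved
have no antistable eigenvalue. -/

set_option linter.unusedSectionVars false

/-! ### Real polynomials and regions made of vertical lines. -/

/-- All complex roots of the real polynomial `p` lie in `R`. -/
def RootsIn (R : Set ℂ) (p : ℝ[X]) : Prop := ∀ z : ℂ, aeval z p = 0 → z ∈ R

/-- `R` is a union of vertical lines. -/
def IsVertical (R : Set ℂ) : Prop := ∀ z w : ℂ, z.re = w.re → z ∈ R → w ∈ R

lemma isVertical_pos : IsVertical {z | 0 < z.re} := fun z w h hz => by
  simp only [Set.mem_ofPred_eq] at *; rwa [← h]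

lemma isVertical_zero : IsVertical {z | z.re = 0} := fun z w h hz => by
  simp only [Set.mem_ofPred_eq] at *; rwa [← h]

lemma isVertical_neg : IsVertical {z | z.re < 0} := fun z w h hz => by
  simp only [Set.mem_ofPred_eq] at *; rwa [← h]

lemma IsVertical.compl {R : Set ℂ} (h : IsVertical R) : IsVertical Rᶜ :=
  fun z w hzw hz hw => hz (h w z hzw.symm hw)

lemma RootsIn.mono {R S : Set ℂ} {p : ℝ[X]} (h : RootsIn R p) (hRS : R ⊆ S) : RootsIn S p :=
  fun z hz => hRS (h z hz)

lemma RootsIn.mul {R : Set ℂ} {p q : ℝ[X]} (hp : RootsIn R p) (hq : RootsIn R q) :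
    RootsIn R (p * q) := by
  intro z hz
  rw [map_mul, mul_eq_zero] at hz
  exact hz.elim (hp z) (hq z)

lemma RootsIn.isCoprime {R S : Set ℂ} {p q : ℝ[X]} (hp : RootsIn R p) (hq : RootsIn S q)
    (hRS : Disjoint R S) : IsCoprime p q := by
  refine (isCoprime_iff_aeval_ne_zero_of_isAlgClosed ℝ ℂ p q).mpr fun z => ?_
  by_contra! h
  exact Set.disjoint_left.mp hRS (hp z h.1) (hq z h.2)

lemma aeval_eq_zero_of_dvd_irreducible {d q : ℝ[X]} (hq : Irreducible q) (hd : ¬ IsUnit d)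
    (hdq : d ∣ q) {w : ℂ} (hw : aeval w q = 0) : aeval w d = 0 := by
  obtain ⟨r, rfl⟩ := hdq
  rw [map_mul, mul_eq_zero] at hw
  refine hw.resolve_right ?_
  exact (((hq.isUnit_or_isUnit rfl).resolve_left hd).map (aeval w)).ne_zero

/-- An irreducible real polynomial is linear or has a pair of conjugate roots. This makes regions
consisting of vertical lines compatible with factorization over `ℝ`. -/
lemma re_eq_of_irreducible {q : ℝ[X]} (hq : Irreducible q) {z w : ℂ} (hz : aeval z q = 0)
    (hw : aeval w q = 0) : z.re = w.re := by
  by_cases him : z.im = 0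
  · have hd : (X - C z.re) ∣ q := by
      rw [dvd_iff_isRoot, IsRoot]
      have h1 : (algebraMap ℝ ℂ) z.re = z := Complex.ext (by simp) (by simp [him])
      have : (algebraMap ℝ ℂ) (q.eval z.re) = 0 := by
        rw [← aeval_algebraMap_apply_eq_algebraMap_eval, h1, hz]
      simpa using this
    have h2 := aeval_eq_zero_of_dvd_irreducible hq (irreducible_X_sub_C z.re).not_isUnit hd hw
    simp only [map_sub, aeval_X, aeval_C, sub_eq_zero] at h2
    rw [h2]; simp
  · have hdeg : (X ^ 2 - C (2 * z.re) * X + C (‖z‖ ^ 2) : ℝ[X]).natDegree = 2 := by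
      compute_degree!
    have hu : ¬ IsUnit (X ^ 2 - C (2 * z.re) * X + C (‖z‖ ^ 2) : ℝ[X]) := fun h => by
      rw [natDegree_eq_zero_of_isUnit h] at hdeg; omega
    have h2 := aeval_eq_zero_of_dvd_irreducible hq hu
      (quadratic_dvd_of_aeval_eq_zero_im_ne_zero q hz him) hw
    have h3 : (w - z) * (w - (starRingEnd ℂ) z) = 0 := by
      have e1 : (z : ℂ) * (starRingEnd ℂ) z = (‖z‖ : ℂ) ^ 2 := Complex.mul_conj' z
      have e2 : z + (starRingEnd ℂ) z = ((2 * z.re : ℝ) : ℂ) := Complex.add_conj z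
      simp only [map_add, map_sub, map_mul, map_pow, aeval_X, aeval_C] at h2
      have : w ^ 2 - (z + (starRingEnd ℂ) z) * w + z * (starRingEnd ℂ) z = 0 := by
        rw [e1, e2]; simpa using h2
      linear_combination this
    rcases mul_eq_zero.mp h3 with h | h
    · rw [sub_eq_zero.mp h]
    · rw [sub_eq_zero.mp h, Complex.conj_re]

open UniqueFactorizationMonoid Classical in
lemma rootsIn_regionFactor (R : Set ℂ) (p : ℝ[X]) : RootsIn R (regionFactor R p) := by
  intro z hz
  unfold regionFactor at hz
  rw [map_multiset_prod, Multiset.prod_eq_zero_iff, Multiset.mem_map] at hz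
  obtain ⟨q, hq, hqz⟩ := hz
  exact (Multiset.mem_filter.mp hq).2 z hqz

-- Verticality of `R` forces each irreducible factor to have all its roots in `R` or all outside, so
-- no factor is lost between the two filters.
open UniqueFactorizationMonoid Classical in
lemma regionFactor_mul_compl {R : Set ℂ} (hR : IsVertical R) {p : ℝ[X]} (hp : p.Monic) :
    regionFactor R p * regionFactor Rᶜ p = p := by
  have h : (normalizedFactors p).filter (fun q => ∀ z : ℂ, aeval z q = 0 → z ∈ Rᶜ) =
      (normalizedFactors p).filter (fun q => ¬ ∀ z : ℂ, aeval z q = 0 → z ∈ R) := by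
    refine Multiset.filter_congr fun q hq => ?_
    have hirr := irreducible_of_normalized_factor q hq
    obtain ⟨z₀, hz₀⟩ : ∃ z : ℂ, aeval z q = 0 :=
      IsAlgClosed.exists_aeval_eq_zero _ q (degree_pos_of_irreducible hirr).ne'
    constructor
    · intro h1 h2
      exact h1 z₀ hz₀ (h2 z₀ hz₀)
    · intro h1 z hz hzR
      exact h1 fun w hw => hR z w (re_eq_of_irreducible hirr hz hw) hzR
  unfold regionFactor
  rw [h, ← Multiset.prod_add, Multiset.filter_add_not (fun q : ℝ[X] => ∀ z : ℂ, aeval z q = 0 → z ∈ R),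
    prod_normalizedFactors_eq hp.ne_zero,
    hp.normalize_eq_self]

/-! ### Polynomials in a matrix and its spectral subspaces. -/

section Matrices

variable {ι κ : Type*} [Fintype ι] [DecidableEq ι] [Fintype κ] [DecidableEq κ]

/-- `x` is annihilated by a polynomial in `M` all of whose roots lie in `R`. -/
def SpectrallyIn (R : Set ℂ) (M : Matrix ι ι ℝ) (x : ι → ℝ) : Prop :=
  ∃ p : ℝ[X], RootsIn R p ∧ aeval M p *ᵥ x = 0

lemma aeval_charpoly_mulVec (M : Matrix ι ι ℝ) (x : ι → ℝ) : aeval M M.charpoly *ᵥ x = 0 := by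
  rw [aeval_self_charpoly, zero_mulVec]

lemma aeval_mul_mulVec (M : Matrix ι ι ℝ) (p q : ℝ[X]) (x : ι → ℝ) :
    aeval M (p * q) *ᵥ x = aeval M p *ᵥ (aeval M q *ᵥ x) := by
  rw [map_mul, mulVec_mulVec]

lemma aeval_mulVec_comm (M : Matrix ι ι ℝ) (p q : ℝ[X]) (x : ι → ℝ) :
    aeval M p *ᵥ (aeval M q *ᵥ x) = aeval M q *ᵥ (aeval M p *ᵥ x) := by
  rw [← aeval_mul_mulVec, ← aeval_mul_mulVec, mul_comm]

lemma eq_zero_of_isCoprime {M : Matrix ι ι ℝ} {p q : ℝ[X]} (h : IsCoprime p q) {x : ι → ℝ}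
    (hp : aeval M p *ᵥ x = 0) (hq : aeval M q *ᵥ x = 0) : x = 0 := by
  obtain ⟨a, b, hab⟩ := h
  have : aeval M (a * p + b * q) *ᵥ x = 0 := by
    rw [map_add, add_mulVec, aeval_mul_mulVec, aeval_mul_mulVec, hp, hq, mulVec_zero, mulVec_zero,
      add_zero]
  simpa [hab] using this

lemma SpectrallyIn.eq_zero {R S : Set ℂ} {M : Matrix ι ι ℝ} {x : ι → ℝ} (h : SpectrallyIn R M x)
    (h' : SpectrallyIn S M x) (hRS : Disjoint R S) : x = 0 := by
  obtain ⟨p, hp, hpx⟩ := h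
  obtain ⟨q, hq, hqx⟩ := h'
  exact eq_zero_of_isCoprime (hp.isCoprime hq hRS) hpx hqx

lemma SpectrallyIn.mono {R S : Set ℂ} {M : Matrix ι ι ℝ} {x : ι → ℝ} (h : SpectrallyIn R M x)
    (hRS : R ⊆ S) : SpectrallyIn S M x :=
  h.imp fun _ hp => ⟨hp.1.mono hRS, hp.2⟩

lemma spectrallyIn_of_charpoly {R : Set ℂ} {M : Matrix ι ι ℝ} (h : RootsIn R M.charpoly)
    (x : ι → ℝ) : SpectrallyIn R M x :=
  ⟨_, h, aeval_charpoly_mulVec M x⟩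

/-- This frees later arguments from the particular factor of the characteristic polynomial: any
annihilating polynomial with roots in `R` will do. If `p` kills `x`, then applying `regionFactor R`
to `x` gives a vector killed by `p` and by the complementary factor, which are coprime. -/
lemma mem_spectralSubspace {R : Set ℂ} (hR : IsVertical R) (M : Matrix ι ι ℝ) (x : ι → ℝ) :
    x ∈ spectralSubspace R M ↔ SpectrallyIn R M x := by
  unfold spectralSubspace
  rw [LinearMap.mem_ker, mulVecLin_apply]
  refine ⟨fun h => ⟨_, rootsIn_regionFactor R _, h⟩, ?_⟩
  rintro ⟨p, hp, hpx⟩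
  have hc := hp.isCoprime (rootsIn_regionFactor Rᶜ M.charpoly) disjoint_compl_right
  refine eq_zero_of_isCoprime (M := M) hc ?_ ?_
  · rw [aeval_mulVec_comm, hpx, mulVec_zero]
  · rw [aeval_mulVec_comm, ← aeval_mul_mulVec, regionFactor_mul_compl hR (charpoly_monic M),
      aeval_charpoly_mulVec]

lemma isCompl_spectralSubspace {R : Set ℂ} (hR : IsVertical R) (M : Matrix ι ι ℝ) :
    IsCompl (spectralSubspace R M) (spectralSubspace Rᶜ M) := by
  have hc : IsCoprime (regionFactor R M.charpoly) (regionFactor Rᶜ M.charpoly) :=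
    (rootsIn_regionFactor R _).isCoprime (rootsIn_regionFactor Rᶜ _) disjoint_compl_right
  refine ⟨Submodule.disjoint_def.mpr fun x hx hx' => eq_zero_of_isCoprime (M := M) hc hx hx',
    codisjoint_iff.mpr (eq_top_iff.mpr fun x _ => ?_)⟩
  have key : ∀ y, aeval M (regionFactor R M.charpoly * regionFactor Rᶜ M.charpoly) *ᵥ y = 0 := by
    intro y; rw [regionFactor_mul_compl hR (charpoly_monic M), aeval_charpoly_mulVec]
  obtain ⟨a, b, hab⟩ := hc
  have hx : x = aeval M (b * regionFactor Rᶜ M.charpoly) *ᵥ x +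
      aeval M (a * regionFactor R M.charpoly) *ᵥ x := by
    rw [← add_mulVec, ← map_add, add_comm, hab, map_one, one_mulVec]
  rw [hx]
  refine Submodule.add_mem_sup ?_ ?_
  · change aeval M (regionFactor R M.charpoly) *ᵥ (aeval M _ *ᵥ x) = 0
    rw [← aeval_mul_mulVec, mul_left_comm, aeval_mul_mulVec, key, mulVec_zero]
  · change aeval M (regionFactor Rᶜ M.charpoly) *ᵥ (aeval M _ *ᵥ x) = 0
    rw [← aeval_mul_mulVec, mul_left_comm, mul_comm (regionFactor Rᶜ M.charpoly),
      aeval_mul_mulVec, key, mulVec_zero]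

/-- The relation `M * Y = Y * N` covers quotient maps, inclusions of invariant subspaces, changes of
coordinates and homogeneous Sylvester equations alike. -/
lemma aeval_intertwine {M : Matrix ι ι ℝ} {N : Matrix κ κ ℝ} {Y : Matrix ι κ ℝ}
    (h : M * Y = Y * N) (p : ℝ[X]) : aeval M p * Y = Y * aeval N p := by
  induction p using Polynomial.induction_on' with
  | add p q hp hq => rw [map_add, map_add, Matrix.add_mul, Matrix.mul_add, hp, hq]
  | monomial k a =>
    have : M ^ k * Y = Y * N ^ k := by
      induction k with
      | zero => simp
      | succ k ih => rw [pow_succ, pow_succ, Matrix.mul_assoc, h, ← Matrix.mul_assoc, ih,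
          Matrix.mul_assoc]
    rw [aeval_monomial, aeval_monomial, ← Algebra.smul_def, ← Algebra.smul_def, Matrix.smul_mul,
      this, Matrix.mul_smul]

lemma SpectrallyIn.map {R : Set ℂ} {M : Matrix ι ι ℝ} {N : Matrix κ κ ℝ} {Y : Matrix κ ι ℝ}
    (h : N * Y = Y * M) {x : ι → ℝ} (hx : SpectrallyIn R M x) : SpectrallyIn R N (Y *ᵥ x) := by
  obtain ⟨p, hp, hpx⟩ := hx
  exact ⟨p, hp, by rw [mulVec_mulVec, aeval_intertwine h, ← mulVec_mulVec, hpx, mulVec_zero]⟩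

lemma SpectrallyIn.mulVec {R : Set ℂ} {M : Matrix ι ι ℝ} {x : ι → ℝ} (hx : SpectrallyIn R M x) :
    SpectrallyIn R M (M *ᵥ x) := hx.map rfl

lemma aeval_mulVec_congr {M N : Matrix ι ι ℝ} {x : ι → ℝ}
    (h : ∀ k : ℕ, (M ^ k) *ᵥ x = (N ^ k) *ᵥ x) (p : ℝ[X]) : aeval M p *ᵥ x = aeval N p *ᵥ x := by
  induction p using Polynomial.induction_on' with
  | add p q hp hq => rw [map_add, map_add, add_mulVec, add_mulVec, hp, hq]
  | monomial k a =>
    rw [aeval_monomial, aeval_monomial, ← Algebra.smul_def, ← Algebra.smul_def, smul_mulVec,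
      smul_mulVec, h]

/-- Two matrices that agree on a subspace invariant under one of them have the same powers
there. -/
lemma pow_mulVec_congr {M N : Matrix ι ι ℝ} {Y : Submodule ℝ (ι → ℝ)}
    (hN : ∀ y ∈ Y, N *ᵥ y ∈ Y) (h : ∀ y ∈ Y, M *ᵥ y = N *ᵥ y) {x : ι → ℝ} (hx : x ∈ Y) (k : ℕ) :
    (M ^ k) *ᵥ x = (N ^ k) *ᵥ x ∧ (N ^ k) *ᵥ x ∈ Y := by
  induction k with
  | zero => simpa using hx
  | succ k ih =>
    rw [pow_succ', pow_succ', ← mulVec_mulVec, ← mulVec_mulVec, ih.1, h _ ih.2]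
    exact ⟨rfl, hN _ ih.2⟩

/-- Used to pass between the uncontrolled and the controlled system, or between two closed loops, on
a subspace where they coincide. -/
lemma SpectrallyIn.congr {R : Set ℂ} {M N : Matrix ι ι ℝ} {Y : Submodule ℝ (ι → ℝ)}
    (hN : ∀ y ∈ Y, N *ᵥ y ∈ Y) (h : ∀ y ∈ Y, M *ᵥ y = N *ᵥ y) {x : ι → ℝ} (hx : x ∈ Y) :
    SpectrallyIn R M x ↔ SpectrallyIn R N x := by
  have := aeval_mulVec_congr fun k => (pow_mulVec_congr hN h hx k).1
  simp only [SpectrallyIn, this]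

lemma aeval_mulVec_mem {N : Matrix ι ι ℝ} {Y : Submodule ℝ (ι → ℝ)}
    (hN : ∀ y ∈ Y, N *ᵥ y ∈ Y) {x : ι → ℝ} (hx : x ∈ Y) (p : ℝ[X]) : aeval N p *ᵥ x ∈ Y := by
  induction p using Polynomial.induction_on' with
  | add p q hp hq => rw [map_add, add_mulVec]; exact Y.add_mem hp hq
  | monomial k a =>
    rw [aeval_monomial, ← Algebra.smul_def, smul_mulVec]
    exact Y.smul_mem _ (pow_mulVec_congr hN (fun _ _ => rfl) hx k).2

/-! ### Powers beyond the dimension -/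

/-- Cayley–Hamilton: higher powers reduce modulo the characteristic polynomial to powers below the
dimension. -/
lemma pow_mulVec_mem_of_forall_lt {M : Matrix ι ι ℝ} {V : Submodule ℝ (ι → ℝ)} {x : ι → ℝ}
    (h : ∀ k < Fintype.card ι, (M ^ k) *ᵥ x ∈ V) (k : ℕ) : (M ^ k) *ᵥ x ∈ V := by
  rw [pow_eq_aeval_mod_charpoly]
  -- The empty index type, where a remainder cannot have degree strictly below 0.
  by_cases h1 : M.charpoly = 1
  · rw [h1]; simp
  have hdeg : (X ^ k %ₘ M.charpoly).natDegree < Fintype.card ι := by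
    rw [← charpoly_natDegree_eq_dim M]
    exact natDegree_modByMonic_lt _ (charpoly_monic M) h1
  rw [aeval_eq_sum_range' hdeg, sum_mulVec]
  refine V.sum_mem fun i hi => ?_
  rw [smul_mulVec]
  exact V.smul_mem _ (h i (Finset.mem_range.mp hi))

lemma mem_invariantCore {V : Submodule ℝ (ι → ℝ)} {M : Matrix ι ι ℝ} {x : ι → ℝ} :
    x ∈ invariantCore V M ↔ ∀ k : ℕ, (M ^ k) *ᵥ x ∈ V := by
  unfold invariantCore
  simp only [Submodule.mem_iInf, Submodule.mem_comap, mulVecLin_apply]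
  exact ⟨fun h => pow_mulVec_mem_of_forall_lt fun k hk => h ⟨k, hk⟩, fun h k => h k⟩

end Matrices

/-! ### Complexification -/

/-- The complexification of a real vector. -/
def vecC {ι : Type*} (x : ι → ℝ) : ι → ℂ := fun i => (x i : ℂ)

/-- The complexification of a real matrix. -/
noncomputable def matC {ι κ : Type*} (M : Matrix ι κ ℝ) : Matrix ι κ ℂ := M.map (algebraMap ℝ ℂ)

section Complex

variable {ι κ μ : Type*} [Fintype ι] [DecidableEq ι] [Fintype κ] [DecidableEq κ] [Fintype μ]

lemma matC_mul (M : Matrix ι κ ℝ) (N : Matrix κ μ ℝ) : matC (M * N) = matC M * matC N :=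
  Matrix.map_mul

lemma matC_add (M N : Matrix ι κ ℝ) : matC (M + N) = matC M + matC N :=
  Matrix.map_add _ (map_add _) _ _

lemma matC_sub (M N : Matrix ι κ ℝ) : matC (M - N) = matC M - matC N :=
  Matrix.map_sub _ (map_sub _) _ _

lemma matC_transpose (M : Matrix ι κ ℝ) : matC Mᵀ = (matC M)ᵀ := rfl

lemma matC_conjTranspose (M : Matrix ι κ ℝ) : (matC M)ᴴ = matC Mᵀ := by
  ext i j; simp [matC]

lemma matC_mulVec_vecC (M : Matrix ι κ ℝ) (x : κ → ℝ) : matC M *ᵥ vecC x = vecC (M *ᵥ x) := by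
  ext i; simp [matC, vecC, mulVec, dotProduct]

lemma vecC_injective : Function.Injective (vecC : (ι → ℝ) → ι → ℂ) := fun x y h => by
  ext i; simpa [vecC] using congrFun h i

lemma vecC_eq_zero {x : ι → ℝ} : vecC x = 0 ↔ x = 0 := by
  refine ⟨fun h => vecC_injective (h.trans ?_), fun h => ?_⟩
  · ext; simp [vecC]
  · subst h; ext; simp [vecC]

lemma exists_eq_vecC_add (v : ι → ℂ) : ∃ a b : ι → ℝ, v = vecC a + Complex.I • vecC b :=
  ⟨fun i => (v i).re, fun i => (v i).im, by
    ext i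
    simp only [vecC, Pi.add_apply, Pi.smul_apply, smul_eq_mul]
    rw [mul_comm, Complex.re_add_im]⟩

lemma aeval_matC (M : Matrix ι ι ℝ) (p : ℝ[X]) :
    aeval (matC M) (p.map (algebraMap ℝ ℂ)) = matC (aeval M p) := by
  have h : ∀ N : Matrix ι ι ℝ, matC N = (algebraMap ℝ ℂ).mapMatrix N := fun _ => rfl
  rw [aeval_map_algebraMap, h, h]
  exact aeval_algHom_apply ((Algebra.ofId ℝ ℂ).mapMatrix) M p

/-- Induction over the complex roots of an annihilating polynomial. -/
lemma induction_on_roots {A : Matrix ι ι ℂ} {R : Set ℂ} {P : (ι → ℂ) → Prop} (h0 : P 0)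
    (hstep : ∀ z ∈ R, ∀ v, P (A *ᵥ v - z • v) → P v) :
    ∀ p : ℂ[X], p ≠ 0 → (∀ z, p.IsRoot z → z ∈ R) → ∀ v, aeval A p *ᵥ v = 0 → P v := by
  intro p
  induction hn : p.natDegree generalizing p with
  | zero =>
    intro hp _ v hv
    rw [eq_C_of_natDegree_eq_zero hn] at hv hp
    have hc : p.coeff 0 ≠ 0 := fun h => hp (by rw [h, C_0])
    rw [aeval_C, Algebra.algebraMap_eq_smul_one, smul_mulVec, one_mulVec] at hv
    rw [(smul_eq_zero.mp hv).resolve_left hc]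
    exact h0
  | succ n ih =>
    intro hp hR v hv
    obtain ⟨z, hz⟩ := IsAlgClosed.exists_root p
      (by rw [degree_eq_natDegree hp, hn]; exact_mod_cast Nat.succ_ne_zero n)
    obtain ⟨q, rfl⟩ := dvd_iff_isRoot.mpr hz
    have hq : q ≠ 0 := right_ne_zero_of_mul hp
    refine hstep z (hR z hz) v (ih q ?_ hq (fun w hw => hR w ?_) _ ?_)
    · rw [natDegree_mul (X_sub_C_ne_zero z) hq, natDegree_X_sub_C] at hn
      omega
    · rw [IsRoot, eval_mul, hw.eq_zero, mul_zero]
    · have : A *ᵥ v - z • v = aeval A (X - C z) *ᵥ v := by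
        rw [map_sub, aeval_X, aeval_C, Algebra.algebraMap_eq_smul_one, sub_mulVec, smul_mulVec,
          one_mulVec]
      rw [this, mulVec_mulVec, ← map_mul, mul_comm, hv]

lemma RootsIn.map {R : Set ℂ} {p : ℝ[X]} (hp : RootsIn R p) (z : ℂ)
    (hz : (p.map (algebraMap ℝ ℂ)).IsRoot z) : z ∈ R :=
  hp z (by rwa [IsRoot, eval_map_algebraMap] at hz)

lemma RootsIn.ne_zero {R : Set ℂ} {p : ℝ[X]} (hp : RootsIn R p) (hR : R ≠ Set.univ) : p ≠ 0 := by
  rintro rfl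
  exact hR (Set.eq_univ_of_forall fun z => hp z (map_zero _))

lemma setOf_re_neg_ne_univ : {z : ℂ | z.re < 0} ≠ Set.univ := fun h => by
  have := h.symm ▸ Set.mem_univ (1 : ℂ)
  simp at this; linarith

lemma setOf_re_nonpos_ne_univ : {z : ℂ | z.re ≤ 0} ≠ Set.univ := fun h => by
  have := h.symm ▸ Set.mem_univ (1 : ℂ)
  simp at this; linarith

/-! ### Eigenvectors -/

lemma aeval_charpoly_eq_zero_iff (M : Matrix ι ι ℝ) (z : ℂ) :
    aeval z M.charpoly = 0 ↔ ∃ v, v ≠ 0 ∧ matC M *ᵥ v = z • v := by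
  have h1 : aeval z M.charpoly = (matC M).charpoly.eval z := by
    rw [matC, charpoly_map, eval_map_algebraMap]
  rw [h1, eval_charpoly, ← exists_mulVec_eq_zero_iff]
  refine exists_congr fun v => and_congr_right fun _ => ?_
  rw [sub_mulVec, sub_eq_zero, eq_comm, scalar_apply, ← smul_one_eq_diagonal, smul_mulVec,
    one_mulVec]

lemma rootsIn_charpoly_iff {R : Set ℂ} {M : Matrix ι ι ℝ} :
    RootsIn R M.charpoly ↔ ∀ z v, v ≠ 0 → matC M *ᵥ v = z • v → z ∈ R := by
  simp only [RootsIn, aeval_charpoly_eq_zero_iff]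
  exact ⟨fun h z v hv hz => h z ⟨v, hv, hz⟩, fun h z ⟨v, hv, hz⟩ => h z v hv hz⟩

/-- The real and imaginary parts of a complex eigenvector are killed by polynomials with roots in
`R`. Their product kills the eigenvector, so it vanishes at the eigenvalue. -/
lemma rootsIn_charpoly_of_forall {R : Set ℂ} {M : Matrix ι ι ℝ} (h : ∀ x, SpectrallyIn R M x) :
    RootsIn R M.charpoly := by
  rw [rootsIn_charpoly_iff]
  intro z v hv hz
  obtain ⟨a, b, rfl⟩ := exists_eq_vecC_add v
  obtain ⟨p, hp, hpa⟩ := h a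
  obtain ⟨q, hq, hqb⟩ := h b
  refine hp.mul hq z ?_
  set v := vecC a + Complex.I • vecC b
  have h1 : matC (aeval M (p * q)) *ᵥ v = 0 := by
    rw [mulVec_add, mulVec_smul, matC_mulVec_vecC, matC_mulVec_vecC, aeval_mul_mulVec,
      aeval_mul_mulVec, hqb, aeval_mulVec_comm, hpa]
    simp [vecC_eq_zero.mpr rfl]
  rw [← aeval_matC] at h1
  have h2 : ∀ P : ℂ[X], aeval (matC M) P *ᵥ v = P.eval z • v := by
    intro P
    induction P using Polynomial.induction_on' with
    | add p q hp hq => rw [map_add, add_mulVec, hp, hq, eval_add, add_smul]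
    | monomial k c =>
      have : (matC M ^ k) *ᵥ v = z ^ k • v := by
        induction k with
        | zero => simp
        | succ k ih => rw [pow_succ, ← mulVec_mulVec, hz, mulVec_smul, ih, smul_smul, pow_succ']
      rw [aeval_monomial, ← Algebra.smul_def, smul_mulVec, this, eval_monomial, smul_smul]
  rw [h2] at h1
  rw [← eval_map_algebraMap]
  exact (smul_eq_zero.mp h1).resolve_right hv

lemma rootsIn_charpoly_transpose {R : Set ℂ} {M : Matrix ι ι ℝ} :
    RootsIn R Mᵀ.charpoly ↔ RootsIn R M.charpoly := by rw [charpoly_transpose]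

lemma rootsIn_charpoly_neg {R : Set ℂ} {M : Matrix ι ι ℝ} :
    RootsIn R (-M).charpoly ↔ RootsIn {z | -z ∈ R} M.charpoly := by
  have h : matC (-M) = -matC M := by ext; simp [matC]
  rw [rootsIn_charpoly_iff, rootsIn_charpoly_iff, h]
  constructor
  · intro H z v hv hz
    exact H (-z) v hv (by rw [neg_mulVec, hz, neg_smul])
  · intro H z v hv hz
    have := H (-z) v hv (by rw [neg_smul, ← hz, neg_mulVec, neg_neg])
    simpa using this

lemma rootsIn_charpoly_fromBlocks {R : Set ℂ} {A : Matrix ι ι ℝ} {B : Matrix ι κ ℝ}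
    {D : Matrix κ κ ℝ} (hA : RootsIn R A.charpoly) (hD : RootsIn R D.charpoly) :
    RootsIn R (fromBlocks A B 0 D).charpoly := by
  rw [charpoly_fromBlocks_zero₂₁]
  exact hA.mul hD

/-! ### Sylvester equations -/

/-- A solution intertwines `M` with `-N`, whose characteristic polynomials are coprime. Bezout then
writes `Y` as a sum of two vanishing terms. -/
lemma eq_zero_of_sylvester {R S : Set ℂ} {M : Matrix ι ι ℝ} {N : Matrix κ κ ℝ}
    (hM : RootsIn R M.charpoly) (hN : RootsIn S N.charpoly)
    (hRS : ∀ z ∈ R, ∀ w ∈ S, z + w ≠ 0) {Y : Matrix ι κ ℝ} (h : M * Y + Y * N = 0) : Y = 0 := by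
  have h1 : M * Y = Y * -N := by rw [Matrix.mul_neg]; exact eq_neg_of_add_eq_zero_left h
  have hN' : RootsIn {z | -z ∈ S} (-N).charpoly := rootsIn_charpoly_neg.mpr (by simpa using hN)
  obtain ⟨a, b, hab⟩ := hM.isCoprime hN' (Set.disjoint_left.mpr fun z hz hw => hRS z hz (-z) hw (by ring))
  have h2 : aeval M (a * M.charpoly + b * (-N).charpoly) * Y = Y := by rw [hab]; simp
  rw [map_add, map_mul, map_mul, aeval_self_charpoly, Matrix.add_mul, Matrix.mul_assoc _ _ Y,
    Matrix.mul_assoc _ _ Y, aeval_intertwine h1, aeval_self_charpoly] at h2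
  simpa using h2.symm

lemma existsUnique_sylvester {R S : Set ℂ} {M : Matrix ι ι ℝ} {N : Matrix κ κ ℝ}
    (hM : RootsIn R M.charpoly) (hN : RootsIn S N.charpoly)
    (hRS : ∀ z ∈ R, ∀ w ∈ S, z + w ≠ 0) (T : Matrix ι κ ℝ) :
    ∃ Y₀, ∀ Y : Matrix ι κ ℝ, M * Y + Y * N = T ↔ Y = Y₀ := by
  let f : Matrix ι κ ℝ →ₗ[ℝ] Matrix ι κ ℝ :=
    { toFun := fun Y => M * Y + Y * N
      map_add' := fun Y Z => by rw [Matrix.mul_add, Matrix.add_mul]; abel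
      map_smul' := fun c Y => by simp }
  have hf : Function.Injective f := by
    rw [← LinearMap.ker_eq_bot, LinearMap.ker_eq_bot']
    exact fun Y hY => eq_zero_of_sylvester hM hN hRS hY
  obtain ⟨Y₀, hY₀⟩ := (LinearMap.injective_iff_surjective.mp hf) T
  exact ⟨Y₀, fun Y => ⟨fun h => hf (h.trans hY₀.symm), fun h => h ▸ hY₀⟩⟩

/-! ### Limits of stable matrices -/

/-- Every root lies to the left of the imaginary axis, so each linear factor has modulus at least
`z.re`. The bound does not depend on the stable matrix and therefore passes to limits, without any
appeal to continuity of the roots. -/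
lemma pow_re_le_norm_aeval_charpoly {M : Matrix ι ι ℝ} (hM : RootsIn {z | z.re < 0} M.charpoly)
    {z : ℂ} (hz : 0 ≤ z.re) : z.re ^ Fintype.card ι ≤ ‖aeval z M.charpoly‖ := by
  have h1 : aeval z M.charpoly = (matC M).charpoly.eval z := by
    rw [matC, charpoly_map, eval_map_algebraMap]
  have h2 := (IsAlgClosed.splits (matC M).charpoly).eq_prod_roots_of_monic (charpoly_monic _)
  have hcard : (matC M).charpoly.roots.card = Fintype.card ι := by
    rw [← charpoly_natDegree_eq_dim (matC M)]
    exact (IsAlgClosed.splits (matC M).charpoly).natDegree_eq_card_roots.symm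
  have h3 : ∀ w ∈ (matC M).charpoly.roots, w.re < 0 := by
    intro w hw
    refine hM.map w ?_
    have := isRoot_of_mem_roots hw
    rwa [matC, charpoly_map] at this
  rw [h1, h2, eval_multiset_prod, ← hcard]
  generalize (matC M).charpoly.roots = s at h3
  induction s using Multiset.induction_on with
  | empty => simp
  | cons a s ih =>
    have ha := h3 a (Multiset.mem_cons_self a s)
    have ih' := ih fun w hw => h3 w (Multiset.mem_cons_of_mem hw)
    rw [Multiset.card_cons, pow_succ', Multiset.map_cons, Multiset.map_cons, Multiset.prod_cons,
      norm_mul]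
    refine mul_le_mul ?_ ih' (pow_nonneg hz _) (norm_nonneg _)
    calc z.re ≤ (z - a).re := by rw [Complex.sub_re]; linarith
      _ ≤ ‖z - a‖ := Complex.re_le_norm _
      _ = _ := by simp

lemma rootsIn_charpoly_of_tendsto {M : ℕ → Matrix ι ι ℝ} {N : Matrix ι ι ℝ}
    (hM : ∀ k, RootsIn {z | z.re < 0} (M k).charpoly) (h : Tendsto M atTop (𝓝 N)) :
    RootsIn {z | z.re ≤ 0} N.charpoly := by
  intro z hz
  by_contra hpos
  simp only [Set.mem_ofPred_eq, not_le] at hpos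
  have h1 : ∀ M : Matrix ι ι ℝ, aeval z M.charpoly = (scalar ι z - matC M).det := by
    intro M
    rw [← eval_charpoly, matC, charpoly_map, eval_map_algebraMap]
  have hcont : Continuous fun M : Matrix ι ι ℝ => aeval z M.charpoly := by
    simp only [h1]
    refine Continuous.matrix_det (continuous_const.sub ?_)
    exact continuous_id.matrix_map (Complex.continuous_ofReal)
  have h2 : Tendsto (fun k => ‖aeval z (M k).charpoly‖) atTop (𝓝 ‖aeval z N.charpoly‖) :=
    ((hcont.tendsto N).comp h).norm
  have h3 := ge_of_tendsto' h2 fun k => pow_re_le_norm_aeval_charpoly (hM k) hpos.le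
  rw [hz, norm_zero] at h3
  exact absurd h3 (not_le.mpr (pow_pos hpos _))

end Complex

/-! ### Linear flows -/

section Flow

variable {ι κ : Type*} [Fintype ι] [DecidableEq ι] [Fintype κ] [DecidableEq κ]

/-- The matrix exponential `exp (t A)`. -/
noncomputable def flow (A : Matrix ι ι ℝ) (t : ℝ) : Matrix ι ι ℝ := NormedSpace.exp (t • A)

lemma flow_zero (A : Matrix ι ι ℝ) : flow A 0 = 1 := by
  rw [flow, zero_smul, NormedSpace.exp_zero]

section Norm

attribute [local instance] Matrix.linftyOpNormedRing Matrix.linftyOpNormedAlgebra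

lemma hasDerivAt_flow_apply (A : Matrix ι ι ℝ) (t : ℝ) (f : Matrix ι ι ℝ →ₗ[ℝ] ℝ) :
    HasDerivAt (fun s => f (flow A s)) (f (A * flow A t)) t :=
  (LinearMap.toContinuousLinearMap f).hasFDerivAt.comp_hasDerivAt t
    (hasDerivAt_exp_smul_const' (𝕂 := ℝ) A t)

lemma hasSum_flow (A : Matrix ι ι ℝ) (t : ℝ) :
    HasSum (fun k : ℕ => ((k.factorial : ℝ)⁻¹ * t ^ k) • A ^ k) (flow A t) := by
  have := NormedSpace.exp_series_hasSum_exp' (𝕂 := ℝ) (t • A)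
  simp only [_root_.smul_pow, smul_smul] at this
  exact this

end Norm

lemma hasDerivAt_flow (A : Matrix ι ι ℝ) (t : ℝ) (i j : ι) :
    HasDerivAt (fun s => flow A s i j) ((A * flow A t) i j) t :=
  hasDerivAt_flow_apply A t (entryLinearMap ℝ ℝ i j)

lemma hasDerivAt_flow_mulVec (A : Matrix ι ι ℝ) (v : ι → ℝ) (t : ℝ) :
    HasDerivAt (fun s => flow A s *ᵥ v) (A *ᵥ (flow A t *ᵥ v)) t := by
  rw [hasDerivAt_pi]
  intro i
  simp only [mulVec_mulVec]
  simp only [mulVec, dotProduct]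
  exact HasDerivAt.fun_sum fun j _ => (hasDerivAt_flow A t i j).mul_const (v j)

lemma continuous_flow_mulVec (A : Matrix ι ι ℝ) (v : ι → ℝ) :
    Continuous fun s => flow A s *ᵥ v :=
  continuous_iff_continuousAt.mpr fun t => (hasDerivAt_flow_mulVec A v t).continuousAt

lemma flow_intertwine {M : Matrix ι ι ℝ} {N : Matrix κ κ ℝ} {Y : Matrix ι κ ℝ}
    (h : M * Y = Y * N) (t : ℝ) : flow M t * Y = Y * flow N t := by
  have hp : ∀ k : ℕ, M ^ k * Y = Y * N ^ k := fun k => by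
    simpa using aeval_intertwine h (X ^ k)
  have h1 := (hasSum_flow M t).map (_root_.mulRightLinearMap ι ℝ Y)
    (continuous_id.matrix_mul continuous_const)
  have h2 := (hasSum_flow N t).map (_root_.mulLeftLinearMap κ ℝ Y)
    (continuous_const.matrix_mul continuous_id)
  refine h1.unique ?_
  convert h2 using 1
  · ext k : 1
    simp [hp]
  · rfl

lemma flow_mulVec_mem {A : Matrix ι ι ℝ} {Y : Submodule ℝ (ι → ℝ)}
    (hA : ∀ y ∈ Y, A *ᵥ y ∈ Y) {x : ι → ℝ} (hx : x ∈ Y) (t : ℝ) : flow A t *ᵥ x ∈ Y := by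
  have h1 := (hasSum_flow A t).map ((mulVecBilin ℝ ℝ).flip x)
    (continuous_id.matrix_mulVec continuous_const)
  refine Y.closed_of_finiteDimensional.mem_of_tendsto h1 (Eventually.of_forall fun s => ?_)
  refine Y.sum_mem fun k _ => ?_
  simp only [Function.comp_apply, map_smul]
  exact Y.smul_mem _ (pow_mulVec_congr hA (fun _ _ => rfl) hx k).2

/-! ### Decay -/

/-- Variation of constants for a scalar decay rate: a decaying forcing term leaves a decaying
solution. -/
lemma tendsto_zero_of_deriv_eq {E : Type*} [NormedAddCommGroup E] [NormedSpace ℂ E]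
    {f g : ℝ → E} {z : ℂ} (hz : z.re < 0) (hf : ∀ t, HasDerivAt f (z • f t + g t) t)
    (hg : Tendsto g atTop (𝓝 0)) : Tendsto f atTop (𝓝 0) := by
  set b := -z.re with hb
  have hb0 : 0 < b := by linarith
  have key : ∀ ε > 0, ∀ T, (∀ t ≥ T, ‖g t‖ ≤ ε) → ∀ t ≥ T,
      ‖f t‖ ≤ Real.exp (-(b * (t - T))) * ‖f T‖ + ε / b := by
    intro ε hε T hT t ht
    let φ : ℝ → E := fun s => Complex.exp (-(z * s)) • f s
    have hφ : ∀ s : ℝ, HasDerivAt φ (Complex.exp (-(z * s)) • g s) s := by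
      intro s
      have h1 : HasDerivAt (fun s : ℝ => Complex.exp (-(z * (s : ℂ))))
          (Complex.exp (-(z * (s : ℂ))) * (-(z * 1))) s :=
        (((hasDerivAt_id s).ofReal_comp.const_mul z).neg).cexp
      convert! h1.smul (hf s) using 1
      rw [smul_add, smul_smul]
      module
    have hn : ∀ s : ℝ, ‖Complex.exp (-(z * s))‖ = Real.exp (b * s) := by
      intro s
      rw [Complex.norm_exp]
      congr 1
      simp [hb]
    have h2 : ∀ s ∈ Set.Icc T t, ‖φ s - φ T‖ ≤
        ε / b * (Real.exp (b * s) - Real.exp (b * T)) := by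
      refine image_norm_le_of_norm_deriv_right_le_deriv_boundary (f := fun s => φ s - φ T)
        (f' := fun s => Complex.exp (-(z * s)) • g s)
        (B' := fun s => ε * Real.exp (b * s))
        (fun s _ => ((hφ s).sub_const _).continuousAt.continuousWithinAt)
        (fun s _ => ((hφ s).sub_const _).hasDerivWithinAt) (by simp) (fun s => ?_) ?_
      · have h := (((hasDerivAt_id s).const_mul b).exp.sub_const
          (Real.exp (b * T))).const_mul (ε / b)
        simp only [id] at h
        convert! h using 1
        field_simp
      · intro s hs
        rw [norm_smul, hn, mul_comm]
        exact mul_le_mul_of_nonneg_right (hT s hs.1) (Real.exp_pos _).le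
    have h3 := h2 t ⟨ht, le_rfl⟩
    have h4 : ‖φ t‖ ≤ ‖φ T‖ + ε / b * Real.exp (b * t) := by
      have := norm_le_insert' (φ t) (φ T)
      have h5 : 0 ≤ ε / b * Real.exp (b * T) := by positivity
      linarith
    simp only [φ, norm_smul, hn] at h4
    have h6 : Real.exp (-(b * (t - T))) = Real.exp (b * T) / Real.exp (b * t) := by
      rw [← Real.exp_sub]; congr 1; ring
    have h7 := Real.exp_pos (b * t)
    rw [h6]
    have h8 : ‖f t‖ = (Real.exp (b * t) * ‖f t‖) / Real.exp (b * t) := by field_simp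
    rw [h8]
    calc _ ≤ (Real.exp (b * T) * ‖f T‖ + ε / b * Real.exp (b * t)) / Real.exp (b * t) := by
          gcongr
      _ = _ := by field_simp
  rw [Metric.tendsto_atTop]
  intro ε hε
  -- Dividing this bound by `b` leaves `ε / 4` for the forced part; the free part is made smaller
  -- than `ε / 2`.
  obtain ⟨T, hT⟩ := Metric.tendsto_atTop.mp hg (ε / 2 * b / 2) (by positivity)
  have h1 := key (ε / 2 * b / 2) (by positivity) T
    (fun t ht => by have := hT t ht; rw [dist_zero_right] at this; exact this.le)
  have h2 : Tendsto (fun t => Real.exp (-(b * (t - T))) * ‖f T‖) atTop (𝓝 0) := by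
    have h3 : Tendsto (fun t => b * (t - T)) atTop atTop :=
      (tendsto_atTop_add_const_right _ (-T) tendsto_id).const_mul_atTop hb0
    simpa using (Real.tendsto_exp_neg_atTop_nhds_zero.comp h3).mul_const ‖f T‖
  obtain ⟨T', hT'⟩ := Metric.tendsto_atTop.mp h2 (ε / 2) (by positivity)
  refine ⟨max T T', fun t ht => ?_⟩
  have h4 := h1 t (le_of_max_le_left ht)
  have h5 := hT' t (le_of_max_le_right ht)
  rw [dist_zero_right, Real.norm_eq_abs] at h5
  rw [dist_zero_right]
  have h6 : ε / 2 * b / 2 / b = ε / 4 := by field_simp; norm_num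
  rw [h6] at h4
  linarith [le_abs_self (Real.exp (-(b * (t - T))) * ‖f T‖)]

/-- Peeling off one root `z` at a time: exp(tA)v solves a scalar equation with rate `z` and forcing
exp(tA)(A - z)v, which decays by induction. No Jordan form is needed. -/
lemma tendsto_flow_of_spectrallyIn {A : Matrix ι ι ℝ} {x : ι → ℝ}
    (hx : SpectrallyIn {z | z.re < 0} A x) : Tendsto (fun t => flow A t *ᵥ x) atTop (𝓝 0) := by
  obtain ⟨p, hp, hpx⟩ := hx
  have key : Tendsto (fun t => matC (flow A t) *ᵥ vecC x) atTop (𝓝 0) := by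
    refine induction_on_roots (A := matC A) (R := {z | z.re < 0})
      (P := fun v => Tendsto (fun t => matC (flow A t) *ᵥ v) atTop (𝓝 0)) ?_ ?_
      (p.map (algebraMap ℝ ℂ)) ?_ hp.map _ ?_
    · simp
    · intro z hz v hv
      refine tendsto_zero_of_deriv_eq hz (fun t => ?_) hv
      have h1 : z • matC (flow A t) *ᵥ v + matC (flow A t) *ᵥ (matC A *ᵥ v - z • v) =
          matC (A * flow A t) *ᵥ v := by
        rw [mulVec_sub, mulVec_smul, add_sub_cancel, mulVec_mulVec, ← matC_mul,
          flow_intertwine (rfl : A * A = A * A)]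
      rw [h1, hasDerivAt_pi]
      intro i
      simp only [mulVec, dotProduct]
      exact HasDerivAt.fun_sum fun j _ => ((hasDerivAt_flow A t i j).ofReal_comp).mul_const (v j)
    · exact (Polynomial.map_ne_zero_iff (algebraMap ℝ ℂ).injective).mpr
        (hp.ne_zero setOf_re_neg_ne_univ)
    · rw [aeval_matC, matC_mulVec_vecC, hpx, vecC_eq_zero]
  rw [tendsto_pi_nhds] at key ⊢
  intro i
  have := (Complex.continuous_re.tendsto 0).comp (key i)
  simpa [matC_mulVec_vecC, vecC, Function.comp_def] using this

lemma tendsto_flow {A : Matrix ι ι ℝ} (hA : RootsIn {z | z.re < 0} A.charpoly) (x : ι → ℝ) :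
    Tendsto (fun t => flow A t *ᵥ x) atTop (𝓝 0) :=
  tendsto_flow_of_spectrallyIn (spectrallyIn_of_charpoly hA x)

/-! ### Lyapunov inequalities -/

lemma hasDerivAt_quadForm {x : ℝ → ι → ℝ} {x' : ι → ℝ} {t : ℝ} (S : Matrix ι ι ℝ)
    (hx : HasDerivAt x x' t) :
    HasDerivAt (fun s => x s ⬝ᵥ S *ᵥ x s) (x' ⬝ᵥ S *ᵥ x t + x t ⬝ᵥ S *ᵥ x') t := by
  rw [hasDerivAt_pi] at hx
  simp only [dotProduct, mulVec, ← Finset.sum_add_distrib]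
  refine HasDerivAt.fun_sum fun i _ => ?_
  exact (hx i).mul (HasDerivAt.fun_sum fun j _ => (hx j).const_mul (S i j))

lemma tendsto_quadForm {x : ℝ → ι → ℝ} (S : Matrix ι ι ℝ) (hx : Tendsto x atTop (𝓝 0)) :
    Tendsto (fun t => x t ⬝ᵥ S *ᵥ x t) atTop (𝓝 0) := by
  have hc : Continuous fun y : ι → ℝ => y ⬝ᵥ S *ᵥ y :=
    continuous_id.dotProduct (continuous_const.matrix_mulVec continuous_id)
  have := (hc.tendsto 0).comp hx
  simpa [Function.comp_def] using this

/-- If the quadratic form of `S` does not increase along a decaying trajectory, it is nonnegative at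
the start. -/
lemma quadForm_nonneg_of_decay {A S : Matrix ι ι ℝ} {x : ι → ℝ}
    (hx : SpectrallyIn {z | z.re < 0} A x)
    (h : ∀ t : ℝ, (flow A t *ᵥ x) ⬝ᵥ (Aᵀ * S + S * A) *ᵥ (flow A t *ᵥ x) ≤ 0) :
    0 ≤ x ⬝ᵥ S *ᵥ x := by
  have h1 : Antitone fun t => (flow A t *ᵥ x) ⬝ᵥ S *ᵥ (flow A t *ᵥ x) := by
    have hd := fun t => hasDerivAt_quadForm S (hasDerivAt_flow_mulVec A x t)
    refine antitone_of_deriv_nonpos (fun t => (hd t).differentiableAt) fun t => ?_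
    rw [(hd t).deriv]
    refine le_of_eq_of_le ?_ (h t)
    rw [add_mulVec, dotProduct_add, ← mulVec_mulVec, ← mulVec_mulVec, dotProduct_mulVec _ Aᵀ,
      vecMul_transpose]
  have h2 := tendsto_quadForm S (tendsto_flow_of_spectrallyIn hx)
  have h3 := h1.le_of_tendsto h2 0
  simpa [flow_zero] using h3

lemma posSemidef_iff_real {S : Matrix ι ι ℝ} :
    S.PosSemidef ↔ S.IsSymm ∧ ∀ x, 0 ≤ x ⬝ᵥ S *ᵥ x := by
  rw [posSemidef_iff_dotProduct_mulVec]
  simp [IsHermitian, IsSymm, conjTranspose_eq_transpose_of_trivial]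

lemma posSemidef_of_lyapunov {A S : Matrix ι ι ℝ} (hA : RootsIn {z | z.re < 0} A.charpoly)
    (hS : S.IsSymm) (h : ∀ x, x ⬝ᵥ (Aᵀ * S + S * A) *ᵥ x ≤ 0) : S.PosSemidef :=
  posSemidef_iff_real.mpr ⟨hS, fun x =>
    quadForm_nonneg_of_decay (spectrallyIn_of_charpoly hA x) fun _ => h _⟩

/-- The Lyapunov equation of a stable matrix. -/
lemma existsUnique_lyapunov {A : Matrix ι ι ℝ} (hA : RootsIn {z | z.re < 0} A.charpoly)
    {T : Matrix ι ι ℝ} (hT : T.IsSymm) : ∃ S, S.IsSymm ∧ Aᵀ * S + S * A = T := by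
  obtain ⟨S, hS⟩ := existsUnique_sylvester (rootsIn_charpoly_transpose.mpr hA) hA
    (fun z hz w hw h => by
      have := congrArg Complex.re h
      simp only [Set.mem_ofPred_eq, Complex.add_re, Complex.zero_re] at hz hw this
      linarith) T
  have h1 := (hS S).mpr rfl
  refine ⟨S, ?_, h1⟩
  refine (hS Sᵀ).mp ?_
  have := congrArg transpose h1
  rw [hT, transpose_add, transpose_mul, transpose_mul, transpose_transpose] at this
  rw [← this, add_comm]

end Flow

/-! ### Riccati equations -/

section RiccatiTheory

variable {ι : Type*} [Fintype ι] [DecidableEq ι] {m : ℕ}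

/-- Some feedback makes the closed loop stable. -/
def HasStabilizer (A : Matrix ι ι ℝ) (B : Matrix ι (Fin m) ℝ) : Prop :=
  ∃ F : Matrix (Fin m) ι ℝ, RootsIn {z | z.re < 0} (A + B * F).charpoly

/-- The Hautus condition: no unstable left eigenvector is annihilated by the input matrix. -/
def HautusCondition (A : Matrix ι ι ℝ) (B : Matrix ι (Fin m) ℝ) : Prop :=
  ∀ z : ℂ, 0 ≤ z.re → ∀ w, (matC A)ᵀ *ᵥ w = z • w → (matC B)ᵀ *ᵥ w = 0 → w = 0

lemma HasStabilizer.hautus {A : Matrix ι ι ℝ} {B : Matrix ι (Fin m) ℝ} (h : HasStabilizer A B) :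
    HautusCondition A B := by
  obtain ⟨F, hF⟩ := h
  intro z hz w hA hB
  by_contra hw
  rw [← rootsIn_charpoly_transpose, rootsIn_charpoly_iff] at hF
  have := hF z w hw (by
    rw [transpose_add, transpose_mul, matC_add, matC_mul, add_mulVec, ← mulVec_mulVec,
      matC_transpose, matC_transpose B, hA, hB, mulVec_zero, add_zero])
  simp only [Set.mem_ofPred_eq] at this
  linarith

/-- Feedback changes Aᵀ only by a term that factors through Bᵀ, which vanishes on the vectors in
question. -/
lemma HautusCondition.closedLoop {A : Matrix ι ι ℝ} {B : Matrix ι (Fin m) ℝ}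
    (h : HautusCondition A B) (K : Matrix ι ι ℝ) : HautusCondition (closedLoop A B K) B := by
  intro z hz w hA hB
  refine h z hz w ?_ hB
  rw [← hA, _root_.closedLoop, matC_sub, transpose_sub, sub_mulVec, Matrix.mul_assoc, matC_mul,
    matC_mul, transpose_mul, transpose_mul, ← mulVec_mulVec, ← mulVec_mulVec, hB]
  simp

lemma re_star_dotProduct_matC (N : Matrix ι ι ℝ) (a b : ι → ℝ) :
    (star (vecC a + Complex.I • vecC b) ⬝ᵥ matC N *ᵥ (vecC a + Complex.I • vecC b)).re =
      a ⬝ᵥ N *ᵥ a + b ⬝ᵥ N *ᵥ b := by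
  have h1 : star (vecC a + Complex.I • vecC b) = vecC a - Complex.I • vecC b := by
    ext i; simp [vecC, sub_eq_add_neg]
  have h2 : ∀ x y : ι → ℝ, vecC x ⬝ᵥ vecC y = ((x ⬝ᵥ y : ℝ) : ℂ) := by
    intro x y; simp [vecC, dotProduct]
  rw [h1, mulVec_add, mulVec_smul, matC_mulVec_vecC, matC_mulVec_vecC]
  simp only [sub_dotProduct, dotProduct_add, smul_dotProduct, dotProduct_smul, h2, smul_eq_mul]
  simp

lemma star_dotProduct_matC_nonneg {S : Matrix ι ι ℝ} (hS : S.PosSemidef) (v : ι → ℂ) :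
    0 ≤ (star v ⬝ᵥ matC S *ᵥ v).re := by
  obtain ⟨a, b, rfl⟩ := exists_eq_vecC_add v
  rw [re_star_dotProduct_matC]
  have := (posSemidef_iff_real.mp hS).2
  exact add_nonneg (this a) (this b)

lemma star_mulVec_matC (N : Matrix ι ι ℝ) (v w : ι → ℂ) :
    star v ⬝ᵥ matC Nᵀ *ᵥ w = star (matC N *ᵥ v) ⬝ᵥ w := by
  rw [star_mulVec, matC_conjTranspose, dotProduct_mulVec]

lemma posDef_iff_real {S : Matrix ι ι ℝ} :
    S.PosDef ↔ S.IsSymm ∧ ∀ x, x ≠ 0 → 0 < x ⬝ᵥ S *ᵥ x := by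
  rw [posDef_iff_dotProduct_mulVec]
  simp [IsHermitian, IsSymm, conjTranspose_eq_transpose_of_trivial]

/-- Strict Lyapunov inequality implies stability. -/
lemma rootsIn_of_lyapunov_posDef {A S : Matrix ι ι ℝ} (hS : S.PosSemidef)
    (h : ∀ x, x ≠ 0 → x ⬝ᵥ (Aᵀ * S + S * A) *ᵥ x < 0) : RootsIn {z | z.re < 0} A.charpoly := by
  rw [rootsIn_charpoly_iff]
  intro z v hv hz
  -- On an eigenvector the Lyapunov form is `2 * z.re` times the form of `S`.
  have h1 : (star v ⬝ᵥ matC (Aᵀ * S + S * A) *ᵥ v).re = 2 * z.re * (star v ⬝ᵥ matC S *ᵥ v).re := by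
    rw [matC_add, matC_mul, matC_mul, add_mulVec, dotProduct_add, ← mulVec_mulVec,
      ← mulVec_mulVec, star_mulVec_matC, hz, mulVec_smul, star_smul, smul_dotProduct,
      dotProduct_smul]
    simp; ring
  have h2 : (star v ⬝ᵥ matC (Aᵀ * S + S * A) *ᵥ v).re < 0 := by
    obtain ⟨a, b, rfl⟩ := exists_eq_vecC_add v
    rw [re_star_dotProduct_matC]
    by_cases ha : a = 0
    · have hb : b ≠ 0 := by
        rintro rfl
        apply hv
        rw [ha, vecC_eq_zero.mpr rfl, smul_zero, add_zero]
      have := h b hb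
      simp only [ha, zero_dotProduct]
      linarith
    · by_cases hb : b = 0
      · have := h a ha
        simp only [hb, zero_dotProduct]
        linarith
      · linarith [h a ha, h b hb]
  have h3 := star_dotProduct_matC_nonneg hS v
  rw [h1] at h2
  by_contra hre
  simp only [Set.mem_ofPred_eq, not_lt] at hre
  have : 0 ≤ 2 * z.re * (star v ⬝ᵥ matC S *ᵥ v).re := by positivity
  linarith

open scoped ComplexOrder in
/-- A nonnegative solution of a Riccati equation vanishes on the unobservable vectors without
antistable component. -/
lemma mulVec_eq_zero_of_riccati {A D T : Matrix ι ι ℝ} {B : Matrix ι (Fin m) ℝ}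
    (hAB : HautusCondition A B) (hD : D.PosSemidef)
    (h : Aᵀ * D + D * A - D * B * Bᵀ * D + T = 0) {x : ι → ℝ}
    (hx : SpectrallyIn {z | z.re ≤ 0} A x) (hT : ∀ k : ℕ, T *ᵥ ((A ^ k) *ᵥ x) = 0) :
    D *ᵥ x = 0 := by
  obtain ⟨p, hp, hpx⟩ := hx
  have key : (∀ k : ℕ, matC T *ᵥ ((matC A ^ k) *ᵥ vecC x) = 0) → matC D *ᵥ vecC x = 0 := by
    refine induction_on_roots (A := matC A) (R := {z | z.re ≤ 0})
      (P := fun v => (∀ k : ℕ, matC T *ᵥ ((matC A ^ k) *ᵥ v) = 0) → matC D *ᵥ v = 0) ?_ ?_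
      (p.map (algebraMap ℝ ℂ)) ?_ hp.map _ ?_
    · simp
    · intro z hz v ih hv
      -- The induction hypothesis for `A v - z v` says that `D` sees `v` as an eigenvector of `A`.
      have h1 : matC D *ᵥ (matC A *ᵥ v) = z • (matC D *ᵥ v) := by
        have := ih fun k => by
          rw [mulVec_sub, mulVec_sub, mulVec_mulVec _ (matC A ^ k), ← pow_succ, hv, mulVec_smul,
            mulVec_smul, hv, smul_zero, sub_zero]
        rwa [mulVec_sub, mulVec_smul, sub_eq_zero] at this
      have h2 : matC Aᵀ *ᵥ (matC D *ᵥ v) + z • (matC D *ᵥ v) =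
          matC (D * B) *ᵥ (matC (Bᵀ * D) *ᵥ v) := by
        have h3 : matC (Aᵀ * D + D * A - D * B * Bᵀ * D + T) *ᵥ v = 0 := by
          rw [h]; ext; simp [matC, mulVec, dotProduct]
        rw [matC_add, matC_sub, matC_add, add_mulVec, sub_mulVec, add_mulVec, matC_mul Aᵀ,
          matC_mul D A, Matrix.mul_assoc (D * B), matC_mul (D * B), ← mulVec_mulVec,
          ← mulVec_mulVec, ← mulVec_mulVec, h1] at h3
        have h4 := hv 0
        rw [pow_zero, one_mulVec] at h4
        rw [h4, add_zero, sub_eq_zero] at h3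
        exact h3
      have hDs : Dᵀ = D := (posSemidef_iff_real.mp hD).1
      -- If `Bᵀ D v = 0`, then `D v` is an eigenvector of `Aᵀ` for `-z`, excluded by the Hautus
      -- condition unless it vanishes. Otherwise pairing with `v` gives `2 Re z · v*Dv = |Bᵀ D v|² >
      -- 0`, against `Re z ≤ 0` and `D ≥ 0`.
      by_cases hb : matC (Bᵀ * D) *ᵥ v = 0
      · rw [hb, mulVec_zero] at h2
        refine hAB (-z) ?_ _ ?_ ?_
        · simpa using hz
        · rw [neg_smul]; exact eq_neg_of_add_eq_zero_left h2
        · rw [mulVec_mulVec, ← matC_transpose, ← matC_mul, hb]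
      · exfalso
        have h5 : star v ⬝ᵥ (matC Aᵀ *ᵥ (matC D *ᵥ v)) =
            star z * (star v ⬝ᵥ matC D *ᵥ v) := by
          rw [star_mulVec_matC]
          conv_lhs => rw [← hDs]
          rw [star_mulVec_matC, h1, star_smul, smul_dotProduct, smul_eq_mul]
          conv_lhs => rw [← star_mulVec_matC, hDs]
        have h6 : star v ⬝ᵥ (matC (D * B) *ᵥ (matC (Bᵀ * D) *ᵥ v)) =
            star (matC (Bᵀ * D) *ᵥ v) ⬝ᵥ (matC (Bᵀ * D) *ᵥ v) := by
          rw [star_mulVec, dotProduct_mulVec, matC_conjTranspose, transpose_mul, hDs,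
            transpose_transpose]
        have h7 := congrArg (fun y => (star v ⬝ᵥ y).re) h2
        simp only [dotProduct_add, h5, h6, dotProduct_smul, smul_eq_mul] at h7
        have h8 : 0 < (star (matC (Bᵀ * D) *ᵥ v) ⬝ᵥ (matC (Bᵀ * D) *ᵥ v)).re := by
          have := dotProduct_star_self_pos_iff (v := matC (Bᵀ * D) *ᵥ v)
          exact (Complex.pos_iff.mp (this.mpr hb)).1
        have h9 := star_dotProduct_matC_nonneg hD v
        rw [← h7, ← add_mul] at h8
        have h10 : (star z + z) = ((2 * z.re : ℝ) : ℂ) := by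
          rw [add_comm]; exact Complex.add_conj z
        rw [h10, Complex.re_ofReal_mul] at h8
        simp only [Set.mem_ofPred_eq] at hz
        nlinarith
    · exact (Polynomial.map_ne_zero_iff (algebraMap ℝ ℂ).injective).mpr
        (hp.ne_zero setOf_re_nonpos_ne_univ)
    · rw [aeval_matC, matC_mulVec_vecC, hpx, vecC_eq_zero]
  have hpow : ∀ k : ℕ, (matC A ^ k) *ᵥ vecC x = vecC ((A ^ k) *ᵥ x) := by
    intro k
    induction k with
    | zero => simp
    | succ k ih => rw [pow_succ', ← mulVec_mulVec, ih, matC_mulVec_vecC, mulVec_mulVec, ← pow_succ']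
  have := key fun k => by rw [hpow, matC_mulVec_vecC, hT, vecC_eq_zero]
  rwa [matC_mulVec_vecC, vecC_eq_zero] at this

/-! ### Monotone sequences of symmetric matrices -/

/-- Polarization; it reduces equality and convergence of symmetric matrices to their quadratic
forms. -/
lemma apply_eq_quadForm {S : Matrix ι ι ℝ} (hS : S.IsSymm) (i j : ι) :
    S i j = ((Pi.single i 1 + Pi.single j 1 : ι → ℝ) ⬝ᵥ S *ᵥ (Pi.single i 1 + Pi.single j 1) -
      (Pi.single i 1 : ι → ℝ) ⬝ᵥ S *ᵥ Pi.single i 1 -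
      (Pi.single j 1 : ι → ℝ) ⬝ᵥ S *ᵥ Pi.single j 1) / 2 := by
  have := hS.apply i j
  simp only [mulVec_add, dotProduct_add, add_dotProduct, single_dotProduct, mulVec_single_one,
    one_mul, col_apply]
  linarith

lemma eq_of_quadForm_eq {S T : Matrix ι ι ℝ} (hS : S.IsSymm) (hT : T.IsSymm)
    (h : ∀ x, x ⬝ᵥ S *ᵥ x = x ⬝ᵥ T *ᵥ x) : S = T := by
  ext i j
  rw [apply_eq_quadForm hS, apply_eq_quadForm hT, h, h, h]

lemma exists_tendsto_of_antitone {P : ℕ → Matrix ι ι ℝ} {K : Matrix ι ι ℝ}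
    (hP : ∀ k, (P k).IsSymm) (hanti : ∀ k, (P k - P (k + 1)).PosSemidef)
    (hK : ∀ k, (P k - K).PosSemidef) : ∃ Y, Tendsto P atTop (𝓝 Y) := by
  have hq : ∀ x : ι → ℝ, ∃ l, Tendsto (fun k => x ⬝ᵥ P k *ᵥ x) atTop (𝓝 l) := by
    intro x
    refine ⟨_, tendsto_atTop_ciInf (antitone_nat_of_succ_le fun k => ?_) ⟨x ⬝ᵥ K *ᵥ x, ?_⟩⟩
    · have := (posSemidef_iff_real.mp (hanti k)).2 x
      rw [sub_mulVec, dotProduct_sub] at this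
      linarith
    · rintro _ ⟨k, rfl⟩
      have := (posSemidef_iff_real.mp (hK k)).2 x
      rw [sub_mulVec, dotProduct_sub] at this
      show x ⬝ᵥ K *ᵥ x ≤ x ⬝ᵥ P k *ᵥ x
      linarith
  choose l hl using hq
  refine ⟨of fun i j => (l (Pi.single i 1 + Pi.single j 1) - l (Pi.single i 1) -
    l (Pi.single j 1)) / 2, ?_⟩
  refine tendsto_pi_nhds.mpr fun i => tendsto_pi_nhds.mpr fun j => ?_
  simp only [apply_eq_quadForm (hP _) i j]
  exact (((hl _).sub (hl _)).sub (hl _)).div_const 2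

lemma isClosed_posSemidef : IsClosed {S : Matrix ι ι ℝ | S.PosSemidef} := by
  have h : {S : Matrix ι ι ℝ | S.PosSemidef} =
      {S | Sᵀ = S} ∩ ⋂ x : ι → ℝ, {S | 0 ≤ x ⬝ᵥ S *ᵥ x} := by
    ext S
    simp only [posSemidef_iff_real, IsSymm, Set.mem_inter_iff, Set.mem_iInter, Set.mem_ofPred_eq]
  rw [h]
  exact (isClosed_eq (continuous_id.matrix_transpose) continuous_id).inter
    (isClosed_iInter fun x => isClosed_le continuous_const
      (continuous_const.dotProduct (continuous_id.matrix_mulVec continuous_const)))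

lemma posSemidef_of_tendsto {P : ℕ → Matrix ι ι ℝ} {S : Matrix ι ι ℝ}
    (h : Tendsto P atTop (𝓝 S)) (hP : ∀ k, (P k).PosSemidef) : S.PosSemidef :=
  isClosed_posSemidef.mem_of_tendsto h (Eventually.of_forall hP)

end RiccatiTheory

/-! ### Stabilizing and maximal solutions by Newton's iteration. -/

section Kleinman

variable {ι : Type*} [Fintype ι] [DecidableEq ι] {m : ℕ}

lemma quadForm_transpose_mul_self {κ : Type*} [Fintype κ] (M : Matrix κ ι ℝ) (x : ι → ℝ) :
    x ⬝ᵥ (Mᵀ * M) *ᵥ x = (M *ᵥ x) ⬝ᵥ (M *ᵥ x) := by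
  rw [← mulVec_mulVec, dotProduct_mulVec, vecMul_transpose]

lemma dotProduct_self_nonneg' {κ : Type*} [Fintype κ] (x : κ → ℝ) : 0 ≤ x ⬝ᵥ x :=
  Finset.sum_nonneg fun i _ => mul_self_nonneg (x i)

lemma quadForm_mul_self_nonneg {κ : Type*} [Fintype κ] (M : Matrix κ ι ℝ) (x : ι → ℝ) :
    0 ≤ x ⬝ᵥ (Mᵀ * M) *ᵥ x := by
  rw [quadForm_transpose_mul_self]; exact dotProduct_self_nonneg' _

variable {A Q : Matrix ι ι ℝ} {B : Matrix ι (Fin m) ℝ}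

lemma closedLoop_eq_add (A : Matrix ι ι ℝ) (B : Matrix ι (Fin m) ℝ) (K : Matrix ι ι ℝ) :
    closedLoop A B K = A + B * (-(Bᵀ * K)) := by
  rw [closedLoop, Matrix.mul_neg, Matrix.mul_assoc, sub_eq_add_neg]

/-- Because of the minus sign before the square, `X - K` is a Lyapunov function for the closed loop
of `X` whenever φ(X) ≤ φ(K). -/
lemma lyapunov_closedLoop_sub {X K : Matrix ι ι ℝ} (hX : X.IsSymm) (hK : K.IsSymm) :
    (closedLoop A B X)ᵀ * (X - K) + (X - K) * closedLoop A B X =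
      riccati A B Q X - riccati A B Q K - (Bᵀ * (X - K))ᵀ * (Bᵀ * (X - K)) := by
  simp only [closedLoop, riccati, transpose_sub, transpose_mul, transpose_transpose, hX.eq, hK.eq,
    Matrix.sub_mul, Matrix.mul_sub, Matrix.mul_assoc]
  abel

/-- Completion of the square in the feedback `F`. For φ(K) ≥ 0 the right side is negative
semidefinite, so every solution of the inequality lies below the cost of every stabilizing feedback.
-/
lemma lyapunov_feedback_sub {F : Matrix (Fin m) ι ℝ} {P K : Matrix ι ι ℝ} (hK : K.IsSymm)
    (hP : (A + B * F)ᵀ * P + P * (A + B * F) = -(Q + Fᵀ * F)) :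
    (A + B * F)ᵀ * (P - K) + (P - K) * (A + B * F) =
      -riccati A B Q K - (F + Bᵀ * K)ᵀ * (F + Bᵀ * K) := by
  have h : (A + B * F)ᵀ * (P - K) + (P - K) * (A + B * F) =
      ((A + B * F)ᵀ * P + P * (A + B * F)) - ((A + B * F)ᵀ * K + K * (A + B * F)) := by
    rw [Matrix.mul_sub, Matrix.sub_mul]; abel
  rw [h, hP]
  simp only [riccati, transpose_add, transpose_mul, transpose_transpose, hK.eq,
    Matrix.add_mul, Matrix.mul_add, Matrix.mul_assoc]
  abel

lemma riccati_isSymm (hQ : Q.IsSymm) {K : Matrix ι ι ℝ} (hK : K.IsSymm) :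
    (riccati A B Q K).IsSymm := by
  simp only [riccati, IsSymm, transpose_add, transpose_sub, transpose_mul, transpose_transpose,
    hK.eq, hQ.eq, Matrix.mul_assoc]
  abel

/-- `P` is the cost matrix of some stabilizing feedback. -/
def IsFeedbackCost (A : Matrix ι ι ℝ) (B : Matrix ι (Fin m) ℝ) (Q P : Matrix ι ι ℝ) : Prop :=
  P.IsSymm ∧ ∃ F : Matrix (Fin m) ι ℝ, RootsIn {z | z.re < 0} (A + B * F).charpoly ∧
    (A + B * F)ᵀ * P + P * (A + B * F) = -(Q + Fᵀ * F)

lemma exists_feedbackCost (hQ : Q.IsSymm) {F : Matrix (Fin m) ι ℝ}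
    (hF : RootsIn {z | z.re < 0} (A + B * F).charpoly) :
    ∃ P, IsFeedbackCost A B Q P ∧ (A + B * F)ᵀ * P + P * (A + B * F) = -(Q + Fᵀ * F) := by
  obtain ⟨P, hP, h⟩ := existsUnique_lyapunov hF (T := -(Q + Fᵀ * F))
    (by simp [IsSymm, hQ.eq])
  exact ⟨P, ⟨hP, F, hF, h⟩, h⟩

lemma IsFeedbackCost.sub_posSemidef {P K : Matrix ι ι ℝ} (hP : IsFeedbackCost A B Q P)
    (hK : K ∈ solARI A B Q) : (P - K).PosSemidef := by
  obtain ⟨hPs, F, hF, h⟩ := hP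
  refine posSemidef_of_lyapunov hF (hPs.sub hK.1) fun x => ?_
  rw [lyapunov_feedback_sub hK.1 h, sub_mulVec, neg_mulVec, dotProduct_sub, dotProduct_neg]
  have h1 := (posSemidef_iff_real.mp hK.2).2 x
  have h2 := quadForm_mul_self_nonneg (F + Bᵀ * K) x
  linarith

lemma IsFeedbackCost.quadForm_riccati_nonpos {P : Matrix ι ι ℝ} (hP : IsFeedbackCost A B Q P)
    (x : ι → ℝ) : x ⬝ᵥ riccati A B Q P *ᵥ x ≤ 0 := by
  obtain ⟨hPs, F, hF, h⟩ := hP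
  have h1 := lyapunov_feedback_sub hPs h
  rw [sub_self, Matrix.mul_zero, Matrix.zero_mul, add_zero] at h1
  have h2 : riccati A B Q P = -((F + Bᵀ * P)ᵀ * (F + Bᵀ * P)) := by
    rw [eq_comm, sub_eq_zero] at h1
    rw [← h1, neg_neg]
  rw [h2, neg_mulVec, dotProduct_neg]
  have := quadForm_mul_self_nonneg (F + Bᵀ * P) x
  linarith

/-- `P - K₀` is a strict Lyapunov function; strictness comes from φ(K₀) > 0 alone. -/
lemma closedLoop_stable_of_riccati_nonpos {P K₀ : Matrix ι ι ℝ} (hPs : P.IsSymm)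
    (hP : ∀ x, x ⬝ᵥ riccati A B Q P *ᵥ x ≤ 0) (hK₀ : K₀.IsSymm)
    (hpos : (riccati A B Q K₀).PosDef) (hle : (P - K₀).PosSemidef) :
    RootsIn {z | z.re < 0} (closedLoop A B P).charpoly := by
  refine rootsIn_of_lyapunov_posDef hle fun x hx => ?_
  rw [lyapunov_closedLoop_sub (Q := Q) hPs hK₀, sub_mulVec, sub_mulVec, dotProduct_sub,
    dotProduct_sub]
  have h1 := hP x
  have h2 := (posDef_iff_real.mp hpos).2 x hx
  have h3 := quadForm_mul_self_nonneg (Bᵀ * (P - K₀)) x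
  linarith

/-- Newton's method in Kleinman's form: `P` is replaced by the cost matrix of the feedback `-Bᵀ P`.
The iterates remain costs of stabilizing feedbacks, decrease because φ(P) ≤ 0, and are bounded below
by every solution of the inequality. The limit solves the equation, and strictness at `K₀` keeps its
closed loop stable. -/
lemma exists_stabilizing_solution (hQ : Q.IsSymm) (hstab : HasStabilizer A B) {K₀ : Matrix ι ι ℝ}
    (hK₀ : K₀.IsSymm) (hpos : (riccati A B Q K₀).PosDef) :
    ∃ Y ∈ solARE A B Q, RootsIn {z | z.re < 0} (closedLoop A B Y).charpoly ∧
      ∀ K ∈ solARI A B Q, (Y - K).PosSemidef := by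
  have hK₀' : K₀ ∈ solARI A B Q := ⟨hK₀, hpos.posSemidef⟩
  have step : ∀ P : {P // IsFeedbackCost A B Q P}, ∃ P' : {P // IsFeedbackCost A B Q P},
      (P.1 - P'.1).PosSemidef ∧ (closedLoop A B P.1)ᵀ * P'.1 + P'.1 * closedLoop A B P.1 =
        -(Q + P.1 * B * (Bᵀ * P.1)) := by
    rintro ⟨P, hP⟩
    have hst := closedLoop_stable_of_riccati_nonpos hP.1 hP.quadForm_riccati_nonpos hK₀ hpos
      (hP.sub_posSemidef hK₀')
    rw [closedLoop_eq_add] at hst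
    obtain ⟨P', hP', h⟩ := exists_feedbackCost hQ hst
    refine ⟨⟨P', hP'⟩, ?_, ?_⟩
    · refine posSemidef_of_lyapunov hst (hP.1.sub hP'.1) fun x => ?_
      have h1 := lyapunov_feedback_sub hP.1 h
      have h2 := hP.quadForm_riccati_nonpos x
      have h3 : (A + B * -(Bᵀ * P))ᵀ * (P - P') + (P - P') * (A + B * -(Bᵀ * P)) =
          riccati A B Q P := by
        rw [neg_add_cancel, Matrix.mul_zero, sub_zero] at h1
        rw [← neg_sub P' P, Matrix.mul_neg, Matrix.neg_mul, ← neg_add, h1, neg_neg]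
      rwa [h3]
    · simp only [closedLoop_eq_add, h]
      simp [hP.1.eq, Matrix.mul_assoc]
  choose next hnext using step
  obtain ⟨F, hF⟩ := hstab
  obtain ⟨P₀, hP₀, -⟩ := exists_feedbackCost hQ hF
  let P : ℕ → {P // IsFeedbackCost A B Q P} := fun k => Nat.rec ⟨P₀, hP₀⟩ (fun _ p => next p) k
  have hP : ∀ k, P (k + 1) = next (P k) := fun k => rfl
  obtain ⟨Y, hY⟩ := exists_tendsto_of_antitone (P := fun k => (P k).1) (K := K₀)
    (fun k => (P k).2.1) (fun k => (hP k).symm ▸ (hnext (P k)).1)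
    fun k => (P k).2.sub_posSemidef hK₀'
  have hYs : Y.IsSymm := tendsto_nhds_unique ((continuous_id.matrix_transpose.tendsto Y).comp hY)
    (hY.congr fun k => ((P k).2.1).symm)
  have hge : ∀ K ∈ solARI A B Q, (Y - K).PosSemidef := fun K hK =>
    posSemidef_of_tendsto (hY.sub_const K) fun k => (P k).2.sub_posSemidef hK
  have hare : riccati A B Q Y = 0 := by
    have hY' := (tendsto_add_atTop_iff_nat 1).mpr hY
    -- The Lyapunov equation linking two consecutive iterates becomes the Riccati equation once both
    -- tend to `Y`.
    have hc1 : Continuous fun Z : Matrix ι ι ℝ × Matrix ι ι ℝ =>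
        (closedLoop A B Z.1)ᵀ * Z.2 + Z.2 * closedLoop A B Z.1 + (Q + Z.1 * B * (Bᵀ * Z.1)) := by
      unfold closedLoop
      fun_prop
    have h1 := (hc1.tendsto (Y, Y)).comp (hY.prodMk_nhds hY')
    have h2 := tendsto_nhds_unique h1 ((tendsto_const_nhds (x := (0 : Matrix ι ι ℝ))).congr fun k => by
      simp only [Function.comp_apply, hP, (hnext (P k)).2, neg_add_cancel])
    rw [← h2]
    simp only [closedLoop, riccati, transpose_sub, transpose_mul, transpose_transpose, hYs.eq,
      Matrix.sub_mul, Matrix.mul_sub, Matrix.mul_assoc]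
    abel
  refine ⟨Y, ⟨hYs, hare⟩, ?_, hge⟩
  exact closedLoop_stable_of_riccati_nonpos (Q := Q) hYs (by simp [hare]) hK₀ hpos (hge K₀ hK₀')

lemma riccati_add_smul_one (ε : ℝ) (K : Matrix ι ι ℝ) :
    riccati A B (Q + ε • 1) K = riccati A B Q K + ε • 1 := by
  simp only [riccati]; abel

lemma posDef_smul_one {ε : ℝ} (hε : 0 < ε) : (ε • (1 : Matrix ι ι ℝ)).PosDef :=
  PosDef.one.smul hε

/-- The maximal solution as the limit of stabilizing solutions of perturbed Riccati equations. -/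
lemma exists_maximal_solution (hQ : Q.IsSymm) (hstab : HasStabilizer A B)
    (hne : (solARI A B Q).Nonempty) :
    ∃ (Kp : Matrix ι ι ℝ) (Y : ℕ → Matrix ι ι ℝ), Kp ∈ solARE A B Q ∧
      (∀ K ∈ solARI A B Q, (Kp - K).PosSemidef) ∧
      RootsIn {z | z.re ≤ 0} (closedLoop A B Kp).charpoly ∧
      (∀ k : ℕ, Y k ∈ solARE A B (Q + ((k : ℝ) + 1)⁻¹ • 1)) ∧
      (∀ k : ℕ, RootsIn {z | z.re < 0} (closedLoop A B (Y k)).charpoly) ∧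
      (∀ k, ∀ K ∈ solARI A B Q, (Y k - K).PosSemidef) ∧ Tendsto Y atTop (𝓝 Kp) := by
  obtain ⟨K₀, hK₀⟩ := hne
  have hpos : ∀ k : ℕ, (0 : ℝ) < ((k : ℝ) + 1)⁻¹ := fun k => by positivity
  have hQ' : ∀ k : ℕ, (Q + ((k : ℝ) + 1)⁻¹ • 1).IsSymm := fun k =>
    hQ.add ((isSymm_one).smul _)
  have hex := fun k : ℕ => exists_stabilizing_solution (hQ' k) hstab hK₀.1
    (by rw [riccati_add_smul_one]; exact (posDef_smul_one (hpos k)).posSemidef_add hK₀.2)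
  choose Y hYare hYst hYge using hex
  have hYK : ∀ k, ∀ K ∈ solARI A B Q, (Y k - K).PosSemidef := fun k K hK =>
    hYge k K ⟨hK.1, by
      rw [riccati_add_smul_one]; exact hK.2.add (posDef_smul_one (hpos k)).posSemidef⟩
  -- With weight perturbed by `1/(k+1)`, the Riccati map at `Y (k+1)` equals `1/(k+1) - 1/(k+2)`
  -- times the identity, so `Y (k+1)` solves the inequality dominated by `Y k`.
  have hYanti : ∀ k, (Y k - Y (k + 1)).PosSemidef := by
    intro k
    refine hYge k _ ⟨(hYare (k + 1)).1, ?_⟩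
    have h1 := (hYare (k + 1)).2
    rw [riccati_add_smul_one] at h1 ⊢
    rw [eq_neg_of_add_eq_zero_left h1, ← neg_smul, ← add_smul]
    refine PosSemidef.one.smul ?_
    have : (((k + 1 : ℕ) : ℝ) + 1)⁻¹ ≤ ((k : ℝ) + 1)⁻¹ := by
      apply inv_anti₀ <;> push_cast <;> linarith [(Nat.cast_nonneg k : (0 : ℝ) ≤ k)]
    linarith
  obtain ⟨Kp, hKp⟩ := exists_tendsto_of_antitone (fun k => (hYare k).1) hYanti
    fun k => hYK k K₀ hK₀
  have hs : Kp.IsSymm := tendsto_nhds_unique ((continuous_id.matrix_transpose.tendsto Kp).comp hKp)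
    (hKp.congr fun k => ((hYare k).1).symm)
  refine ⟨Kp, Y, ⟨hs, ?_⟩, fun K hK => posSemidef_of_tendsto (hKp.sub_const K) fun k => hYK k K hK,
    ?_, hYare, hYst, hYK, hKp⟩
  · have hc : Continuous fun Z : Matrix ι ι ℝ × ℝ => riccati A B Q Z.1 + Z.2 • 1 := by
      unfold riccati
      fun_prop
    have h0 : Tendsto (fun k : ℕ => ((k : ℝ) + 1)⁻¹) atTop (𝓝 0) := by
      simpa using tendsto_one_div_add_atTop_nhds_zero_nat (𝕜 := ℝ)
    have h1 := (hc.tendsto (Kp, 0)).comp (hKp.prodMk_nhds h0)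
    have h2 := tendsto_nhds_unique h1 ((tendsto_const_nhds (x := (0 : Matrix ι ι ℝ))).congr fun k => by
      simp only [Function.comp_apply, ← riccati_add_smul_one, (hYare k).2])
    simpa using h2
  · have hc : Continuous fun Z : Matrix ι ι ℝ => closedLoop A B Z := by
      unfold closedLoop
      fun_prop
    exact rootsIn_charpoly_of_tendsto hYst ((hc.tendsto Kp).comp hKp)

/-- A solution with semistable closed loop is the maximal solution. -/
lemma eq_of_semistable {K Kp : Matrix ι ι ℝ} (hstab : HasStabilizer A B) (hK : K ∈ solARE A B Q)
    (hKst : RootsIn {z | z.re ≤ 0} (closedLoop A B K).charpoly) (hKp : Kp ∈ solARE A B Q)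
    (hle : (Kp - K).PosSemidef) : Kp = K := by
  -- The gap solves a Riccati equation without weight, so every vector counts as unobservable and
  -- semistability alone makes the gap vanish.
  have h : (closedLoop A B K)ᵀ * (Kp - K) + (Kp - K) * closedLoop A B K -
      (Kp - K) * B * Bᵀ * (Kp - K) + 0 = 0 := by
    have h1 := hKp.2
    have h2 := hK.2
    have : riccati A B Q Kp - riccati A B Q K = 0 := by rw [h1, h2, sub_zero]
    rw [add_zero]
    refine Eq.trans ?_ this
    simp only [closedLoop, riccati, transpose_sub, transpose_mul, transpose_transpose, hK.1.eq,
      Matrix.sub_mul, Matrix.mul_sub, Matrix.mul_assoc]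
    abel
  have h0 : ∀ x, (Kp - K) *ᵥ x = 0 := fun x =>
    mulVec_eq_zero_of_riccati (hstab.hautus.closedLoop K) hle h
      (spectrallyIn_of_charpoly hKst x) (by simp)
  rw [← sub_eq_zero]
  exact Matrix.ext_of_mulVec_single fun i => by rw [h0, zero_mulVec]

/-! ### Controllable pairs -/

/-- No nonzero subspace invariant under `Aᵀ` is annihilated by `Bᵀ`. -/
def IsControllablePair (A : Matrix ι ι ℝ) (B : Matrix ι (Fin m) ℝ) : Prop :=
  ∀ Y : Submodule ℝ (ι → ℝ), (∀ y ∈ Y, Aᵀ *ᵥ y ∈ Y) → (∀ y ∈ Y, Bᵀ *ᵥ y = 0) → Y = ⊥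

lemma IsControllablePair.neg {B : Matrix ι (Fin m) ℝ} (h : IsControllablePair A B) :
    IsControllablePair (-A) B := by
  intro Y hA hB
  refine h Y (fun y hy => ?_) hB
  have := Y.neg_mem (hA y hy)
  rwa [transpose_neg, neg_mulVec, neg_neg] at this

lemma exists_shift_stable (A : Matrix ι ι ℝ) :
    ∃ β : ℝ, 0 < β ∧ RootsIn {z | z.re < 0} (-(A + β • 1)).charpoly := by
  have hfin := Polynomial.rootSet_finite A.charpoly ℂ
  obtain ⟨M, hM⟩ := (hfin.image fun z : ℂ => -z.re).bddAbove
  -- `M` bounds `-Re z` over the eigenvalues; the maximum with 0 keeps the shift positive.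
  refine ⟨max M 0 + 1, by positivity, ?_⟩
  rw [rootsIn_charpoly_neg, rootsIn_charpoly_iff]
  intro z v hv hz
  have h1 : matC A *ᵥ v = (z - ((max M 0 + 1 : ℝ) : ℂ)) • v := by
    rw [sub_smul, ← hz, matC_add, add_mulVec]
    have : matC ((max M 0 + 1) • (1 : Matrix ι ι ℝ)) = ((max M 0 + 1 : ℝ) : ℂ) • 1 := by
      ext i j; by_cases hij : i = j <;> simp [matC, hij]
    rw [this, smul_mulVec, one_mulVec, add_sub_cancel_right]
  have h2 : (z - ((max M 0 + 1 : ℝ) : ℂ)) ∈ A.charpoly.rootSet ℂ := by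
    rw [Polynomial.mem_rootSet]
    exact ⟨(charpoly_monic A).ne_zero, (aeval_charpoly_eq_zero_iff A _).mpr ⟨v, hv, h1⟩⟩
  have h3 := hM (Set.mem_image_of_mem _ h2)
  simp only [Complex.sub_re, Complex.ofReal_re] at h3
  simp only [Set.mem_ofPred_eq, Complex.neg_re]
  linarith [le_max_left M 0]

/-- Bass' construction of a stabilizing feedback. -/
lemma IsControllablePair.hasStabilizer {B : Matrix ι (Fin m) ℝ} (h : IsControllablePair A B) :
    HasStabilizer A B := by
  obtain ⟨β, hβ, hst⟩ := exists_shift_stable A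
  rw [← rootsIn_charpoly_transpose] at hst
  -- `W` is a Gramian of the shifted pair, which is stable in reversed time.
  obtain ⟨W, hWs, hW⟩ := existsUnique_lyapunov hst (T := -((2 : ℝ) • (B * Bᵀ)))
    (by simp [IsSymm])
  have hW' : (A + β • 1) * W + W * (A + β • 1)ᵀ = (2 : ℝ) • (B * Bᵀ) := by
    rw [← neg_inj, ← hW]
    simp only [transpose_transpose, transpose_neg, Matrix.neg_mul, Matrix.mul_neg]
    abel
  have hBB : ∀ x : ι → ℝ, x ⬝ᵥ (B * Bᵀ) *ᵥ x = (Bᵀ *ᵥ x) ⬝ᵥ (Bᵀ *ᵥ x) := fun x => by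
    have := quadForm_transpose_mul_self Bᵀ x
    rwa [transpose_transpose] at this
  have hWpsd : W.PosSemidef := by
    refine posSemidef_of_lyapunov hst hWs fun x => ?_
    rw [hW, neg_mulVec, smul_mulVec, dotProduct_neg, dotProduct_smul, hBB, smul_eq_mul]
    have := dotProduct_self_nonneg' (Bᵀ *ᵥ x)
    linarith
  have hker : LinearMap.ker W.mulVecLin = ⊥ := by
    -- Testing the equation of `W` with a kernel vector leaves `|Bᵀ y|² = 0`. The equation then
    -- shows the kernel to be `Aᵀ`-invariant, and controllability makes it trivial.
    have hB0 : ∀ y, W *ᵥ y = 0 → Bᵀ *ᵥ y = 0 := by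
      intro y hy
      have h1 := congrArg (fun N : Matrix ι ι ℝ => y ⬝ᵥ N *ᵥ y) hW'
      simp only [add_mulVec, dotProduct_add, smul_mulVec, dotProduct_smul, hBB] at h1
      rw [← mulVec_mulVec, hy, mulVec_zero, dotProduct_zero, zero_add, ← mulVec_mulVec,
        dotProduct_mulVec, ← mulVec_transpose, hWs.eq, hy, zero_dotProduct] at h1
      refine dotProduct_self_eq_zero.mp ?_
      simpa using h1.symm
    refine h _ (fun y hy => ?_) fun y hy => hB0 y hy
    rw [LinearMap.mem_ker, mulVecLin_apply] at hy ⊢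
    have h1 := congrArg (fun N : Matrix ι ι ℝ => N *ᵥ y) hW'
    simp only [add_mulVec, smul_mulVec] at h1
    rw [← mulVec_mulVec, hy, mulVec_zero, ← mulVec_mulVec, ← mulVec_mulVec, hB0 y hy,
      mulVec_zero, smul_zero, zero_add, transpose_add, add_mulVec, mulVec_add, transpose_smul,
      transpose_one, smul_mulVec, one_mulVec, mulVec_smul, hy, smul_zero, add_zero] at h1
    exact h1
  have hunit : IsUnit W := by
    rw [← mulVec_injective_iff_isUnit]
    exact LinearMap.ker_eq_bot.mp hker
  have hdet : IsUnit W.det := (isUnit_iff_isUnit_det W).mp hunit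
  refine ⟨-(Bᵀ * W⁻¹), ?_⟩
  rw [← rootsIn_charpoly_transpose]
  refine rootsIn_of_lyapunov_posDef hWpsd fun x hx => ?_
  -- The feedback cancels the Gramian's source `2 B Bᵀ`, and only the shift `-2βW` remains: `W` is a
  -- strict Lyapunov function for the transposed closed loop.
  have h1 : (A + B * -(Bᵀ * W⁻¹))ᵀᵀ * W + W * (A + B * -(Bᵀ * W⁻¹))ᵀ = -((2 * β) • W) := by
    have e1 : W⁻¹ * W = 1 := nonsing_inv_mul W hdet
    have e2 : W * W⁻¹ᵀ = 1 := by
      rw [transpose_nonsing_inv, hWs.eq]; exact mul_nonsing_inv W hdet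
    have e3 : (A + B * -(Bᵀ * W⁻¹)) * W = A * W - B * Bᵀ := by
      rw [Matrix.add_mul, Matrix.mul_neg, Matrix.neg_mul, Matrix.mul_assoc, Matrix.mul_assoc, e1,
        Matrix.mul_one, sub_eq_add_neg]
    have e4 : W * (A + B * -(Bᵀ * W⁻¹))ᵀ = W * Aᵀ - B * Bᵀ := by
      rw [transpose_add, transpose_mul, transpose_neg, transpose_mul, transpose_transpose,
        Matrix.mul_add, Matrix.neg_mul, Matrix.mul_neg, ← Matrix.mul_assoc, ← Matrix.mul_assoc, e2,
        Matrix.one_mul, sub_eq_add_neg]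
    rw [transpose_transpose, e3, e4]
    have e5 : A * W + W * Aᵀ + (2 * β) • W = (2 : ℝ) • (B * Bᵀ) := by
      rw [← hW', transpose_add, transpose_smul, transpose_one, Matrix.add_mul, Matrix.mul_add,
        Matrix.smul_mul, Matrix.mul_smul, Matrix.one_mul, Matrix.mul_one, two_mul, add_smul]
      abel
    rw [two_smul] at e5
    rw [eq_neg_iff_add_eq_zero, ← sub_eq_zero.mpr e5]
    abel
  rw [h1, neg_mulVec, dotProduct_neg, smul_mulVec, dotProduct_smul, smul_eq_mul, neg_lt_zero]
  refine mul_pos (by positivity) ?_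
  refine lt_of_le_of_ne ((posSemidef_iff_real.mp hWpsd).2 x) fun h0 => hx ?_
  have h2 := (hWpsd.dotProduct_mulVec_zero_iff x).mp (by simpa using h0.symm)
  exact LinearMap.ker_eq_bot'.mp hker x h2

end Kleinman

/-! ### Extremal solutions, their gap, and the projected solution. -/

section Structure

variable {ι : Type*} [Fintype ι] [DecidableEq ι] {m : ℕ}
variable {A Q : Matrix ι ι ℝ} {B : Matrix ι (Fin m) ℝ}

lemma posSemidef_antisymm {S T : Matrix ι ι ℝ} (hS : S.IsSymm) (hT : T.IsSymm)
    (h : (S - T).PosSemidef) (h' : (T - S).PosSemidef) : S = T := by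
  refine eq_of_quadForm_eq hS hT fun x => le_antisymm ?_ ?_
  · have := (posSemidef_iff_real.mp h').2 x
    rw [sub_mulVec, dotProduct_sub] at this
    linarith
  · have := (posSemidef_iff_real.mp h).2 x
    rw [sub_mulVec, dotProduct_sub] at this
    linarith

/-- Time reversal `(A, K) ↦ (-A, -K)` exchanges maximal and minimal solutions, and semistable and
antistable closed loops. -/
lemma riccati_neg (A Q : Matrix ι ι ℝ) (B : Matrix ι (Fin m) ℝ) (K : Matrix ι ι ℝ) :
    riccati (-A) B Q (-K) = riccati A B Q K := by
  simp [riccati]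

lemma closedLoop_neg (A : Matrix ι ι ℝ) (B : Matrix ι (Fin m) ℝ) (K : Matrix ι ι ℝ) :
    closedLoop (-A) B (-K) = -closedLoop A B K := by
  simp [closedLoop]; abel

lemma closedLoop_mulVec (A : Matrix ι ι ℝ) (B : Matrix ι (Fin m) ℝ) (K : Matrix ι ι ℝ)
    (x : ι → ℝ) : closedLoop A B K *ᵥ x = A *ᵥ x - B *ᵥ (Bᵀ *ᵥ (K *ᵥ x)) := by
  rw [closedLoop, sub_mulVec, ← mulVec_mulVec, ← mulVec_mulVec]

lemma solARE_subset_solARI : solARE A B Q ⊆ solARI A B Q := fun K hK =>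
  ⟨hK.1, by rw [hK.2]; exact PosSemidef.zero⟩

/-- The extremal solutions of the Riccati equation of a controllable pair. -/
lemma exists_extremal_solutions (hQ : Q.IsSymm) (hc : IsControllablePair A B)
    (hne : (solARI A B Q).Nonempty) :
    (∃ Kp, IsMaximalElement (solARE A B Q) Kp) ∧ ∃ Km, IsMinimalElement (solARE A B Q) Km := by
  obtain ⟨Kp, -, hKp, hmax, -⟩ := exists_maximal_solution hQ hc.hasStabilizer hne
  obtain ⟨K₀, hK₀⟩ := hne
  obtain ⟨Km, -, hKm, hmin, -⟩ := exists_maximal_solution (A := -A) hQ hc.neg.hasStabilizer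
    ⟨-K₀, hK₀.1.neg, by rw [riccati_neg]; exact hK₀.2⟩
  refine ⟨⟨Kp, hKp, fun K hK => hmax K (solARE_subset_solARI hK)⟩, -Km, ⟨hKm.1.neg, ?_⟩,
    fun K hK => ?_⟩
  · rw [← riccati_neg, neg_neg]; exact hKm.2
  · have := hmin (-K) ⟨hK.1.neg, by rw [riccati_neg, hK.2]; exact PosSemidef.zero⟩
    rwa [sub_neg_eq_add, add_comm, ← sub_neg_eq_add] at this

/-- Antisymmetry of the order transfers the properties of the constructed solution to any maximal
element, including dominance over solutions of the inequality. -/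
lemma IsMaximalElement.semistable {Kp : Matrix ι ι ℝ} (h : IsMaximalElement (solARE A B Q) Kp)
    (hQ : Q.IsSymm) (hstab : HasStabilizer A B) :
    RootsIn {z | z.re ≤ 0} (closedLoop A B Kp).charpoly ∧
      ∀ K ∈ solARI A B Q, (Kp - K).PosSemidef := by
  obtain ⟨K, -, hK, hmax, hst, -⟩ :=
    exists_maximal_solution hQ hstab ⟨Kp, solARE_subset_solARI h.1⟩
  have : Kp = K := posSemidef_antisymm h.1.1 hK.1 (h.2 K hK) (hmax Kp (solARE_subset_solARI h.1))
  rw [this]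
  exact ⟨hst, hmax⟩

lemma IsMinimalElement.antisemistable {Km : Matrix ι ι ℝ}
    (h : IsMinimalElement (solARE A B Q) Km) (hQ : Q.IsSymm) (hstab : HasStabilizer (-A) B) :
    RootsIn {z | 0 ≤ z.re} (closedLoop A B Km).charpoly ∧
      ∀ K ∈ solARI A B Q, (K - Km).PosSemidef := by
  have h' : IsMaximalElement (solARE (-A) B Q) (-Km) := by
    refine ⟨⟨h.1.1.neg, by rw [riccati_neg]; exact h.1.2⟩, fun K hK => ?_⟩
    have := h.2 (-K) ⟨hK.1.neg, by rw [← riccati_neg, neg_neg]; exact hK.2⟩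
    rwa [neg_sub_comm] at this
  obtain ⟨h1, h2⟩ := h'.semistable hQ hstab
  refine ⟨?_, fun K hK => ?_⟩
  · rw [closedLoop_neg, rootsIn_charpoly_neg] at h1
    simpa using h1
  · have := h2 (-K) ⟨hK.1.neg, by rw [riccati_neg]; exact hK.2⟩
    rwa [neg_sub_neg] at this

lemma SpectrallyIn.neg {R : Set ℂ} {M : Matrix ι ι ℝ} {x : ι → ℝ} (h : SpectrallyIn R M x) :
    SpectrallyIn {z | -z ∈ R} (-M) x := by
  obtain ⟨p, hp, hpx⟩ := h
  refine ⟨p.comp (-X), fun z hz => hp (-z) ?_, ?_⟩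
  · rwa [aeval_comp, map_neg, aeval_X] at hz
  · rwa [aeval_comp, map_neg, aeval_X, neg_neg]

lemma disjoint_pos_nonpos : Disjoint {z : ℂ | 0 < z.re} {z | z.re ≤ 0} :=
  Set.disjoint_left.mpr fun z (h : 0 < z.re) (h' : z.re ≤ 0) => not_lt.mpr h' h

lemma quadForm_riccati_add {K K' : Matrix ι ι ℝ} (hK : K.IsSymm) (hK' : K'.IsSymm) {x d : ι → ℝ}
    (hd : K' *ᵥ x = K *ᵥ x + d) :
    x ⬝ᵥ riccati A B Q K' *ᵥ x = x ⬝ᵥ riccati A B Q K *ᵥ x +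
      2 * ((closedLoop A B K *ᵥ x) ⬝ᵥ d) - (Bᵀ *ᵥ d) ⬝ᵥ (Bᵀ *ᵥ d) := by
  have key : ∀ S : Matrix ι ι ℝ, S.IsSymm → x ⬝ᵥ riccati A B Q S *ᵥ x =
      2 * ((A *ᵥ x) ⬝ᵥ (S *ᵥ x)) + x ⬝ᵥ Q *ᵥ x - (Bᵀ *ᵥ (S *ᵥ x)) ⬝ᵥ (Bᵀ *ᵥ (S *ᵥ x)) := by
    intro S hS
    have h1 : ∀ y, x ⬝ᵥ S *ᵥ y = (S *ᵥ x) ⬝ᵥ y := fun y => by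
      rw [dotProduct_mulVec, ← mulVec_transpose, hS.eq]
    have h2 : ∀ y, x ⬝ᵥ Aᵀ *ᵥ y = (A *ᵥ x) ⬝ᵥ y := fun y => by
      rw [dotProduct_mulVec, vecMul_transpose]
    have h3 : ∀ y z, y ⬝ᵥ B *ᵥ z = (Bᵀ *ᵥ y) ⬝ᵥ z := fun y z => by
      rw [dotProduct_mulVec, mulVec_transpose]
    simp only [riccati, add_mulVec, sub_mulVec, dotProduct_add, dotProduct_sub, ← mulVec_mulVec,
      h1, h2, h3]
    rw [dotProduct_comm (S *ᵥ x) (A *ᵥ x)]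
    ring
  rw [key K' hK', key K hK, hd, closedLoop_mulVec]
  have h3 : ∀ y z, (B *ᵥ z) ⬝ᵥ y = z ⬝ᵥ (Bᵀ *ᵥ y) := fun y z => by
    rw [dotProduct_comm, dotProduct_mulVec, ← mulVec_transpose, dotProduct_comm]
  simp only [dotProduct_add, add_dotProduct, mulVec_add, sub_dotProduct, h3]
  rw [dotProduct_comm (Bᵀ *ᵥ d) (Bᵀ *ᵥ (K *ᵥ x))]
  ring

/-- The gap intertwines the closed loop of `Kp` with minus the transposed closed loop of `Km`. Hence
if `N` is invariant for `Km`, its gap-orthogonal complement is invariant for `Kp`. -/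
lemma closedLoop_transpose_mul_sub {Km Kp : Matrix ι ι ℝ} (hm : Km ∈ solARE A B Q)
    (hp : Kp ∈ solARE A B Q) :
    (closedLoop A B Km)ᵀ * (Kp - Km) + (Kp - Km) * closedLoop A B Kp = 0 := by
  have h1 : riccati A B Q Kp - riccati A B Q Km = 0 := by rw [hp.2, hm.2, sub_zero]
  refine Eq.trans ?_ h1
  simp only [closedLoop, riccati, transpose_sub, transpose_mul, transpose_transpose, hm.1.eq,
    Matrix.sub_mul, Matrix.mul_sub, Matrix.mul_assoc]
  abel

lemma dotProduct_gap_closedLoop {Km Kp : Matrix ι ι ℝ} (hm : Km ∈ solARE A B Q)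
    (hp : Kp ∈ solARE A B Q) (y b : ι → ℝ) :
    y ⬝ᵥ (Kp - Km) *ᵥ (closedLoop A B Kp *ᵥ b) =
      -((closedLoop A B Km *ᵥ y) ⬝ᵥ (Kp - Km) *ᵥ b) := by
  have h := eq_neg_of_add_eq_zero_right (closedLoop_transpose_mul_sub hm hp)
  rw [mulVec_mulVec, h, neg_mulVec, dotProduct_neg, ← mulVec_mulVec, dotProduct_mulVec,
    vecMul_transpose]

lemma closedLoop_eq_of_gap {Km Kp : Matrix ι ι ℝ} {x : ι → ℝ} (h : (Kp - Km) *ᵥ x = 0) :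
    closedLoop A B Kp *ᵥ x = closedLoop A B Km *ᵥ x := by
  rw [sub_mulVec, sub_eq_zero] at h
  rw [closedLoop_mulVec, closedLoop_mulVec, h]

variable {Km Kp : Matrix ι ι ℝ} {N : Submodule ℝ (ι → ℝ)}

/-- On the part of `N` killed by the gap both closed loops coincide, so its motions are at once
antistable and semistable. -/
lemma eq_zero_of_mem_of_gap (hm : Km ∈ solARE A B Q) (hp : Kp ∈ solARE A B Q)
    (hst : RootsIn {z | z.re ≤ 0} (closedLoop A B Kp).charpoly)
    (hN : ∀ x ∈ N, closedLoop A B Km *ᵥ x ∈ N)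
    (hNpos : ∀ x ∈ N, SpectrallyIn {z | 0 < z.re} (closedLoop A B Km) x) {x : ι → ℝ} (hx : x ∈ N)
    (h0 : (Kp - Km) *ᵥ x = 0) : x = 0 := by
  have hinv : ∀ y ∈ N ⊓ LinearMap.ker (Kp - Km).mulVecLin,
      closedLoop A B Km *ᵥ y ∈ N ⊓ LinearMap.ker (Kp - Km).mulVecLin := by
    rintro y ⟨hyN, hy⟩
    refine ⟨hN y hyN, ?_⟩
    have hy' : (Kp - Km) *ᵥ y = 0 := hy
    change (Kp - Km) *ᵥ (closedLoop A B Km *ᵥ y) = 0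
    rw [← closedLoop_eq_of_gap hy']
    refine dotProduct_eq _ _ fun w => ?_
    rw [dotProduct_comm, dotProduct_gap_closedLoop hm hp, hy', dotProduct_zero, neg_zero,
      zero_dotProduct]
  exact SpectrallyIn.eq_zero ((SpectrallyIn.congr hinv
    (fun y hy => closedLoop_eq_of_gap hy.2) ⟨hx, h0⟩).mpr (hNpos x hx))
    (spectrallyIn_of_charpoly hst x) disjoint_pos_nonpos

lemma mem_orthComplement {V : Submodule ℝ (ι → ℝ)} {x : ι → ℝ} :
    x ∈ orthComplement V ↔ ∀ v ∈ V, v ⬝ᵥ x = 0 := Iff.rfl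

/-- The form of the gap is nonnegative and nondegenerate on `N`. It identifies `N` with its dual,
and representing `v ↦ v ⬝ᵥ Δ x` by some `a ∈ N` splits `x` as `a + (x - a)`. -/
lemma isCompl_comap_orthComplement (hm : Km ∈ solARE A B Q) (hp : Kp ∈ solARE A B Q)
    (hgap : (Kp - Km).PosSemidef)
    (hst : RootsIn {z | z.re ≤ 0} (closedLoop A B Kp).charpoly)
    (hN : ∀ x ∈ N, closedLoop A B Km *ᵥ x ∈ N)
    (hNpos : ∀ x ∈ N, SpectrallyIn {z | 0 < z.re} (closedLoop A B Km) x) :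
    IsCompl N ((orthComplement N).comap (Kp - Km).mulVecLin) := by
  have hinj : ∀ x ∈ N, (∀ v ∈ N, v ⬝ᵥ (Kp - Km) *ᵥ x = 0) → x = 0 := fun x hx h =>
    eq_zero_of_mem_of_gap hm hp hst hN hNpos hx
      ((hgap.dotProduct_mulVec_zero_iff x).mp (by simpa using h x hx))
  refine ⟨Submodule.disjoint_def.mpr fun x hx hx' => hinj x hx hx', codisjoint_iff.mpr
    (eq_top_iff.mpr fun x _ => ?_)⟩
  let f : N →ₗ[ℝ] Module.Dual ℝ N :=
    LinearMap.mk₂ ℝ (fun a v : N => (v : ι → ℝ) ⬝ᵥ (Kp - Km) *ᵥ (a : ι → ℝ))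
      (by intro a b v; simp [mulVec_add]) (by intro c a v; simp [mulVec_smul])
      (by intro a v w; simp) (by intro c a v; simp)
  have hf : Function.Injective f := by
    rw [← LinearMap.ker_eq_bot, LinearMap.ker_eq_bot']
    intro a ha
    refine Subtype.ext (hinj a a.2 fun v hv => ?_)
    exact congrArg (fun g : Module.Dual ℝ N => g ⟨v, hv⟩) ha
  obtain ⟨a, ha⟩ := (LinearMap.injective_iff_surjective_of_finrank_eq_finrank
    (Subspace.dual_finrank_eq (K := ℝ) (V := N)).symm).mp hf
    { toFun := fun v : N => (v : ι → ℝ) ⬝ᵥ (Kp - Km) *ᵥ x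
      map_add' := by intros; simp
      map_smul' := by intros; simp }
  rw [← add_sub_cancel (a : ι → ℝ) x]
  refine Submodule.add_mem_sup a.2 fun v hv => ?_
  have := congrArg (fun g : Module.Dual ℝ N => g ⟨v, hv⟩) ha
  simp only [f, LinearMap.mk₂_apply, LinearMap.coe_mk, AddHom.coe_mk] at this
  rw [mulVecLin_apply, mulVec_sub, dotProduct_sub, this, sub_self]

variable {P : Matrix ι ι ℝ}

lemma IsProjectionAlong.mem_left {V W : Submodule ℝ (ι → ℝ)} (hP : IsProjectionAlong P V W)
    (x : ι → ℝ) : P *ᵥ x ∈ V ∧ x - P *ᵥ x ∈ W := by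
  have hx : x ∈ V ⊔ W := by rw [hP.isCompl.sup_eq_top]; trivial
  obtain ⟨a, ha, b, hb, rfl⟩ := Submodule.mem_sup.mp hx
  rw [mulVec_add, hP.apply_left a ha, hP.apply_right b hb, add_zero, add_sub_cancel_left]
  exact ⟨ha, hb⟩

lemma projectedSolution_mulVec (x : ι → ℝ) :
    projectedSolution Km Kp P *ᵥ x = Km *ᵥ x + (Kp - Km) *ᵥ (x - P *ᵥ x) := by
  rw [projectedSolution, add_mulVec, ← mulVec_mulVec, ← mulVec_mulVec, sub_mulVec 1 P, one_mulVec,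
    mulVec_sub, mulVec_sub, sub_mulVec, sub_mulVec]
  abel

/-- The two summands are orthogonal for the gap form, so `P` is self-adjoint for it and `Kp - (Kp -
Km) P` is symmetric. -/
lemma projectedSolution_isSymm
    (hP : IsProjectionAlong P N ((orthComplement N).comap (Kp - Km).mulVecLin))
    (hm : Km.IsSymm) (hp : Kp.IsSymm) :
    (projectedSolution Km Kp P).IsSymm := by
  have h1 : ∀ x y, x ⬝ᵥ (Kp - Km) *ᵥ (P *ᵥ y) = (P *ᵥ x) ⬝ᵥ (Kp - Km) *ᵥ (P *ᵥ y) := by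
    intro x y
    have h2 := (hP.mem_left x).2 _ (hP.mem_left y).1
    rw [mulVecLin_apply, dotProduct_mulVec, ← mulVec_transpose, (hp.sub hm).eq, dotProduct_comm,
      sub_dotProduct, sub_eq_zero] at h2
    exact h2
  have h3 : (((Kp - Km) * P)ᵀ) = (Kp - Km) * P := by
    ext i j
    have e : ∀ i j, ((Kp - Km) * P) i j =
        (Pi.single i 1 : ι → ℝ) ⬝ᵥ (Kp - Km) *ᵥ (P *ᵥ Pi.single j 1) := by
      intro i j
      rw [mulVec_mulVec, mulVec_single_one, single_dotProduct, one_mul, col_apply]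
    rw [transpose_apply, e, e, h1, h1 (Pi.single i 1), dotProduct_mulVec, ← mulVec_transpose,
      (hp.sub hm).eq, dotProduct_comm]
  have h4 : projectedSolution Km Kp P = Kp - (Kp - Km) * P := by
    rw [projectedSolution, Matrix.mul_sub, Matrix.sub_mul, Matrix.mul_one]; abel
  rw [h4, IsSymm, transpose_sub, h3, hp.eq]

/-- Expanded around `Km`, the Riccati form at `x` involves only the component `b` along the
complement: the cross term vanishes by invariance of `N` and gap-orthogonality. What is left is the
Riccati form of `Kp` at `b`, which is zero. -/
lemma projectedSolution_mem_solARE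
    (hP : IsProjectionAlong P N ((orthComplement N).comap (Kp - Km).mulVecLin))
    (hQ : Q.IsSymm) (hm : Km ∈ solARE A B Q)
    (hp : Kp ∈ solARE A B Q) (hN : ∀ x ∈ N, closedLoop A B Km *ᵥ x ∈ N) :
    projectedSolution Km Kp P ∈ solARE A B Q := by
  have hs := projectedSolution_isSymm hP hm.1 hp.1
  refine ⟨hs, eq_of_quadForm_eq (riccati_isSymm hQ hs) isSymm_zero fun x => ?_⟩
  obtain ⟨ha, hb⟩ := hP.mem_left x
  set b := x - P *ᵥ x with hbdef
  rw [quadForm_riccati_add hm.1 hs (projectedSolution_mulVec x), hm.2]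
  have h1 : Kp *ᵥ b = Km *ᵥ b + (Kp - Km) *ᵥ b := by rw [sub_mulVec]; abel
  have h2 := quadForm_riccati_add (A := A) (B := B) (Q := Q) hm.1 hp.1 h1
  rw [hp.2, hm.2] at h2
  have h3 : closedLoop A B Km *ᵥ x = closedLoop A B Km *ᵥ (P *ᵥ x) + closedLoop A B Km *ᵥ b := by
    rw [← mulVec_add, hbdef, add_sub_cancel]
  have h4 : (closedLoop A B Km *ᵥ (P *ᵥ x)) ⬝ᵥ ((Kp - Km) *ᵥ b) = 0 := hb _ (hN _ ha)
  rw [h3, add_dotProduct, h4, zero_add]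
  simp only [zero_mulVec, dotProduct_zero] at h2 ⊢
  linarith

lemma closedLoop_projectedSolution_left
    (hP : IsProjectionAlong P N ((orthComplement N).comap (Kp - Km).mulVecLin))
    {x : ι → ℝ} (hx : x ∈ N) :
    closedLoop A B (projectedSolution Km Kp P) *ᵥ x = closedLoop A B Km *ᵥ x := by
  rw [closedLoop_mulVec, closedLoop_mulVec, projectedSolution_mulVec, hP.apply_left x hx, sub_self,
    mulVec_zero, add_zero]

lemma projectedSolution_mulVec_right
    (hP : IsProjectionAlong P N ((orthComplement N).comap (Kp - Km).mulVecLin))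
    {x : ι → ℝ}
    (hx : x ∈ (orthComplement N).comap (Kp - Km).mulVecLin) :
    projectedSolution Km Kp P *ᵥ x = Kp *ᵥ x := by
  rw [projectedSolution_mulVec, hP.apply_right x hx, sub_zero, sub_mulVec, add_sub_cancel]

lemma closedLoop_projectedSolution_right
    (hP : IsProjectionAlong P N ((orthComplement N).comap (Kp - Km).mulVecLin))
    {x : ι → ℝ}
    (hx : x ∈ (orthComplement N).comap (Kp - Km).mulVecLin) :
    closedLoop A B (projectedSolution Km Kp P) *ᵥ x = closedLoop A B Kp *ᵥ x := by
  rw [closedLoop_mulVec, closedLoop_mulVec, projectedSolution_mulVec_right hP hx]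

lemma closedLoop_mem_comap (hm : Km ∈ solARE A B Q) (hp : Kp ∈ solARE A B Q)
    (hN : ∀ x ∈ N, closedLoop A B Km *ᵥ x ∈ N) {x : ι → ℝ}
    (hx : x ∈ (orthComplement N).comap (Kp - Km).mulVecLin) :
    closedLoop A B Kp *ᵥ x ∈ (orthComplement N).comap (Kp - Km).mulVecLin := by
  intro y hy
  rw [mulVecLin_apply, dotProduct_gap_closedLoop hm hp]
  have := hx _ (hN y hy)
  rw [mulVecLin_apply] at this
  rw [this, neg_zero]

/-- The components along `N` and along the complement of a vector inherit its spectral region. -/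
lemma spectrallyIn_projectedSolution
    (hP : IsProjectionAlong P N ((orthComplement N).comap (Kp - Km).mulVecLin))
    (hm : Km ∈ solARE A B Q) (hp : Kp ∈ solARE A B Q)
    (hN : ∀ x ∈ N, closedLoop A B Km *ᵥ x ∈ N) {R : Set ℂ} {x : ι → ℝ}
    (hx : SpectrallyIn R (closedLoop A B (projectedSolution Km Kp P)) x) :
    SpectrallyIn R (closedLoop A B Km) (P *ᵥ x) ∧
      SpectrallyIn R (closedLoop A B Kp) (x - P *ᵥ x) := by
  obtain ⟨p, hpR, hpx⟩ := hx
  set M := closedLoop A B (projectedSolution Km Kp P)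
  set W := (orthComplement N).comap (Kp - Km).mulVecLin
  obtain ⟨ha, hb⟩ := hP.mem_left x
  have hl : ∀ y ∈ N, M *ᵥ y = closedLoop A B Km *ᵥ y := fun y hy =>
    closedLoop_projectedSolution_left hP hy
  have hr : ∀ y ∈ W, M *ᵥ y = closedLoop A B Kp *ᵥ y := fun y hy =>
    closedLoop_projectedSolution_right hP hy
  have hW : ∀ y ∈ W, closedLoop A B Kp *ᵥ y ∈ W := fun y hy => closedLoop_mem_comap hm hp hN hy
  have e1 := aeval_mulVec_congr (fun k => (pow_mulVec_congr hN hl ha k).1) p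
  have e2 := aeval_mulVec_congr (fun k => (pow_mulVec_congr hW hr hb k).1) p
  have hsum : aeval (closedLoop A B Km) p *ᵥ (P *ᵥ x) +
      aeval (closedLoop A B Kp) p *ᵥ (x - P *ᵥ x) = 0 := by
    rw [← e1, ← e2, ← mulVec_add, add_sub_cancel, hpx]
  have m1 := aeval_mulVec_mem hN ha p
  have m2 := aeval_mulVec_mem hW hb p
  have hz : aeval (closedLoop A B Km) p *ᵥ (P *ᵥ x) = 0 := by
    refine Submodule.disjoint_def.mp hP.isCompl.disjoint _ m1 ?_
    rw [eq_neg_of_add_eq_zero_left hsum]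
    exact W.neg_mem m2
  exact ⟨⟨p, hpR, hz⟩, ⟨p, hpR, by rwa [hz, zero_add] at hsum⟩⟩

/-- The closed loop is that of `Km` on `N`, which is antistable, and that of `Kp` on the complement,
which is semistable. -/
lemma specPos_projectedSolution
    (hP : IsProjectionAlong P N ((orthComplement N).comap (Kp - Km).mulVecLin))
    (hm : Km ∈ solARE A B Q) (hp : Kp ∈ solARE A B Q)
    (hst : RootsIn {z | z.re ≤ 0} (closedLoop A B Kp).charpoly)
    (hN : ∀ x ∈ N, closedLoop A B Km *ᵥ x ∈ N)
    (hNpos : ∀ x ∈ N, SpectrallyIn {z | 0 < z.re} (closedLoop A B Km) x) :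
    specPos (closedLoop A B (projectedSolution Km Kp P)) = N := by
  ext x
  rw [specPos, mem_spectralSubspace isVertical_pos]
  constructor
  · intro h
    have h1 := (spectrallyIn_projectedSolution hP hm hp hN h).2
    have h2 := h1.eq_zero (spectrallyIn_of_charpoly hst _) disjoint_pos_nonpos
    rw [sub_eq_zero.mp h2]
    exact (hP.mem_left x).1
  · intro h
    exact (SpectrallyIn.congr hN (fun y hy => closedLoop_projectedSolution_left hP hy) h).mpr
      (hNpos x h)

lemma mem_right_of_spectrallyIn
    (hP : IsProjectionAlong P N ((orthComplement N).comap (Kp - Km).mulVecLin))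
    (hm : Km ∈ solARE A B Q) (hp : Kp ∈ solARE A B Q)
    (hN : ∀ x ∈ N, closedLoop A B Km *ᵥ x ∈ N)
    (hNpos : ∀ x ∈ N, SpectrallyIn {z | 0 < z.re} (closedLoop A B Km) x) {x : ι → ℝ}
    (hx : SpectrallyIn {z | z.re ≤ 0} (closedLoop A B (projectedSolution Km Kp P)) x) :
    x ∈ (orthComplement N).comap (Kp - Km).mulVecLin ∧
      ∀ R, SpectrallyIn R (closedLoop A B (projectedSolution Km Kp P)) x →
        SpectrallyIn R (closedLoop A B Kp) x := by
  have h1 := (spectrallyIn_projectedSolution hP hm hp hN hx).1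
  have h2 : P *ᵥ x = 0 := (hNpos _ (hP.mem_left x).1).eq_zero h1 disjoint_pos_nonpos
  refine ⟨by simpa [h2] using (hP.mem_left x).2, fun R hR => ?_⟩
  simpa [h2] using (spectrallyIn_projectedSolution hP hm hp hN hR).2

/-- The gap solves a weightless Riccati equation with drift minus the closed loop of `Kp`, and
neutral vectors have no antistable part for that drift either. -/
lemma gap_mulVec_eq_zero_of_neutral
    (hP : IsProjectionAlong P N ((orthComplement N).comap (Kp - Km).mulVecLin))
    (hm : Km ∈ solARE A B Q) (hp : Kp ∈ solARE A B Q)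
    (hgap : (Kp - Km).PosSemidef) (hstab : HasStabilizer (-A) B)
    (hN : ∀ x ∈ N, closedLoop A B Km *ᵥ x ∈ N)
    (hNpos : ∀ x ∈ N, SpectrallyIn {z | 0 < z.re} (closedLoop A B Km) x) {x : ι → ℝ}
    (hx : SpectrallyIn {z | z.re = 0} (closedLoop A B (projectedSolution Km Kp P)) x) :
    (Kp - Km) *ᵥ x = 0 := by
  have h1 := (mem_right_of_spectrallyIn hP hm hp hN hNpos (hx.mono fun z hz => hz.le)).2 _ hx
  have h2 := hstab.hautus.closedLoop (-Kp)
  rw [closedLoop_neg] at h2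
  have h3 : (-closedLoop A B Kp)ᵀ * (Kp - Km) + (Kp - Km) * -closedLoop A B Kp -
      (Kp - Km) * B * Bᵀ * (Kp - Km) + 0 = 0 := by
    have h := lyapunov_closedLoop_sub (A := A) (B := B) (Q := Q) hp.1 hm.1
    rw [hp.2, hm.2, transpose_mul, transpose_transpose, (hp.1.sub hm.1).eq] at h
    rw [transpose_neg, Matrix.neg_mul, Matrix.mul_neg, ← neg_add, h]
    simp only [Matrix.mul_assoc]
    abel
  exact mulVec_eq_zero_of_riccati h2 hgap h3 (h1.neg.mono fun z hz => by
    simpa using (le_of_eq (by simpa using hz))) (by simp)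

end Structure

/-! ### Primitives of locally integrable functions on the half-line -/

/-- `f` is a primitive of the locally integrable function `f'` on `[0, ∞)`. -/
def HasPrim (f f' : ℝ → ℝ) : Prop :=
  ∀ T : ℝ, 0 ≤ T → IntervalIntegrable f' volume 0 T ∧ f T = f 0 + ∫ t in (0 : ℝ)..T, f' t

lemma HasPrim.continuousOn {f f' : ℝ → ℝ} (h : HasPrim f f') {T : ℝ} (hT : 0 ≤ T) :
    ContinuousOn f (Set.uIcc 0 T) := by
  have h1 : ContinuousOn (fun t => f 0 + ∫ s in (0 : ℝ)..t, f' s) (Set.uIcc 0 T) :=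
    continuousOn_const.add (intervalIntegral.continuousOn_primitive_interval'
      (h T hT).1 Set.left_mem_uIcc)
  refine h1.congr fun t ht => (h t ?_).2
  rw [Set.uIcc_of_le hT] at ht
  exact ht.1

lemma HasPrim.sub_eq {f f' : ℝ → ℝ} (h : HasPrim f f') {a b : ℝ} (ha : 0 ≤ a) (hb : 0 ≤ b) :
    f b - f a = ∫ t in a..b, f' t := by
  rw [(h b hb).2, (h a ha).2, ← intervalIntegral.integral_interval_sub_left (h b hb).1 (h a ha).1]
  ring

lemma HasPrim.intervalIntegrable {f f' : ℝ → ℝ} (h : HasPrim f f') {a b : ℝ} (ha : 0 ≤ a)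
    (hb : 0 ≤ b) : IntervalIntegrable f' volume a b :=
  (h a ha).1.symm.trans (h b hb).1

lemma HasPrim.add {f f' g g' : ℝ → ℝ} (hf : HasPrim f f') (hg : HasPrim g g') :
    HasPrim (fun t => f t + g t) (fun t => f' t + g' t) := fun T hT =>
  ⟨(hf T hT).1.add (hg T hT).1, by
    rw [intervalIntegral.integral_add (hf T hT).1 (hg T hT).1]
    beta_reduce
    rw [(hf T hT).2, (hg T hT).2]; ring⟩

lemma HasPrim.const_mul {f f' : ℝ → ℝ} (c : ℝ) (hf : HasPrim f f') :
    HasPrim (fun t => c * f t) (fun t => c * f' t) := fun T hT =>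
  ⟨(hf T hT).1.const_mul c, by
    rw [intervalIntegral.integral_const_mul]
    beta_reduce
    rw [(hf T hT).2]; ring⟩

lemma HasPrim.sum {α : Type*} (s : Finset α) {f f' : α → ℝ → ℝ}
    (h : ∀ i ∈ s, HasPrim (f i) (f' i)) :
    HasPrim (fun t => ∑ i ∈ s, f i t) (fun t => ∑ i ∈ s, f' i t) := by
  classical
  induction s using Finset.induction_on with
  | empty => intro T _; simp
  | insert a s ha ih =>
    simp only [Finset.sum_insert ha]
    exact (h a (Finset.mem_insert_self a s)).add
      (ih fun i hi => h i (Finset.mem_insert_of_mem hi))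

/-- Controls are only locally square integrable, so trajectories are merely absolutely continuous
and the product rule holds almost everywhere, in integrated form. -/
lemma HasPrim.mul {f f' g g' : ℝ → ℝ} (hf : HasPrim f f') (hg : HasPrim g g') :
    HasPrim (fun t => f t * g t) (fun t => f' t * g t + f t * g' t) := by
  intro T hT
  refine ⟨((hf T hT).1.mul_continuousOn (hg.continuousOn hT)).add
    ((hg T hT).1.continuousOn_mul (hf.continuousOn hT)), ?_⟩
  -- `f` is unrestricted on the negative axis; it is replaced by the formula for its primitive, with
  -- which it agrees on `[0, T]`.
  have hac : ∀ {f f' : ℝ → ℝ}, HasPrim f f' →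
      AbsolutelyContinuousOnInterval (fun t => f 0 + ∫ s in (0 : ℝ)..t, f' s) 0 T := by
    intro f f' h
    have h1 := (h T hT).1.absolutelyContinuousOnInterval_intervalIntegral Set.left_mem_uIcc
    have h2 : AbsolutelyContinuousOnInterval (fun _ : ℝ => f 0) 0 T :=
      (LipschitzWith.const (f 0)).lipschitzOnWith.absolutelyContinuousOnInterval
    exact h2.add h1
  have hder : ∀ {f f' : ℝ → ℝ}, HasPrim f f' → ∀ᵐ t, t ∈ Set.uIcc 0 T →
      deriv (fun t => f 0 + ∫ s in (0 : ℝ)..t, f' s) t = f' t := by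
    intro f f' h
    filter_upwards [(h T hT).1.ae_hasDerivAt_integral] with t ht htm
    exact ((ht htm 0 Set.left_mem_uIcc).const_add (f 0)).deriv
  have key := (hac hf).integral_deriv_mul_eq_sub (hac hg)
  have h2 : ∀ t ∈ Set.uIcc 0 T, f t = f 0 + ∫ s in (0 : ℝ)..t, f' s := fun t ht =>
    (hf t (by rw [Set.uIcc_of_le hT] at ht; exact ht.1)).2
  have h3 : ∀ t ∈ Set.uIcc 0 T, g t = g 0 + ∫ s in (0 : ℝ)..t, g' s := fun t ht =>
    (hg t (by rw [Set.uIcc_of_le hT] at ht; exact ht.1)).2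
  have h4 : ∫ t in (0 : ℝ)..T, (f' t * g t + f t * g' t) = f T * g T - f 0 * g 0 := by
    rw [h2 T Set.right_mem_uIcc, h3 T Set.right_mem_uIcc]
    refine Eq.trans ?_ (key.trans (by simp))
    refine intervalIntegral.integral_congr_ae ?_
    filter_upwards [hder hf, hder hg] with t h5 h6 ht
    have ht' := Set.uIoc_subset_uIcc ht
    rw [h5 ht', h6 ht', ← h2 t ht', ← h3 t ht']
  rw [h4]; ring

lemma hasPrim_of_hasDerivAt {f f' : ℝ → ℝ} (h : ∀ t, HasDerivAt f (f' t) t)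
    (hc : Continuous f') : HasPrim f f' := fun T _ =>
  ⟨hc.intervalIntegrable 0 T, by
    rw [intervalIntegral.integral_eq_sub_of_hasDerivAt (fun t _ => h t)
      (hc.intervalIntegrable 0 T)]; ring⟩

section Vector

variable {ι κ : Type*} [Fintype ι] [Fintype κ] {m : ℕ}

/-- Componentwise version of `HasPrim`. -/
def HasPrimVec (x g : ℝ → ι → ℝ) : Prop := ∀ i, HasPrim (fun t => x t i) (fun t => g t i)

lemma HasPrimVec.mulVec {x g : ℝ → ι → ℝ} (M : Matrix κ ι ℝ) (h : HasPrimVec x g) :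
    HasPrimVec (fun t => M *ᵥ x t) (fun t => M *ᵥ g t) := fun i => by
  simp only [Matrix.mulVec, dotProduct]
  exact HasPrim.sum _ fun j _ => (h j).const_mul (M i j)

lemma HasPrimVec.dotProduct {x g y h : ℝ → ι → ℝ} (hx : HasPrimVec x g) (hy : HasPrimVec y h) :
    HasPrim (fun t => x t ⬝ᵥ y t) (fun t => g t ⬝ᵥ y t + x t ⬝ᵥ h t) := by
  simp only [_root_.dotProduct, ← Finset.sum_add_distrib]
  exact HasPrim.sum _ fun i _ => (hx i).mul (hy i)

lemma HasPrimVec.quadForm {x g : ℝ → ι → ℝ} (hx : HasPrimVec x g) (S : Matrix ι ι ℝ) :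
    HasPrim (fun t => x t ⬝ᵥ S *ᵥ x t) (fun t => g t ⬝ᵥ S *ᵥ x t + x t ⬝ᵥ S *ᵥ g t) :=
  hx.dotProduct (hx.mulVec S)

lemma HasPrimVec.continuousOn_dotProduct {x g : ℝ → ι → ℝ} (hx : HasPrimVec x g) {T : ℝ}
    (hT : 0 ≤ T) (S : Matrix ι ι ℝ) : ContinuousOn (fun t => x t ⬝ᵥ S *ᵥ x t) (Set.uIcc 0 T) :=
  (hx.quadForm S).continuousOn hT

/-! ### Controls -/

lemma IsL2Loc.intervalIntegrable {u : ℝ → Fin m → ℝ} (hu : IsL2Loc u) {T : ℝ} (hT : 0 ≤ T) :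
    IntervalIntegrable (fun t => u t ⬝ᵥ u t) volume 0 T := by
  rw [intervalIntegrable_iff_integrableOn_Icc_of_le hT]
  exact hu.integrable T hT

lemma sq_le_dotProduct_self (y : ι → ℝ) (i : ι) : y i ^ 2 ≤ y ⬝ᵥ y := by
  rw [sq]
  exact Finset.single_le_sum (f := fun i => y i * y i) (fun j _ => mul_self_nonneg (y j))
    (Finset.mem_univ i)

lemma IsL2Loc.intervalIntegrable_apply {u : ℝ → Fin m → ℝ} (hu : IsL2Loc u) {T : ℝ} (hT : 0 ≤ T)
    (j : Fin m) : IntervalIntegrable (fun t => u t j) volume 0 T := by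
  -- Domination by `|u|² + 1`, using `|a| ≤ a² + 1`.
  refine ((hu.intervalIntegrable hT).add (intervalIntegrable_const (c := (1 : ℝ)))).mono_fun
    (measurable_pi_iff.mp hu.measurable j).aestronglyMeasurable ?_
  refine Eventually.of_forall fun t => ?_
  have h1 := sq_le_dotProduct_self (u t) j
  have h2 : 0 ≤ u t ⬝ᵥ u t := (sq_nonneg _).trans h1
  beta_reduce
  rw [Real.norm_eq_abs, Real.norm_eq_abs, abs_of_nonneg (a := u t ⬝ᵥ u t + 1) (by linarith)]
  nlinarith [sq_abs (u t j), sq_nonneg (|u t j| - 1)]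

/-- `x` solves `x' = A x + B u` on `[0, ∞)`, in an arbitrary coordinate space. -/
def IsCurve (A : Matrix ι ι ℝ) (B : Matrix ι (Fin m) ℝ) (u : ℝ → Fin m → ℝ) (x : ℝ → ι → ℝ) :
    Prop :=
  HasPrimVec x fun t => A *ᵥ x t + B *ᵥ u t

lemma IsTrajectory.isCurve {n : ℕ} {A : Matrix (Fin n) (Fin n) ℝ} {B : Matrix (Fin n) (Fin m) ℝ}
    {x₀ : Fin n → ℝ} {u : ℝ → Fin m → ℝ} {x : ℝ → Fin n → ℝ} (hx : IsTrajectory A B x₀ u x)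
    (hu : IsL2Loc u) : IsCurve A B u x ∧ x 0 = x₀ := by
  have h0 : x 0 = x₀ := by simpa using hx.eq_integral 0 le_rfl
  refine ⟨fun i T hT => ?_, h0⟩
  have hi : ∀ i, IntervalIntegrable (fun t => (A *ᵥ x t + B *ᵥ u t) i) volume 0 T := by
    intro i
    refine IntervalIntegrable.add (f := fun t => (A *ᵥ x t) i) (g := fun t => (B *ᵥ u t) i) ?_ ?_
    · refine ContinuousOn.intervalIntegrable ?_
      have h1 : ContinuousOn x (Set.uIcc 0 T) := hx.continuousOn.mono fun t ht => by
        rw [Set.uIcc_of_le hT] at ht; exact ht.1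
      exact (continuous_apply i).comp_continuousOn
        ((continuous_const.matrix_mulVec continuous_id).comp_continuousOn h1)
    · simp only [Matrix.mulVec, _root_.dotProduct]
      have := IntervalIntegrable.sum (f := fun j t => B i j * u t j) Finset.univ fun j _ =>
        (hu.intervalIntegrable_apply hT j).const_mul (B i j)
      simpa only [Finset.sum_fn] using this
  refine ⟨hi i, ?_⟩
  have h1 := congrFun (hx.eq_integral T hT) i
  have h2 : IntervalIntegrable (fun t => A *ᵥ x t + B *ᵥ u t) volume 0 T := by
    constructor
    · exact Integrable.of_eval fun i => (hi i).1
    · exact Integrable.of_eval fun i => (hi i).2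
  beta_reduce
  rw [h1, Pi.add_apply, h0]
  congr 1
  have := (ContinuousLinearMap.proj (R := ℝ) (φ := fun _ : Fin n => ℝ) i).intervalIntegral_comp_comm
    h2
  exact this.symm

lemma IsCurve.map {A : Matrix ι ι ℝ} {B : Matrix ι (Fin m) ℝ} {u : ℝ → Fin m → ℝ} {x : ℝ → ι → ℝ}
    (hx : IsCurve A B u x) {E : Matrix κ ι ℝ} {A' : Matrix κ κ ℝ} (hA : E * A = A' * E) :
    IsCurve A' (E * B) u (fun t => E *ᵥ x t) := by
  have := hx.mulVec E
  simp only [mulVec_add, mulVec_mulVec, hA] at this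
  simpa only [IsCurve, mulVec_mulVec] using this

lemma IsCurve.intervalIntegrable_cost {A : Matrix ι ι ℝ} {B : Matrix ι (Fin m) ℝ}
    {u : ℝ → Fin m → ℝ} {x : ℝ → ι → ℝ} (hx : IsCurve A B u x) (hu : IsL2Loc u) (Q : Matrix ι ι ℝ)
    {T : ℝ} (hT : 0 ≤ T) :
    IntervalIntegrable (fun t => x t ⬝ᵥ Q *ᵥ x t + u t ⬝ᵥ u t) volume 0 T :=
  (hx.continuousOn_dotProduct hT Q).intervalIntegrable.add (hu.intervalIntegrable hT)

/-- Completion of the squares. -/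
lemma cost_density_eq (A Q : Matrix ι ι ℝ) (B : Matrix ι (Fin m) ℝ) {K : Matrix ι ι ℝ}
    (hK : K.IsSymm) (x : ι → ℝ) (u : Fin m → ℝ) :
    (u + Bᵀ *ᵥ (K *ᵥ x)) ⬝ᵥ (u + Bᵀ *ᵥ (K *ᵥ x)) + x ⬝ᵥ riccati A B Q K *ᵥ x =
      (x ⬝ᵥ Q *ᵥ x + u ⬝ᵥ u) +
        ((A *ᵥ x + B *ᵥ u) ⬝ᵥ K *ᵥ x + x ⬝ᵥ K *ᵥ (A *ᵥ x + B *ᵥ u)) := by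
  have h1 : ∀ y, x ⬝ᵥ K *ᵥ y = (K *ᵥ x) ⬝ᵥ y := fun y => by
    rw [dotProduct_mulVec, ← mulVec_transpose, hK.eq]
  have h2 : ∀ y, x ⬝ᵥ Aᵀ *ᵥ y = (A *ᵥ x) ⬝ᵥ y := fun y => by
    rw [dotProduct_mulVec, vecMul_transpose]
  have h3 : ∀ y z, y ⬝ᵥ B *ᵥ z = (Bᵀ *ᵥ y) ⬝ᵥ z := fun y z => by
    rw [dotProduct_mulVec, mulVec_transpose]
  have h4 : ∀ y z, (B *ᵥ z) ⬝ᵥ y = (Bᵀ *ᵥ y) ⬝ᵥ z := fun y z => by rw [dotProduct_comm, h3]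
  simp only [riccati, add_mulVec, sub_mulVec, dotProduct_add, dotProduct_sub, ← mulVec_mulVec,
    h1, h2, h3, h4, add_dotProduct]
  rw [dotProduct_comm (K *ᵥ x) (A *ᵥ x), dotProduct_comm u (Bᵀ *ᵥ (K *ᵥ x))]
  ring

lemma IsCurve.hasPrim_squares {A : Matrix ι ι ℝ} {B : Matrix ι (Fin m) ℝ} {u : ℝ → Fin m → ℝ}
    {x : ℝ → ι → ℝ} (hx : IsCurve A B u x) (hu : IsL2Loc u) (Q : Matrix ι ι ℝ) {K : Matrix ι ι ℝ}
    (hK : K.IsSymm) :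
    HasPrim (fun T => (∫ t in (0 : ℝ)..T, (x t ⬝ᵥ Q *ᵥ x t + u t ⬝ᵥ u t)) + x T ⬝ᵥ K *ᵥ x T)
      (fun t => (u t + Bᵀ *ᵥ (K *ᵥ x t)) ⬝ᵥ (u t + Bᵀ *ᵥ (K *ᵥ x t)) +
        x t ⬝ᵥ riccati A B Q K *ᵥ x t) := by
  simp only [cost_density_eq A Q B hK]
  have h1 : HasPrim (fun T => ∫ t in (0 : ℝ)..T, (x t ⬝ᵥ Q *ᵥ x t + u t ⬝ᵥ u t))
      (fun t => x t ⬝ᵥ Q *ᵥ x t + u t ⬝ᵥ u t) := fun T hT =>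
    ⟨hx.intervalIntegrable_cost hu Q hT, by simp⟩
  exact h1.add (HasPrimVec.quadForm hx K)

end Vector

/-! ### Functions that are small or bounded up to a square integrable function -/

/-- Functions that are arbitrarily small near infinity up to a square integrable function. -/
def nearL2 : Submodule ℝ (ℝ → ℝ) where
  carrier := {g | ∀ ε > 0, ∃ f : ℝ → ℝ, MemLp f 2 volume ∧ ∀ᶠ t in atTop, |g t - f t| ≤ ε}
  add_mem' := by
    intro g h hg hh ε hε
    obtain ⟨f, hf, hgf⟩ := hg (ε / 2) (by positivity)
    obtain ⟨k, hk, hhk⟩ := hh (ε / 2) (by positivity)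
    refine ⟨f + k, hf.add hk, ?_⟩
    filter_upwards [hgf, hhk] with t h1 h2
    rw [Pi.add_apply, Pi.add_apply, add_sub_add_comm]
    linarith [abs_add_le (g t - f t) (h t - k t)]
  zero_mem' := fun ε hε => ⟨0, MemLp.zero', by simp [hε.le]⟩
  smul_mem' := by
    intro c g hg ε hε
    obtain ⟨f, hf, hgf⟩ := hg (ε / (|c| + 1)) (by positivity)
    refine ⟨c • f, hf.const_smul c, ?_⟩
    filter_upwards [hgf] with t h1
    rw [Pi.smul_apply, Pi.smul_apply, smul_eq_mul, smul_eq_mul, ← mul_sub, abs_mul]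
    calc |c| * |g t - f t| ≤ (|c| + 1) * (ε / (|c| + 1)) := by gcongr; linarith
      _ = ε := by field_simp

/-- Functions that are bounded near infinity up to a square integrable function. -/
def boundedModL2 : Submodule ℝ (ℝ → ℝ) where
  carrier := {g | ∃ C : ℝ, ∃ f : ℝ → ℝ, MemLp f 2 volume ∧ ∀ᶠ t in atTop, |g t - f t| ≤ C}
  add_mem' := by
    rintro g h ⟨C, f, hf, hgf⟩ ⟨C', k, hk, hhk⟩
    refine ⟨C + C', f + k, hf.add hk, ?_⟩
    filter_upwards [hgf, hhk] with t h1 h2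
    rw [Pi.add_apply, Pi.add_apply, add_sub_add_comm]
    linarith [abs_add_le (g t - f t) (h t - k t)]
  zero_mem' := ⟨0, 0, MemLp.zero', by simp⟩
  smul_mem' := by
    rintro c g ⟨C, f, hf, hgf⟩
    refine ⟨|c| * C, c • f, hf.const_smul c, ?_⟩
    filter_upwards [hgf] with t h1
    rw [Pi.smul_apply, Pi.smul_apply, smul_eq_mul, smul_eq_mul, ← mul_sub, abs_mul]
    gcongr

lemma nearL2_le_boundedModL2 : nearL2 ≤ boundedModL2 := fun _ hg => ⟨1, hg 1 one_pos⟩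

/-- Stability under positive time shifts and under decaying perturbations. -/
structure IsShiftClass (S : Submodule ℝ (ℝ → ℝ)) : Prop where
  shift : ∀ g ∈ S, ∀ h : ℝ, (fun t => g (t + h)) ∈ S
  of_tendsto : ∀ g : ℝ → ℝ, Tendsto g atTop (𝓝 0) → g ∈ S

lemma mem_nearL2_of_tendsto {g : ℝ → ℝ} (hg : Tendsto g atTop (𝓝 0)) : g ∈ nearL2 := by
  intro ε hε
  refine ⟨0, MemLp.zero', ?_⟩
  filter_upwards [(Metric.tendsto_nhds.mp hg) ε hε] with t ht
  simpa [Real.dist_eq] using ht.le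

lemma memLp_shift {f : ℝ → ℝ} (hf : MemLp f 2 volume) (h : ℝ) :
    MemLp (fun t => f (t + h)) 2 volume :=
  hf.comp_measurePreserving (measurePreserving_add_right volume h)

lemma isShiftClass_nearL2 : IsShiftClass nearL2 where
  shift g hg h ε hε := by
    obtain ⟨f, hf, hgf⟩ := hg ε hε
    exact ⟨_, memLp_shift hf h, (tendsto_atTop_add_const_right atTop h tendsto_id).eventually hgf⟩
  of_tendsto _ := mem_nearL2_of_tendsto

lemma isShiftClass_boundedModL2 : IsShiftClass boundedModL2 where
  shift := by
    rintro g ⟨C, f, hf, hgf⟩ h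
    exact ⟨C, _, memLp_shift hf h,
      (tendsto_atTop_add_const_right atTop h tendsto_id).eventually hgf⟩
  of_tendsto _ hg := nearL2_le_boundedModL2 (mem_nearL2_of_tendsto hg)

lemma frequently_lt_of_integrable {g : ℝ → ℝ} (hg : Integrable g) {ε : ℝ} (hε : 0 < ε) :
    ∃ᶠ t in atTop, g t < ε := by
  intro h
  simp only [not_lt] at h
  obtain ⟨T, hT⟩ := eventually_atTop.mp h
  have h1 : IntegrableOn (fun _ : ℝ => ε) (Set.Ioi T) := by
    refine (hg.integrableOn (s := Set.Ioi T)).mono' aestronglyMeasurable_const ?_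
    filter_upwards [ae_restrict_mem measurableSet_Ioi] with t ht
    rw [Real.norm_eq_abs, abs_of_pos hε]
    exact hT t (le_of_lt ht)
  rw [integrableOn_const_iff] at h1
  simp [hε.ne'] at h1

/-! ### Linear functionals along a trajectory. -/

section Functionals

variable {ι : Type*} [Fintype ι] [DecidableEq ι] {m : ℕ}

/-- The functionals `c` for which `t ↦ c ⬝ᵥ x t` belongs to the class `S`. -/
def functionalsIn (S : Submodule ℝ (ℝ → ℝ)) (x : ℝ → ι → ℝ) : Submodule ℝ (ι → ℝ) :=
  S.comap (show (ι → ℝ) →ₗ[ℝ] (ℝ → ℝ) from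
    { toFun := fun c t => c ⬝ᵥ x t
      map_add' := fun c d => by ext t; simp
      map_smul' := fun a c => by ext t; simp })

lemma mem_functionalsIn {S : Submodule ℝ (ℝ → ℝ)} {x : ℝ → ι → ℝ} {c : ι → ℝ} :
    c ∈ functionalsIn S x ↔ (fun t => c ⬝ᵥ x t) ∈ S := Iff.rfl

/-- Shifting time by `h` amounts, up to a decaying error, to applying exp(hAᵀ) to the functional.
The subspace is thus stable under the flow, and being closed it contains the derivative of the flow
at 0. -/
lemma transpose_mulVec_mem_functionalsIn {S : Submodule ℝ (ℝ → ℝ)} (hS : IsShiftClass S)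
    {x : ℝ → ι → ℝ} {A : Matrix ι ι ℝ}
    (hx : ∀ (d : ι → ℝ) (h : ℝ), 0 ≤ h →
      Tendsto (fun t => d ⬝ᵥ x (t + h) - (flow Aᵀ h *ᵥ d) ⬝ᵥ x t) atTop (𝓝 0))
    {c : ι → ℝ} (hc : c ∈ functionalsIn S x) : Aᵀ *ᵥ c ∈ functionalsIn S x := by
  have h1 : ∀ h : ℝ, 0 ≤ h → flow Aᵀ h *ᵥ c ∈ functionalsIn S x := by
    intro h hh
    have h2 := S.sub_mem (hS.shift _ hc h) (hS.of_tendsto _ (hx c h hh))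
    rw [mem_functionalsIn]
    convert! h2 using 1
    ext t
    simp
  have h3 := (hasDerivAt_flow_mulVec Aᵀ c 0).tendsto_slope_zero_right
  simp only [zero_add, flow_zero, one_mulVec] at h3
  refine (functionalsIn S x).closed_of_finiteDimensional.mem_of_tendsto h3 ?_
  filter_upwards [self_mem_nhdsWithin] with h hh
  exact Submodule.smul_mem _ _ (Submodule.sub_mem _ (h1 h (le_of_lt hh)) hc)

lemma orthComplement_orthComplement_le (V : Submodule ℝ (ι → ℝ)) :
    orthComplement (orthComplement V) ≤ V := by
  intro c hc
  by_contra hcV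
  obtain ⟨f, hf, hfV⟩ := Submodule.exists_le_ker_of_notMem hcV
  have hz : ∀ y, f y = y ⬝ᵥ fun i => f (Pi.single i 1) := fun y => by
    rw [LinearMap.pi_apply_eq_sum_univ f y]
    refine Finset.sum_congr rfl fun i _ => ?_
    rw [smul_eq_mul]
    congr 2
    ext j
    simp [Pi.single_apply, eq_comm]
  refine hf ?_
  rw [hz, dotProduct_comm]
  refine hc _ fun v hv => ?_
  rw [← hz]
  exact hfV hv

lemma orthComplement_invariant {V : Submodule ℝ (ι → ℝ)} {A : Matrix ι ι ℝ}
    (hV : ∀ c ∈ V, Aᵀ *ᵥ c ∈ V) {z : ι → ℝ} (hz : z ∈ orthComplement V) :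
    A *ᵥ z ∈ orthComplement V := by
  intro c hc
  rw [dotProduct_mulVec, ← mulVec_transpose]
  exact hz _ (hV c hc)

lemma mulVec_eq_zero_of_mem_orthComplement {V : Submodule ℝ (ι → ℝ)} {S : Matrix ι ι ℝ}
    (hS : S.IsSymm) (hV : ∀ c, S *ᵥ c ∈ V) {z : ι → ℝ} (hz : z ∈ orthComplement V) :
    S *ᵥ z = 0 := by
  refine dotProduct_eq _ _ fun c => ?_
  have := hz _ (hV c)
  rwa [dotProduct_comm, zero_dotProduct, dotProduct_mulVec, ← mulVec_transpose, hS.eq]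

lemma aeval_transpose (M : Matrix ι ι ℝ) (p : ℝ[X]) : (aeval M p)ᵀ = aeval Mᵀ p := by
  induction p using Polynomial.induction_on' with
  | add p q hp hq => rw [map_add, map_add, transpose_add, hp, hq]
  | monomial k a =>
    rw [aeval_monomial, aeval_monomial, ← Algebra.smul_def, ← Algebra.smul_def, transpose_smul,
      transpose_pow]

lemma flow_mul_flow_neg (A : Matrix ι ι ℝ) (t : ℝ) : flow A t * flow (-A) t = 1 := by
  rw [flow, flow, smul_neg, Matrix.exp_neg]
  exact mul_nonsing_inv _ ((isUnit_iff_isUnit_det _).mp (Matrix.isUnit_exp _))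

/-- Functionals on the antistable part that are bounded modulo `L²` are small modulo `L²`. -/
lemma mem_functionalsIn_nearL2 {x : ℝ → ι → ℝ} {A : Matrix ι ι ℝ}
    (hx : ∀ (d : ι → ℝ) (h : ℝ), 0 ≤ h →
      Tendsto (fun t => d ⬝ᵥ x (t + h) - (flow Aᵀ h *ᵥ d) ⬝ᵥ x t) atTop (𝓝 0))
    (hb : specPos Aᵀ ≤ functionalsIn boundedModL2 x) : specPos Aᵀ ≤ functionalsIn nearL2 x := by
  intro c hc
  rw [mem_functionalsIn]
  intro ε hε
  have hinv : ∀ y ∈ specPos Aᵀ, -Aᵀ *ᵥ y ∈ specPos Aᵀ := by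
    intro y hy
    rw [neg_mulVec]
    refine Submodule.neg_mem _ ?_
    rw [specPos, mem_spectralSubspace isVertical_pos] at hy ⊢
    exact hy.mulVec
  have hdecay : Tendsto (fun t => flow (-Aᵀ) t *ᵥ c) atTop (𝓝 0) := by
    refine tendsto_flow_of_spectrallyIn ?_
    rw [specPos, mem_spectralSubspace isVertical_pos] at hc
    exact hc.neg.mono fun z hz => by simpa using hz
  set b := Module.finBasis ℝ (specPos Aᵀ) with hbdef
  have hbd : ∀ i, ∃ C : ℝ, ∃ f : ℝ → ℝ, MemLp f 2 volume ∧
      ∀ᶠ t in atTop, |(b i : ι → ℝ) ⬝ᵥ x t - f t| ≤ C := fun i => hb (b i).2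
  choose C f hf hfC using hbd
  -- The coordinates are extended to the whole space so that continuity makes them tend to 0 along
  -- the decaying backward flow.
  have hext : ∀ i, ∃ l : (ι → ℝ) →ₗ[ℝ] ℝ, l.comp (specPos Aᵀ).subtype = b.coord i := fun i =>
    LinearMap.exists_extend (b.coord i)
  choose l hl using hext
  have hl0 : Tendsto (fun t => ∑ i, |l i (flow (-Aᵀ) t *ᵥ c)| * |C i|) atTop (𝓝 0) := by
    rw [show (0 : ℝ) = ∑ i, |l i 0| * |C i| by simp]
    refine tendsto_finsetSum _ fun i _ => Tendsto.mul_const _ (Tendsto.abs ?_)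
    exact ((l i).continuous_of_finiteDimensional.tendsto 0).comp hdecay
  -- The length of the backward flow: `d` has coordinates small enough to beat the bounds `C i` of
  -- the basis functionals.
  obtain ⟨h, hh0, hh⟩ : ∃ h : ℝ, 0 ≤ h ∧ ∑ i, |l i (flow (-Aᵀ) h *ᵥ c)| * |C i| ≤ ε / 2 := by
    have h1 := (hl0.eventually (ge_mem_nhds (half_pos hε) : ∀ᶠ y in 𝓝 (0 : ℝ), y ≤ ε / 2)).and
      (eventually_ge_atTop 0)
    obtain ⟨h, h2, h3⟩ := h1.exists
    exact ⟨h, h3, h2⟩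
  set d := flow (-Aᵀ) h *ᵥ c with hd
  have hdmem : d ∈ specPos Aᵀ := flow_mulVec_mem hinv hc h
  have hdsum : d = ∑ i, l i d • (b i : ι → ℝ) := by
    have h1 := congrArg (fun y : specPos Aᵀ => (y : ι → ℝ)) (b.sum_repr ⟨d, hdmem⟩)
    simp only [Submodule.coe_sum, Submodule.coe_smul] at h1
    rw [← h1]
    have h2 : ∀ i, l i d = b.repr ⟨d, hdmem⟩ i := fun i =>
      LinearMap.congr_fun (hl i) ⟨d, hdmem⟩
    simp only [h1, h2]
  -- Hence `c ⬝ᵥ x t` is close to `d ⬝ᵥ x (t + h)`: a bounded quantity with small coefficients, up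
  -- to an L² function.
  have hcd : flow Aᵀ h *ᵥ d = c := by rw [hd, mulVec_mulVec, flow_mul_flow_neg, one_mulVec]
  refine ⟨fun t => ∑ i, l i d * f i (t + h), ?_, ?_⟩
  · exact memLp_finsetSum (f := fun i t => l i d * f i (t + h)) _ fun i _ =>
      (memLp_shift (hf i) h).const_mul (l i d)
  · have h1 := hx d h hh0
    rw [hcd] at h1
    have h2 := eventually_all.mpr fun i =>
      (tendsto_atTop_add_const_right atTop h tendsto_id).eventually (hfC i)
    filter_upwards [Metric.tendsto_nhds.mp h1 (ε / 2) (half_pos hε), h2] with t h3 h4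
    rw [Real.dist_eq, sub_zero] at h3
    have h5 : d ⬝ᵥ x (t + h) = ∑ i, l i d * ((b i : ι → ℝ) ⬝ᵥ x (t + h)) := by
      conv_lhs => rw [hdsum]
      simp [sum_dotProduct]
    have h6 : |d ⬝ᵥ x (t + h) - ∑ i, l i d * f i (t + h)| ≤ ε / 2 := by
      rw [h5, ← Finset.sum_sub_distrib]
      refine (Finset.abs_sum_le_sum_abs _ _).trans (le_trans (Finset.sum_le_sum fun i _ => ?_) hh)
      rw [← mul_sub, abs_mul]
      exact mul_le_mul_of_nonneg_left ((h4 i).trans (le_abs_self _)) (abs_nonneg _)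
    have h7 : c ⬝ᵥ x t - ∑ i, l i d * f i (t + h) =
        (d ⬝ᵥ x (t + h) - ∑ i, l i d * f i (t + h)) - (d ⬝ᵥ x (t + h) - c ⬝ᵥ x t) := by ring
    rw [h7]
    exact (abs_sub _ _).trans (by linarith)

end Functionals

/-! ### The lower bound for the cost -/

section LowerBound

variable {ι : Type*} [Fintype ι] [DecidableEq ι] {m : ℕ}

lemma integrableOn_Ioi_of_le {f s : ℝ → ℝ} (hf : ∀ T, 0 ≤ T → IntervalIntegrable f volume 0 T)
    (hs : ∀ T, 0 ≤ T → IntervalIntegrable s volume 0 T) (h0 : ∀ t, 0 ≤ f t) (hfs : ∀ t, f t ≤ s t)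
    {C : ℝ} (hC : ∀ᶠ T in atTop, ∫ t in (0 : ℝ)..T, s t ≤ C) : IntegrableOn f (Set.Ioi 0) := by
  refine integrableOn_Ioi_of_intervalIntegral_norm_bounded (l := atTop) (b := fun T => T) C 0
    (fun T => ?_) tendsto_id ?_
  · rcases le_total 0 T with hT | hT
    · exact (hf T hT).1
    · rw [Set.Ioc_eq_empty_of_le hT]
      exact integrableOn_empty
  · filter_upwards [hC, eventually_ge_atTop 0] with T hT hT0
    refine le_trans (intervalIntegral.integral_mono_on hT0 (hf T hT0).norm (hs T hT0)
      fun t _ => ?_) hT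
    rw [Real.norm_eq_abs, abs_of_nonneg (h0 t)]
    exact hfs t

/-- Young's inequality with a free weight, constants not sharp. It makes the influence of an L²
input small without taking square roots. -/
lemma abs_dotProduct_le {κ : Type*} [Fintype κ] {δ : ℝ} (hδ : 0 < δ) (a b : κ → ℝ) :
    |a ⬝ᵥ b| ≤ δ * (a ⬝ᵥ a) + (b ⬝ᵥ b) / δ := by
  simp only [dotProduct, Finset.mul_sum, Finset.sum_div, ← Finset.sum_add_distrib]
  refine (Finset.abs_sum_le_sum_abs _ _).trans (Finset.sum_le_sum fun i _ => ?_)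
  rw [abs_mul]
  have h1 : δ * (a i * a i) + b i * b i / δ - |a i| * |b i| =
      ((2 * δ * |a i| - |b i|) ^ 2 + 3 * |b i| ^ 2) / (4 * δ) := by
    rw [← abs_mul_abs_self (a i), ← abs_mul_abs_self (b i)]
    field_simp
    ring
  have h2 : 0 ≤ ((2 * δ * |a i| - |b i|) ^ 2 + 3 * |b i| ^ 2) / (4 * δ) := by positivity
  linarith

lemma tendsto_intervalIntegral_shift {g : ℝ → ℝ} (hg : IntegrableOn g (Set.Ioi 0)) (h : ℝ)
    (hh : 0 ≤ h) : Tendsto (fun t => ∫ s in t..(t + h), g s) atTop (𝓝 0) := by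
  have h1 := intervalIntegral_tendsto_integral_Ioi 0 hg tendsto_id
  have h2 := intervalIntegral_tendsto_integral_Ioi 0 hg (tendsto_atTop_add_const_right atTop h
    tendsto_id)
  have h3 := h2.sub h1
  rw [sub_self] at h3
  refine h3.congr' ?_
  filter_upwards [eventually_ge_atTop 0] with t ht
  have hi : ∀ T, 0 ≤ T → IntervalIntegrable g volume 0 T := fun T hT =>
    (intervalIntegrable_iff_integrableOn_Ioc_of_le hT).mpr (hg.mono_set Set.Ioc_subset_Ioi_self)
  exact intervalIntegral.integral_interval_sub_left (hi _ (add_nonneg ht hh)) (hi _ ht)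

/-- Variation of constants: the response to a square integrable input over a time interval of
fixed length tends to `0`. -/
lemma IsCurve.tendsto_shift {A : Matrix ι ι ℝ} {B : Matrix ι (Fin m) ℝ} {w : ℝ → Fin m → ℝ}
    {x : ℝ → ι → ℝ} (hx : IsCurve A B w x)
    (hw : IntegrableOn (fun t => w t ⬝ᵥ w t) (Set.Ioi 0)) (d : ι → ℝ) (h : ℝ) (hh : 0 ≤ h) :
    Tendsto (fun t => d ⬝ᵥ x (t + h) - (flow Aᵀ h *ᵥ d) ⬝ᵥ x t) atTop (𝓝 0) := by
  have hcont : Continuous fun s => Bᵀ *ᵥ (flow Aᵀ s *ᵥ d) :=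
    continuous_const.matrix_mulVec (continuous_flow_mulVec Aᵀ d)
  obtain ⟨C, hC⟩ : ∃ C, ∀ s ∈ Set.Icc 0 h,
      (Bᵀ *ᵥ (flow Aᵀ s *ᵥ d)) ⬝ᵥ (Bᵀ *ᵥ (flow Aᵀ s *ᵥ d)) ≤ C := by
    obtain ⟨C, hC⟩ := (isCompact_Icc (a := (0 : ℝ)) (b := h)).bddAbove_image
      (hcont.dotProduct hcont).continuousOn
    exact ⟨C, fun s hs => hC (Set.mem_image_of_mem _ hs)⟩
  have hC0 : 0 ≤ C := (dotProduct_self_nonneg' _).trans (hC 0 ⟨le_rfl, hh⟩)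
  have hwi : ∀ a b, 0 ≤ a → a ≤ b → IntervalIntegrable (fun t => w t ⬝ᵥ w t) volume a b :=
    fun a b ha hab => (intervalIntegrable_iff_integrableOn_Ioc_of_le hab).mpr
      (hw.mono_set fun t ht => lt_of_le_of_lt ha ht.1)
  have key : ∀ t, 0 ≤ t → ∀ δ > 0, |d ⬝ᵥ x (t + h) - (flow Aᵀ h *ᵥ d) ⬝ᵥ x t| ≤
      δ * C * h + (∫ s in t..(t + h), w s ⬝ᵥ w s) / δ := by
    intro t ht δ hδ
    -- Pairing with the adjoint solution cancels the drift, leaving only the integral against the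
    -- input.
    have hy : HasPrimVec (fun s => flow Aᵀ (t + h - s) *ᵥ d)
        (fun s => -(Aᵀ *ᵥ (flow Aᵀ (t + h - s) *ᵥ d))) := by
      intro i
      refine hasPrim_of_hasDerivAt (fun s => ?_) ?_
      · have h1 := (hasDerivAt_pi.mp (hasDerivAt_flow_mulVec Aᵀ d (t + h - s)) i)
        have h2 := h1.scomp s ((hasDerivAt_id s).const_sub (t + h))
        simpa using! h2
      · have h3 : Continuous fun s => -(Aᵀ *ᵥ (flow Aᵀ (t + h - s) *ᵥ d)) :=
          (continuous_const.matrix_mulVec ((continuous_flow_mulVec Aᵀ d).comp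
            (continuous_const.sub continuous_id))).neg
        exact (continuous_apply i).comp h3
    have h4 := (hy.dotProduct hx).sub_eq ht (add_nonneg ht hh)
    have h5 := (hy.dotProduct hx).intervalIntegrable ht (add_nonneg ht hh)
    have h6 : ∀ s, -(Aᵀ *ᵥ (flow Aᵀ (t + h - s) *ᵥ d)) ⬝ᵥ x s +
        (flow Aᵀ (t + h - s) *ᵥ d) ⬝ᵥ (A *ᵥ x s + B *ᵥ w s) =
        (Bᵀ *ᵥ (flow Aᵀ (t + h - s) *ᵥ d)) ⬝ᵥ w s := by
      intro s
      rw [dotProduct_add, dotProduct_mulVec _ A, dotProduct_mulVec _ B, ← mulVec_transpose,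
        ← mulVec_transpose, neg_dotProduct]
      ring
    simp only [h6] at h4 h5
    simp only [sub_self, flow_zero, one_mulVec, add_sub_cancel_left] at h4
    rw [h4, ← Real.norm_eq_abs]
    have hth : t ≤ t + h := by linarith
    have hi2 : IntervalIntegrable (fun s => δ * C + (w s ⬝ᵥ w s) / δ) volume t (t + h) :=
      intervalIntegrable_const.add ((hwi _ _ ht hth).div_const δ)
    refine (intervalIntegral.norm_integral_le_of_norm_le hth (Eventually.of_forall
      fun s hs => ?_) hi2).trans (le_of_eq ?_)
    · rw [Real.norm_eq_abs]
      refine (abs_dotProduct_le hδ _ _).trans ?_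
      gcongr
      exact hC _ ⟨by linarith [hs.2], by linarith [hs.1]⟩
    · rw [intervalIntegral.integral_add intervalIntegrable_const ((hwi _ _ ht hth).div_const δ),
        intervalIntegral.integral_const, intervalIntegral.integral_div, smul_eq_mul]
      ring
  rw [Metric.tendsto_nhds]
  intro ε hε
  -- Keeps the term `δ * C * h` below `ε / 2`; the added 1 prevents division by zero.
  set δ := ε / (2 * (C * h + 1)) with hδdef
  have hCh : 0 ≤ C * h := mul_nonneg hC0 hh
  have hδ : 0 < δ := by positivity
  have h7 : δ * C * h ≤ ε / 2 := by
    rw [hδdef, mul_assoc, div_mul_eq_mul_div, div_le_div_iff₀ (by positivity) two_pos]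
    nlinarith
  have h8 := (tendsto_intervalIntegral_shift hw h hh).eventually
    (gt_mem_nhds (show (0 : ℝ) < δ * (ε / 2) by positivity))
  filter_upwards [h8, eventually_ge_atTop 0] with t h9 ht
  rw [Real.dist_eq, sub_zero]
  have h10 : (∫ s in t..(t + h), w s ⬝ᵥ w s) / δ < ε / 2 := by
    rw [div_lt_iff₀ hδ]; linarith
  linarith [key t ht δ hδ]

open scoped MatrixOrder Matrix.Norms.L2Operator in
lemma exists_factor_of_posSemidef {S : Matrix ι ι ℝ} (hS : S.PosSemidef) :
    ∃ R : Matrix ι ι ℝ, S = Rᵀ * R := by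
  obtain ⟨R, hR⟩ := CStarAlgebra.nonneg_iff_eq_star_mul_self.mp hS.nonneg
  exact ⟨R, by rw [hR, star_eq_conjTranspose, conjTranspose_eq_transpose_of_trivial]⟩

/-- In a factorization `S = Rᵀ R` each row of `R` has its square dominated by the form of `S`, and
the range of `S` lies in the span of these rows. Bounds on a quadratic form thereby become bounds on
linear functionals. -/
lemma mulVec_mem_of_posSemidef {S : Matrix ι ι ℝ} (hS : S.PosSemidef) {V : Submodule ℝ (ι → ℝ)}
    (h : ∀ r : ι → ℝ, (∀ y, (r ⬝ᵥ y) ^ 2 ≤ y ⬝ᵥ S *ᵥ y) → r ∈ V) (c : ι → ℝ) : S *ᵥ c ∈ V := by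
  obtain ⟨R, rfl⟩ := exists_factor_of_posSemidef hS
  rw [← mulVec_mulVec, mulVec_transpose, vecMul_eq_sum]
  refine V.sum_mem fun i _ => V.smul_mem _ (h _ fun y => ?_)
  rw [quadForm_transpose_mul_self]
  exact sq_le_dotProduct_self (R *ᵥ y) i

lemma HasPrim.continuousOn_Ici {f f' : ℝ → ℝ} (h : HasPrim f f') : ContinuousOn f (Set.Ici 0) := by
  intro t ht
  have h1 := h.continuousOn (T := t + 1) (by linarith [Set.mem_Ici.mp ht])
  rw [Set.uIcc_of_le (by linarith [Set.mem_Ici.mp ht])] at h1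
  refine (h1 t ⟨ht, by linarith⟩).mono_of_mem_nhdsWithin ?_
  rw [mem_nhdsWithin]
  exact ⟨Set.Iio (t + 1), isOpen_Iio, by simp, fun s hs => ⟨hs.2, le_of_lt hs.1⟩⟩

lemma HasPrimVec.continuousOn_functional {x g : ℝ → ι → ℝ} (h : HasPrimVec x g) (c : ι → ℝ) :
    ContinuousOn (fun t => c ⬝ᵥ x t) (Set.Ici 0) :=
  continuousOn_finsetSum _ fun i _ => continuousOn_const.mul (h i).continuousOn_Ici

lemma mem_nearL2_of_sq_le {f g : ℝ → ℝ} (hf : ContinuousOn f (Set.Ici 0))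
    (hg : IntegrableOn g (Set.Ioi 0)) (h : ∀ t, f t ^ 2 ≤ g t) : f ∈ nearL2 := by
  intro ε hε
  have hm : AEStronglyMeasurable f (volume.restrict (Set.Ioi 0)) :=
    (hf.mono Set.Ioi_subset_Ici_self).aestronglyMeasurable measurableSet_Ioi
  refine ⟨(Set.Ioi 0).indicator f, ?_, ?_⟩
  · rw [memLp_indicator_iff_restrict measurableSet_Ioi, memLp_two_iff_integrable_sq hm]
    refine Integrable.mono' hg (hm.pow 2) (Eventually.of_forall fun t => ?_)
    rw [Real.norm_eq_abs, abs_of_nonneg (sq_nonneg _)]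
    exact h t
  · filter_upwards [eventually_gt_atTop 0] with t ht
    rw [Set.indicator_of_mem (Set.mem_Ioi.mpr ht), sub_self, abs_zero]
    exact hε.le

end LowerBound

section LowerBoundMain

variable {ι : Type*} [Fintype ι] [DecidableEq ι] {m : ℕ}

lemma compl_pos_eq : ({z : ℂ | 0 < z.re}ᶜ : Set ℂ) = {z | z.re ≤ 0} := by
  ext z
  simp

/-- If no nonzero vector orthogonal to the invariant subspace `V` is antistable, then `V` contains
all antistable functionals. -/
lemma specPos_transpose_le {A : Matrix ι ι ℝ} {V : Submodule ℝ (ι → ℝ)}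
    (hV : ∀ c ∈ V, Aᵀ *ᵥ c ∈ V)
    (h : ∀ z ∈ orthComplement V, SpectrallyIn {z | 0 < z.re} A z → z = 0) : specPos Aᵀ ≤ V := by
  intro c hc
  rw [specPos, mem_spectralSubspace isVertical_pos] at hc
  obtain ⟨p, hp, hpc⟩ := hc
  set q := regionFactor {z : ℂ | 0 < z.re} A.charpoly with hq
  set r := regionFactor {z : ℂ | 0 < z.re}ᶜ A.charpoly with hr
  have hqr : q * r = A.charpoly := regionFactor_mul_compl isVertical_pos A.charpoly_monic
  refine orthComplement_orthComplement_le V fun z hz => ?_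
  obtain ⟨a, b, hab⟩ : IsCoprime p r :=
    hp.isCoprime (rootsIn_regionFactor _ _) disjoint_compl_right
  have hz0 : aeval A r *ᵥ z = 0 := by
    refine h _ (aeval_mulVec_mem (fun y hy => orthComplement_invariant hV hy) hz r) ?_
    refine ⟨q, rootsIn_regionFactor _ _, ?_⟩
    rw [← aeval_mul_mulVec, hqr, aeval_charpoly_mulVec]
  -- On `c` the polynomial `p` vanishes, so Bezout makes `r` act invertibly; moving `r` to the other
  -- factor annihilates `z`.
  have h1 : c = aeval Aᵀ r *ᵥ (aeval Aᵀ b *ᵥ c) := by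
    rw [aeval_mulVec_comm, ← aeval_mul_mulVec]
    have h2 : aeval Aᵀ (a * p + b * r) *ᵥ c = c := by rw [hab, map_one, one_mulVec]
    rw [map_add, add_mulVec, aeval_mul_mulVec _ a, hpc, mulVec_zero, zero_add] at h2
    exact h2.symm
  rw [h1, ← aeval_transpose A r, dotProduct_mulVec, vecMul_transpose, hz0, zero_dotProduct]

/-- With `r` the non-antistable factor, `r(Aᵀ) d` is an antistable functional for every `d`, so
`r(A) z` is orthogonal to everything. -/
lemma spectrallyIn_of_mem_orthComplement {A : Matrix ι ι ℝ} {V : Submodule ℝ (ι → ℝ)}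
    (hV : specPos Aᵀ ≤ V) {z : ι → ℝ} (hz : z ∈ orthComplement V) :
    SpectrallyIn {z | z.re ≤ 0} A z := by
  set q := regionFactor {z : ℂ | 0 < z.re} A.charpoly with hq
  set r := regionFactor {z : ℂ | 0 < z.re}ᶜ A.charpoly with hr
  have hqr : q * r = A.charpoly := regionFactor_mul_compl isVertical_pos A.charpoly_monic
  refine ⟨r, compl_pos_eq ▸ rootsIn_regionFactor _ _, dotProduct_eq _ _ fun d => ?_⟩
  rw [dotProduct_comm, zero_dotProduct, dotProduct_mulVec, ← mulVec_transpose, aeval_transpose]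
  refine hz _ (hV ?_)
  rw [specPos, mem_spectralSubspace isVertical_pos]
  refine ⟨q, rootsIn_regionFactor _ _, ?_⟩
  rw [← aeval_mul_mulVec, hqr, ← charpoly_transpose, aeval_charpoly_mulVec]

lemma riccati_add (A Q : Matrix ι ι ℝ) (B : Matrix ι (Fin m) ℝ) {K D : Matrix ι ι ℝ}
    (hK : K.IsSymm) :
    (closedLoop A B K)ᵀ * D + D * closedLoop A B K - D * B * Bᵀ * D + riccati A B Q K =
      riccati A B Q (K + D) := by
  simp only [closedLoop, riccati, transpose_sub, transpose_mul, transpose_transpose, hK.eq,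
    Matrix.mul_add, Matrix.add_mul, Matrix.mul_sub, Matrix.sub_mul, Matrix.mul_assoc]
  abel

/-- Along any trajectory with bounded costs and with prescribed functionals tending to `0`, the
costs eventually come close to the quadratic form of the semistable solution, provided no
antistable motion is unseen. -/
theorem IsCurve.frequently_le_cost {A Q : Matrix ι ι ℝ} {B : Matrix ι (Fin m) ℝ}
    {u : ℝ → Fin m → ℝ} {x : ℝ → ι → ℝ} (hx : IsCurve A B u x) (hu : IsL2Loc u) (hQ : Q.IsSymm)
    (hstab : HasStabilizer A B) {K K₀ : Matrix ι ι ℝ} (hK : K ∈ solARE A B Q)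
    (hKst : RootsIn {z | z.re ≤ 0} (closedLoop A B K).charpoly) (hK₀ : K₀ ∈ solARINeg A B Q)
    {Λ : Set (ι → ℝ)} (hΛ : ∀ c ∈ Λ, Tendsto (fun t => c ⬝ᵥ x t) atTop (𝓝 0))
    (hno : ∀ y, SpectrallyIn {z | 0 < z.re} A y →
      (∀ k : ℕ, K₀ *ᵥ ((A ^ k) *ᵥ y) = 0 ∧ Q *ᵥ ((A ^ k) *ᵥ y) = 0 ∧
        ∀ c ∈ Λ, c ⬝ᵥ (A ^ k) *ᵥ y = 0) → y = 0)
    {C : ℝ} (hC : ∀ᶠ T in atTop, ∫ t in (0 : ℝ)..T, (x t ⬝ᵥ Q *ᵥ x t + u t ⬝ᵥ u t) ≤ C)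
    {ε : ℝ} (hε : 0 < ε) :
    ∃ᶠ T in atTop, x 0 ⬝ᵥ K *ᵥ x 0 - ε <
      ∫ t in (0 : ℝ)..T, (x t ⬝ᵥ Q *ᵥ x t + u t ⬝ᵥ u t) := by
  obtain ⟨⟨hK₀s, hφ⟩, hneg⟩ := hK₀
  set w : ℝ → Fin m → ℝ := fun t => u t + Bᵀ *ᵥ (K₀ *ᵥ x t) with hw
  set A₀ := closedLoop A B K₀ with hA₀
  have hprim := hx.hasPrim_squares hu Q hK₀s
  have hφ0 : ∀ y, 0 ≤ y ⬝ᵥ riccati A B Q K₀ *ᵥ y := fun y => (posSemidef_iff_real.mp hφ).2 y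
  have hn0 : ∀ y, 0 ≤ y ⬝ᵥ (-K₀) *ᵥ y := fun y => (posSemidef_iff_real.mp hneg).2 y
  have hw0 : ∀ t, 0 ≤ w t ⬝ᵥ w t := fun t => dotProduct_self_nonneg' _
  have hsi : ∀ T, 0 ≤ T → IntervalIntegrable
      (fun t => w t ⬝ᵥ w t + x t ⬝ᵥ riccati A B Q K₀ *ᵥ x t) volume 0 T :=
    fun T hT => (hprim T hT).1
  have hφi : ∀ T, 0 ≤ T → IntervalIntegrable (fun t => x t ⬝ᵥ riccati A B Q K₀ *ᵥ x t) volume 0 T :=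
    fun T hT => (hx.continuousOn_dotProduct hT _).intervalIntegrable
  have hwi : ∀ T, 0 ≤ T → IntervalIntegrable (fun t => w t ⬝ᵥ w t) volume 0 T := fun T hT => by
    simpa using (hsi T hT).sub (hφi T hT)
  -- the bounds that follow from the boundedness of the costs
  have hid : ∀ T, 0 ≤ T → (∫ t in (0 : ℝ)..T, (w t ⬝ᵥ w t + x t ⬝ᵥ riccati A B Q K₀ *ᵥ x t)) +
      x T ⬝ᵥ (-K₀) *ᵥ x T =
      (∫ t in (0 : ℝ)..T, (x t ⬝ᵥ Q *ᵥ x t + u t ⬝ᵥ u t)) - x 0 ⬝ᵥ K₀ *ᵥ x 0 := by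
    intro T hT
    have h1 := (hprim T hT).2
    beta_reduce at h1
    rw [intervalIntegral.integral_same, zero_add] at h1
    rw [neg_mulVec, dotProduct_neg]
    linarith
  set C' := C - x 0 ⬝ᵥ K₀ *ᵥ x 0 with hC'
  have hsC : ∀ᶠ T in atTop,
      ∫ t in (0 : ℝ)..T, (w t ⬝ᵥ w t + x t ⬝ᵥ riccati A B Q K₀ *ᵥ x t) ≤ C' := by
    filter_upwards [hC, eventually_ge_atTop 0] with T h1 h2
    linarith [hid T h2, hn0 (x T)]
  have hnC : ∀ᶠ T in atTop, x T ⬝ᵥ (-K₀) *ᵥ x T ≤ C' := by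
    filter_upwards [hC, eventually_ge_atTop 0] with T h1 h2
    have := intervalIntegral.integral_nonneg (μ := volume) h2 fun t _ => add_nonneg (hw0 t) (hφ0 (x t))
    linarith [hid T h2]
  have hwI : IntegrableOn (fun t => w t ⬝ᵥ w t) (Set.Ioi 0) :=
    integrableOn_Ioi_of_le hwi hsi hw0 (fun t => le_add_of_nonneg_right (hφ0 _)) hsC
  have hφI : IntegrableOn (fun t => x t ⬝ᵥ riccati A B Q K₀ *ᵥ x t) (Set.Ioi 0) :=
    integrableOn_Ioi_of_le hφi hsi (fun t => hφ0 _) (fun t => le_add_of_nonneg_left (hw0 _)) hsC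
  -- Absorbing the feedback of `K₀` into the drift leaves a square integrable input, which
  -- `tendsto_shift` requires.
  have hx₀ : IsCurve A₀ B w x := by
    have h1 : ∀ t, A₀ *ᵥ x t + B *ᵥ w t = A *ᵥ x t + B *ᵥ u t := fun t => by
      rw [hA₀, closedLoop_mulVec, hw, mulVec_add]
      abel
    simpa only [IsCurve, h1] using hx
  have hV := hx₀.tendsto_shift hwI
  -- the classes of functionals
  set H := functionalsIn boundedModL2 x with hH
  set G := functionalsIn nearL2 x with hG
  have hGH : G ≤ H := fun c hc => nearL2_le_boundedModL2 hc
  have hHinv : ∀ c ∈ H, A₀ᵀ *ᵥ c ∈ H := fun c hc =>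
    transpose_mulVec_mem_functionalsIn isShiftClass_boundedModL2 hV hc
  have hGinv : ∀ c ∈ G, A₀ᵀ *ᵥ c ∈ G := fun c hc =>
    transpose_mulVec_mem_functionalsIn isShiftClass_nearL2 hV hc
  have hΛG : ∀ c ∈ Λ, c ∈ G := fun c hc => mem_nearL2_of_tendsto (hΛ c hc)
  have hφG : ∀ c, riccati A B Q K₀ *ᵥ c ∈ G := mulVec_mem_of_posSemidef hφ fun r hr =>
    mem_nearL2_of_sq_le (HasPrimVec.continuousOn_functional hx r) hφI fun t => hr (x t)
  have hnH : ∀ c, (-K₀) *ᵥ c ∈ H := mulVec_mem_of_posSemidef hneg fun r hr => by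
    refine ⟨C' + 1, 0, MemLp.zero', ?_⟩
    filter_upwards [hnC] with t ht
    rw [Pi.zero_apply, sub_zero]
    change |r ⬝ᵥ x t| ≤ _
    nlinarith [hr (x t), sq_abs (r ⬝ᵥ x t), sq_nonneg (|r ⬝ᵥ x t| - 1)]
  have hφs := riccati_isSymm (A := A) (B := B) hQ hK₀s
  -- A direction invisible to all bounded functionals lies in the kernels of `K₀` and φ(K₀). There
  -- `A₀` coincides with `A`, and `Q` vanishes as well.
  have hM : ∀ z ∈ orthComplement H, K₀ *ᵥ z = 0 ∧ riccati A B Q K₀ *ᵥ z = 0 := fun z hz => by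
    have h1 := mulVec_eq_zero_of_mem_orthComplement (S := -K₀) (by rw [IsSymm, transpose_neg, hK₀s.eq])
      hnH hz
    rw [neg_mulVec, neg_eq_zero] at h1
    exact ⟨h1, mulVec_eq_zero_of_mem_orthComplement hφs (fun c => hGH (hφG c)) hz⟩
  have hMinv : ∀ z ∈ orthComplement H, A₀ *ᵥ z ∈ orthComplement H := fun z hz =>
    orthComplement_invariant hHinv hz
  have hAA₀ : ∀ z ∈ orthComplement H, A *ᵥ z = A₀ *ᵥ z := fun z hz => by
    rw [hA₀, closedLoop_mulVec, (hM z hz).1, mulVec_zero, mulVec_zero, sub_zero]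
  have hQM : ∀ z ∈ orthComplement H, Q *ᵥ z = 0 := fun z hz => by
    have h1 := (hM z hz).2
    simp only [riccati, add_mulVec, sub_mulVec, ← mulVec_mulVec, (hM z hz).1, mulVec_zero,
      sub_zero, zero_add, hAA₀ z hz, (hM _ (hMinv z hz)).1] at h1
    exact h1
  -- The only use of `hno`: an antistable motion orthogonal to `H` would be undetected.
  have hHpos : specPos A₀ᵀ ≤ H := by
    refine specPos_transpose_le hHinv fun z hz hzp => ?_
    refine hno z ((SpectrallyIn.congr hMinv hAA₀ hz).mpr hzp) fun k => ?_
    obtain ⟨h1, h2⟩ := pow_mulVec_congr hMinv hAA₀ hz k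
    rw [h1]
    exact ⟨(hM _ h2).1, hQM _ h2, fun c hc => h2 c (hGH (hΛG c hc))⟩
  have hGpos : specPos A₀ᵀ ≤ G := mem_functionalsIn_nearL2 hV hHpos
  -- the gap between `K` and `K₀`
  obtain ⟨Kp, Y, hKp, hKpmax, -⟩ := exists_maximal_solution hQ hstab ⟨K₀, hK₀s, hφ⟩
  have hKK : Kp = K := eq_of_semistable hstab hK hKst hKp (hKpmax K (solARE_subset_solARI hK))
  have hD : (K - K₀).PosSemidef := hKK ▸ hKpmax K₀ ⟨hK₀s, hφ⟩
  have hric : A₀ᵀ * (K - K₀) + (K - K₀) * A₀ - (K - K₀) * B * Bᵀ * (K - K₀) +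
      riccati A B Q K₀ = 0 := by
    rw [hA₀, riccati_add A Q B hK₀s, add_sub_cancel, hK.2]
  -- Directions orthogonal to `G` carry no antistable part and are unobservable through φ(K₀), the
  -- weight in the Riccati equation of the gap.
  have hDY : ∀ z ∈ orthComplement G, (K - K₀) *ᵥ z = 0 := fun z hz =>
    mulVec_eq_zero_of_riccati (hstab.hautus.closedLoop K₀) hD hric
      (spectrallyIn_of_mem_orthComplement hGpos hz) fun k =>
        mulVec_eq_zero_of_mem_orthComplement hφs hφG
          (pow_mulVec_congr (fun y hy => orthComplement_invariant hGinv hy) (fun _ _ => rfl) hz k).2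
  obtain ⟨R, hR⟩ := exists_factor_of_posSemidef hD
  have hRG : ∀ i, R i ∈ G := by
    refine fun i => orthComplement_orthComplement_le G fun z hz => ?_
    have h1 := hDY z hz
    have h2 : (R *ᵥ z) ⬝ᵥ (R *ᵥ z) = 0 := by
      rw [← quadForm_transpose_mul_self, ← hR, h1, dotProduct_zero]
    rw [dotProduct_comm]
    exact congrFun (dotProduct_self_eq_zero.mp h2) i
  -- small values of the gap
  set N : ℝ := Nat.cast (Fintype.card ι) with hN
  -- With `∑ f i ^ 2 < ε / 4`, the sum of `2 f i ^ 2 + 2 δ` stays below `ε / 2 + ε / 2`.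
  set δ : ℝ := ε / (4 * (N + 1)) with hδ
  have hN0 : 0 ≤ N := Nat.cast_nonneg _
  have hδ0 : 0 < δ := by positivity
  choose f hf hfδ using fun i => hRG i (Real.sqrt δ) (Real.sqrt_pos.mpr hδ0)
  have hint : Integrable (fun t => ∑ i, f i t ^ 2) :=
    integrable_finsetSum _ fun i _ => (hf i).integrable_sq
  -- An integrable function need not tend to 0, but it is small at arbitrarily late times; hence a
  -- frequent rather than an eventual bound.
  have hfreq := (frequently_lt_of_integrable hint (show 0 < ε / 4 by positivity)).and_eventually
    ((eventually_all.mpr hfδ).and (eventually_ge_atTop 0))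
  refine hfreq.mono fun T hT => ?_
  obtain ⟨h1, h2, h3⟩ := hT
  have h4 : x T ⬝ᵥ (K - K₀) *ᵥ x T < ε := by
    rw [hR, quadForm_transpose_mul_self]
    have h5 : ∀ i, (R *ᵥ x T) i * (R *ᵥ x T) i ≤ 2 * f i T ^ 2 + 2 * δ := fun i => by
      have h6 : |R i ⬝ᵥ x T - f i T| ≤ √δ := h2 i
      have h7 := Real.sq_sqrt hδ0.le
      have h8 : (R i ⬝ᵥ x T - f i T) ^ 2 ≤ δ := by
        rw [← h7, ← sq_abs]
        gcongr
      change (R i ⬝ᵥ x T) * (R i ⬝ᵥ x T) ≤ _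
      nlinarith [sq_nonneg (R i ⬝ᵥ x T - 2 * f i T)]
    have h9 : (R *ᵥ x T) ⬝ᵥ (R *ᵥ x T) ≤ ∑ i, (2 * f i T ^ 2 + 2 * δ) :=
      Finset.sum_le_sum fun i _ => h5 i
    rw [Finset.sum_add_distrib, ← Finset.mul_sum, Finset.sum_const, Finset.card_univ,
      nsmul_eq_mul] at h9
    have h10 : N * (2 * δ) ≤ ε / 2 := by
      rw [hδ]
      have : N * (2 * (ε / (4 * (N + 1)))) = ε / 2 * (N / (N + 1)) := by field_simp; ring
      rw [this]
      have : N / (N + 1) ≤ 1 := by rw [div_le_one (by positivity)]; linarith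
      nlinarith
    linarith
  have hKprim := (hx.hasPrim_squares hu Q hK.1 T h3).2
  beta_reduce at hKprim
  rw [intervalIntegral.integral_same, zero_add, hK.2] at hKprim
  -- The integral of the square in the completion with `K` may be dropped. In the end term, `K = (K
  -- - K₀) + K₀` with the first part below `ε` and the second nonpositive.
  have h11 : 0 ≤ ∫ t in (0 : ℝ)..T, ((u t + Bᵀ *ᵥ (K *ᵥ x t)) ⬝ᵥ (u t + Bᵀ *ᵥ (K *ᵥ x t)) +
      x t ⬝ᵥ (0 : Matrix ι ι ℝ) *ᵥ x t) := by
    refine intervalIntegral.integral_nonneg h3 fun t _ => ?_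
    rw [zero_mulVec, dotProduct_zero, add_zero]
    exact dotProduct_self_nonneg' _
  have h12 := hn0 (x T)
  rw [neg_mulVec, dotProduct_neg] at h12
  rw [sub_mulVec, dotProduct_sub] at h4
  linarith

end LowerBoundMain

/-! ### The value function of a reducible problem -/

section Distance

variable {n : ℕ} {L : Submodule ℝ (Fin n → ℝ)}

lemma abs_dotProduct_le_euclideanDist {d : Fin n → ℝ} (hd : ∀ y ∈ L, d ⬝ᵥ y = 0) (x : Fin n → ℝ) :
    |d ⬝ᵥ x| ≤ (‖(WithLp.toLp 2 d : EuclideanSpace ℝ (Fin n))‖ + 1) * euclideanDist L x := by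
  -- The added 1 allows division also when `d = 0`.
  have hpos : 0 < ‖(WithLp.toLp 2 d : EuclideanSpace ℝ (Fin n))‖ + 1 := by positivity
  rw [← div_le_iff₀' hpos, euclideanDist,
    Metric.le_infDist ⟨WithLp.toLp 2 0, Set.mem_image_of_mem _ L.zero_mem⟩]
  rintro _ ⟨y, hy, rfl⟩
  rw [div_le_iff₀' hpos, dist_eq_norm]
  have h1 : d ⬝ᵥ x = inner ℝ (WithLp.toLp 2 d : EuclideanSpace ℝ (Fin n))
      (WithLp.toLp 2 x - WithLp.toLp 2 y) := by
    rw [← WithLp.toLp_sub, EuclideanSpace.inner_toLp_toLp, star_trivial, dotProduct_comm,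
      sub_dotProduct, dotProduct_comm y, hd y hy, sub_zero]
  rw [h1]
  refine (abs_real_inner_le_norm _ _).trans ?_
  gcongr
  linarith

lemma tendsto_of_euclideanDist {d : Fin n → ℝ} (hd : ∀ y ∈ L, d ⬝ᵥ y = 0) {x : ℝ → Fin n → ℝ}
    (hx : Tendsto (fun t => euclideanDist L (x t)) atTop (𝓝 0)) :
    Tendsto (fun t => d ⬝ᵥ x t) atTop (𝓝 0) := by
  refine squeeze_zero_norm (fun t => ?_) (by
    simpa using hx.const_mul (‖(WithLp.toLp 2 d : EuclideanSpace ℝ (Fin n))‖ + 1))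
  exact abs_dotProduct_le_euclideanDist hd (x t)

lemma tendsto_euclideanDist {x y : ℝ → Fin n → ℝ} (hy : Tendsto y atTop (𝓝 0))
    (hxy : ∀ t, x t - y t ∈ L) : Tendsto (fun t => euclideanDist L (x t)) atTop (𝓝 0) := by
  have h1 : Tendsto (fun t => ‖(WithLp.toLp 2 (y t) : EuclideanSpace ℝ (Fin n))‖) atTop (𝓝 0) := by
    have h2 := ((PiLp.continuous_toLp 2 (fun _ : Fin n => ℝ)).tendsto 0).comp hy
    simpa using! h2.norm
  refine squeeze_zero (fun t => Metric.infDist_nonneg) (fun t => ?_) h1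
  refine (Metric.infDist_le_dist_of_mem (Set.mem_image_of_mem _ (hxy t))).trans (le_of_eq ?_)
  rw [dist_eq_norm, ← WithLp.toLp_sub, sub_sub_cancel]

end Distance

/-! ### Upper and lower bounds for the value function of the quotient problem. -/

section Value

variable {n m : ℕ} {κ : Type*} [Fintype κ] [DecidableEq κ]

lemma quadForm_congruence (E : Matrix κ (Fin n) ℝ) (S : Matrix κ κ ℝ) (x : Fin n → ℝ) :
    x ⬝ᵥ (Eᵀ * S * E) *ᵥ x = (E *ᵥ x) ⬝ᵥ S *ᵥ (E *ᵥ x) := by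
  rw [Matrix.mul_assoc, ← mulVec_mulVec, ← mulVec_mulVec, dotProduct_mulVec, vecMul_transpose]

/-- A stabilizing solution of the perturbed Riccati equation of the reduced problem provides a
permissible control. -/
lemma exists_permissibleCost {A : Matrix (Fin n) (Fin n) ℝ} {B : Matrix (Fin n) (Fin m) ℝ}
    {L : Submodule ℝ (Fin n → ℝ)} {E : Matrix κ (Fin n) ℝ} {G : Matrix (Fin n) κ ℝ}
    (hEG : E * G = 1) {A' : Matrix κ κ ℝ} (hA : E * A = A' * E) {Q' : Matrix κ κ ℝ}
    (hQ' : Q'.IsSymm) (hker : ∀ x, E *ᵥ x = 0 → x ∈ L) {ε : ℝ} (hε : 0 ≤ ε) {Y : Matrix κ κ ℝ}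
    (hY : Y ∈ solARE A' (E * B) (Q' + ε • 1))
    (hYst : RootsIn {z | z.re < 0} (closedLoop A' (E * B) Y).charpoly) (x₀ : Fin n → ℝ) :
    ∃ c : ℝ, (c : EReal) ∈ permissibleCosts A B (Eᵀ * Q' * E) L x₀ ∧
      c ≤ x₀ ⬝ᵥ (Eᵀ * Y * E) *ᵥ x₀ := by
  set F : Matrix (Fin m) κ ℝ := -((E * B)ᵀ * Y) with hF
  have hcl : closedLoop A' (E * B) Y = A' + E * B * F := closedLoop_eq_add _ _ _
  rw [hcl] at hYst
  obtain ⟨S, hS, hSl⟩ := exists_feedbackCost hQ' hYst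
  have hYε : riccati A' (E * B) Q' Y = -(ε • 1) := by
    have h1 := hY.2
    rw [riccati_add_smul_one] at h1
    exact eq_neg_of_add_eq_zero_left h1
  -- `Y` accounts for the perturbed weight, whereas `S` is the true cost of the same feedback; the
  -- excess weight `ε` makes `S ≤ Y`.
  have hle : (Y - S).PosSemidef := by
    refine posSemidef_of_lyapunov hYst (hY.1.sub hS.1) fun y => ?_
    have h1 := lyapunov_feedback_sub hY.1 hSl
    rw [hYε, neg_neg, hF, neg_add_cancel, Matrix.mul_zero, sub_zero] at h1
    rw [hF, ← neg_sub S Y, Matrix.mul_neg, Matrix.neg_mul, ← neg_add, h1, neg_mulVec,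
      dotProduct_neg, smul_mulVec, one_mulVec, dotProduct_smul, smul_eq_mul]
    exact neg_nonpos.mpr (mul_nonneg hε (dotProduct_self_nonneg' y))
  set M := A + B * (F * E) with hM
  have hEM : E * M = (A' + E * B * F) * E := by
    rw [hM, Matrix.mul_add, hA, Matrix.add_mul]
    simp only [Matrix.mul_assoc]
  set x : ℝ → Fin n → ℝ := fun t => flow M t *ᵥ x₀ with hx
  set u : ℝ → Fin m → ℝ := fun t => F *ᵥ (E *ᵥ x t) with hu
  have hxc : Continuous x := continuous_flow_mulVec M x₀
  have huc : Continuous u := continuous_const.matrix_mulVec (continuous_const.matrix_mulVec hxc)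
  have hx0 : x 0 = x₀ := by rw [hx]; simp only [flow_zero, one_mulVec]
  have hder : ∀ t, HasDerivAt x (A *ᵥ x t + B *ᵥ u t) t := fun t => by
    have h1 := hasDerivAt_flow_mulVec M x₀ t
    rwa [hM, add_mulVec, ← mulVec_mulVec, ← mulVec_mulVec, ← hM] at h1
  have hEx : ∀ t, E *ᵥ x t = flow (A' + E * B * F) t *ᵥ (E *ᵥ x₀) := fun t => by
    rw [hx]
    simp only [mulVec_mulVec, flow_intertwine hEM.symm t]
  have hEx0 : Tendsto (fun t => E *ᵥ x t) atTop (𝓝 0) := by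
    simp only [hEx]
    exact tendsto_flow hYst _
  refine ⟨(E *ᵥ x₀) ⬝ᵥ S *ᵥ (E *ᵥ x₀), ⟨u, x, ⟨huc.measurable, fun T _ =>
    (huc.dotProduct huc).continuousOn.integrableOn_Icc⟩, ⟨hxc.continuousOn, fun t _ => ?_⟩, ?_,
    ?_⟩, ?_⟩
  · rw [intervalIntegral.integral_eq_sub_of_hasDerivAt (fun s _ => hder s), hx0]
    · abel
    · exact ((continuous_const.matrix_mulVec hxc).add
        (continuous_const.matrix_mulVec huc)).intervalIntegrable _ _
  · have hderS : ∀ t, HasDerivAt (fun s => -((E *ᵥ x s) ⬝ᵥ S *ᵥ (E *ᵥ x s)))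
        (x t ⬝ᵥ (Eᵀ * Q' * E) *ᵥ x t + u t ⬝ᵥ u t) t := by
      intro t
      have h1 := (hasDerivAt_quadForm S
        (hasDerivAt_flow_mulVec (A' + E * B * F) (E *ᵥ x₀) t)).neg
      simp only [← hEx] at h1
      have h2 : (E *ᵥ x t) ⬝ᵥ ((A' + E * B * F)ᵀ * S + S * (A' + E * B * F)) *ᵥ (E *ᵥ x t) =
          -((E *ᵥ x t) ⬝ᵥ Q' *ᵥ (E *ᵥ x t) + u t ⬝ᵥ u t) := by
        rw [hSl, neg_mulVec, dotProduct_neg, add_mulVec, dotProduct_add,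
          quadForm_transpose_mul_self]
      rw [add_mulVec, dotProduct_add, ← mulVec_mulVec, ← mulVec_mulVec,
        dotProduct_mulVec _ (A' + E * B * F)ᵀ, vecMul_transpose] at h2
      rw [quadForm_congruence]
      convert! h1 using 1
      linarith
    have hJ : ∀ T, costUpTo (Eᵀ * Q' * E) x u T =
        (E *ᵥ x₀) ⬝ᵥ S *ᵥ (E *ᵥ x₀) - (E *ᵥ x T) ⬝ᵥ S *ᵥ (E *ᵥ x T) := by
      intro T
      rw [costUpTo, intervalIntegral.integral_eq_sub_of_hasDerivAt (fun s _ => hderS s), hx0]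
      · ring
      · exact ((hxc.dotProduct (continuous_const.matrix_mulVec hxc)).add
          (huc.dotProduct huc)).intervalIntegrable _ _
    simp only [hJ]
    refine (continuous_coe_real_ereal.tendsto _).comp ?_
    simpa using (tendsto_quadForm S hEx0).const_sub ((E *ᵥ x₀) ⬝ᵥ S *ᵥ (E *ᵥ x₀))
  · refine tendsto_euclideanDist (y := fun t => G *ᵥ (E *ᵥ x t)) ?_ fun t => hker _ ?_
    · have h1 := ((continuous_const (y := G)).matrix_mulVec continuous_id).tendsto (0 : κ → ℝ)
      simp only [id, mulVec_zero] at h1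
      exact h1.comp hEx0
    · rw [mulVec_sub, mulVec_mulVec _ E G, hEG, one_mulVec, sub_self]
  · rw [quadForm_congruence]
    have := (posSemidef_iff_real.mp hle).2 (E *ᵥ x₀)
    rw [sub_mulVec, dotProduct_sub] at this
    linarith

/-- The value function of a problem that descends to a quotient of the state space by a subspace of
the target, on which no antistable motion is unseen. -/
theorem valueFunction_eq_of_reduction {A : Matrix (Fin n) (Fin n) ℝ} {B : Matrix (Fin n) (Fin m) ℝ}
    {L : Submodule ℝ (Fin n → ℝ)} {E : Matrix κ (Fin n) ℝ} {G : Matrix (Fin n) κ ℝ}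
    (hEG : E * G = 1) {A' : Matrix κ κ ℝ} (hA : E * A = A' * E) {Q' : Matrix κ κ ℝ}
    (hQ' : Q'.IsSymm) (hker : ∀ x, E *ᵥ x = 0 → x ∈ L) (hstab : HasStabilizer A' (E * B))
    {K K₀ : Matrix κ κ ℝ} (hK : K ∈ solARE A' (E * B) Q')
    (hKst : RootsIn {z | z.re ≤ 0} (closedLoop A' (E * B) K).charpoly)
    (hK₀ : K₀ ∈ solARINeg A' (E * B) Q')
    (hno : ∀ y, SpectrallyIn {z | 0 < z.re} A' y →
      (∀ k : ℕ, K₀ *ᵥ ((A' ^ k) *ᵥ y) = 0 ∧ Q' *ᵥ ((A' ^ k) *ᵥ y) = 0 ∧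
        G *ᵥ ((A' ^ k) *ᵥ y) ∈ L) → y = 0) (x₀ : Fin n → ℝ) :
    valueFunction A B (Eᵀ * Q' * E) L x₀ = ((x₀ ⬝ᵥ (Eᵀ * K * E) *ᵥ x₀ : ℝ) : EReal) := by
  refine le_antisymm ?_ (le_sInf ?_)
  · obtain ⟨Kp, Y, hKp, hKpmax, -, hY, hYst, -, hYlim⟩ := exists_maximal_solution hQ' hstab
      ⟨K₀, hK₀.1⟩
    have hKK : Kp = K := eq_of_semistable hstab hK hKst hKp (hKpmax K (solARE_subset_solARI hK))
    have h1 : ∀ k, valueFunction A B (Eᵀ * Q' * E) L x₀ ≤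
        ((x₀ ⬝ᵥ (Eᵀ * Y k * E) *ᵥ x₀ : ℝ) : EReal) := fun k => by
      obtain ⟨c, hc, hcle⟩ := exists_permissibleCost (L := L) hEG hA hQ' hker (by positivity)
        (hY k) (hYst k) x₀
      exact (sInf_le hc).trans (EReal.coe_le_coe_iff.mpr hcle)
    have h2 : Continuous fun S : Matrix κ κ ℝ => x₀ ⬝ᵥ (Eᵀ * S * E) *ᵥ x₀ := by fun_prop
    exact ge_of_tendsto' ((continuous_coe_real_ereal.tendsto _).comp
      ((h2.tendsto K).comp (hKK ▸ hYlim))) h1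
  · rintro c ⟨u, x, hu, hx, hJ, hdist⟩
    by_contra! hlt
    -- A real number strictly between treats finite costs and cost `-∞` together, and bounds the
    -- finite-horizon costs from above.
    obtain ⟨r, hcr, hr⟩ := EReal.lt_iff_exists_real_btwn.mp hlt
    rw [EReal.coe_lt_coe_iff] at hr
    obtain ⟨hcurve, hx0⟩ := hx.isCurve hu
    have hcost : ∀ T, costUpTo (Eᵀ * Q' * E) x u T =
        ∫ t in (0 : ℝ)..T, ((E *ᵥ x t) ⬝ᵥ Q' *ᵥ (E *ᵥ x t) + u t ⬝ᵥ u t) := fun T => by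
      simp only [costUpTo, quadForm_congruence]
    have hbd : ∀ᶠ T in atTop, costUpTo (Eᵀ * Q' * E) x u T < r := by
      filter_upwards [hJ.eventually (gt_mem_nhds hcr)] with T hT
      exact EReal.coe_lt_coe_iff.mp hT
    -- Since the kernel of `E` lies in `L`, a functional orthogonal to the target of the quotient
    -- pulls back to one orthogonal to `L`, which then tends to 0 along `x`.
    have hLE : ∀ y ∈ L, G *ᵥ (E *ᵥ y) ∈ L := fun y hy => by
      have h1 : y - G *ᵥ (E *ᵥ y) ∈ L := hker _ (by
        rw [mulVec_sub, mulVec_mulVec _ E G, hEG, one_mulVec, sub_self])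
      simpa using L.sub_mem hy h1
    have hlow := (hcurve.map hA).frequently_le_cost hu hQ' hstab hK hKst hK₀
      (Λ := (orthComplement (L.comap G.mulVecLin) : Set (κ → ℝ))) (fun c hc => ?_)
      (fun y hy hy0 => hno y hy fun k => ⟨(hy0 k).1, (hy0 k).2.1,
        orthComplement_orthComplement_le (L.comap G.mulVecLin) (hy0 k).2.2⟩)
      (C := r) (hbd.mono fun T hT => (hcost T ▸ hT).le) (sub_pos.mpr hr)
    · obtain ⟨T, h1, h2⟩ := (hlow.and_eventually hbd).exists
      rw [hcost] at h2
      rw [hx0, ← quadForm_congruence] at h1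
      linarith
    · have h1 : ∀ t, c ⬝ᵥ (E *ᵥ x t) = (Eᵀ *ᵥ c) ⬝ᵥ x t := fun t => by
        rw [dotProduct_mulVec, mulVec_transpose]
      simp only [h1]
      refine tendsto_of_euclideanDist (fun y hy => ?_) hdist
      rw [mulVec_transpose, ← dotProduct_mulVec, dotProduct_comm]
      exact hc _ (hLE y hy)

end Value

/-! ### Block triangular systems -/

section Blocks

variable {m : ℕ} {ι₁ ι₂ : Type*} [Fintype ι₁] [DecidableEq ι₁] [Fintype ι₂] [DecidableEq ι₂]

lemma eq_fromBlocks_of_isSymm {S : Matrix (ι₁ ⊕ ι₂) (ι₁ ⊕ ι₂) ℝ} (hS : S.IsSymm) :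
    S = fromBlocks S.toBlocks₁₁ S.toBlocks₁₂ S.toBlocks₁₂ᵀ S.toBlocks₂₂ ∧
      S.toBlocks₁₁.IsSymm ∧ S.toBlocks₂₂.IsSymm := by
  refine ⟨?_, ?_, ?_⟩
  · conv_lhs => rw [← fromBlocks_toBlocks S]
    congr 1
    ext i j
    exact hS.apply (Sum.inl j) (Sum.inr i)
  · ext i j
    exact hS.apply (Sum.inl i) (Sum.inl j)
  · ext i j
    exact hS.apply (Sum.inr i) (Sum.inr j)

lemma fromBlocks_sub' (A A' : Matrix ι₁ ι₁ ℝ) (B B' : Matrix ι₁ ι₂ ℝ) (C C' : Matrix ι₂ ι₁ ℝ)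
    (D D' : Matrix ι₂ ι₂ ℝ) : fromBlocks A B C D - fromBlocks A' B' C' D' =
      fromBlocks (A - A') (B - B') (C - C') (D - D') := by
  rw [sub_eq_add_neg, fromBlocks_neg, fromBlocks_add]
  simp only [sub_eq_add_neg]

/-- The equation is triangular: Riccati in `K₁`, then Sylvester in `K₁₂`, then Lyapunov in `K₂`. -/
lemma riccati_fromBlocks (A₁ : Matrix ι₁ ι₁ ℝ) (A₁₂ : Matrix ι₁ ι₂ ℝ) (A₂ : Matrix ι₂ ι₂ ℝ)
    (B₁ : Matrix ι₁ (Fin m) ℝ) (Q₁ : Matrix ι₁ ι₁ ℝ) (Q₁₂ : Matrix ι₁ ι₂ ℝ) (Q₂ : Matrix ι₂ ι₂ ℝ)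
    {K₁ : Matrix ι₁ ι₁ ℝ} (hK₁ : K₁.IsSymm) (K₁₂ : Matrix ι₁ ι₂ ℝ) (K₂ : Matrix ι₂ ι₂ ℝ) :
    riccati (fromBlocks A₁ A₁₂ 0 A₂) (fromRows B₁ 0) (fromBlocks Q₁ Q₁₂ Q₁₂ᵀ Q₂)
      (fromBlocks K₁ K₁₂ K₁₂ᵀ K₂) =
    fromBlocks (riccati A₁ B₁ Q₁ K₁)
      ((closedLoop A₁ B₁ K₁)ᵀ * K₁₂ + K₁₂ * A₂ + (Q₁₂ + K₁ * A₁₂))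
      ((closedLoop A₁ B₁ K₁)ᵀ * K₁₂ + K₁₂ * A₂ + (Q₁₂ + K₁ * A₁₂))ᵀ
      (A₂ᵀ * K₂ + K₂ * A₂ - (K₁₂ᵀ * B₁ * B₁ᵀ * K₁₂ - K₁₂ᵀ * A₁₂ - A₁₂ᵀ * K₁₂ - Q₂)) := by
  have hB : fromRows B₁ (0 : Matrix ι₂ (Fin m) ℝ) * (fromRows B₁ (0 : Matrix ι₂ (Fin m) ℝ))ᵀ =
      fromBlocks (B₁ * B₁ᵀ) 0 0 0 := by
    rw [transpose_fromRows, fromRows_mul_fromCols]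
    simp
  rw [riccati, Matrix.mul_assoc _ (fromRows B₁ 0), hB]
  simp only [fromBlocks_transpose, fromBlocks_multiply, fromBlocks_add, fromBlocks_sub', riccati,
    closedLoop, transpose_zero, transpose_transpose, Matrix.mul_zero, Matrix.zero_mul, add_zero,
    transpose_add, transpose_sub, transpose_mul, hK₁.eq]
  congr 1 <;> simp only [Matrix.mul_assoc, Matrix.sub_mul, Matrix.mul_sub] <;> abel

lemma closedLoop_fromBlocks (A₁ : Matrix ι₁ ι₁ ℝ) (A₁₂ : Matrix ι₁ ι₂ ℝ) (A₂ : Matrix ι₂ ι₂ ℝ)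
    (B₁ : Matrix ι₁ (Fin m) ℝ) (K₁ : Matrix ι₁ ι₁ ℝ) (K₁₂ : Matrix ι₁ ι₂ ℝ)
    (K₂₁ : Matrix ι₂ ι₁ ℝ) (K₂ : Matrix ι₂ ι₂ ℝ) :
    closedLoop (fromBlocks A₁ A₁₂ 0 A₂) (fromRows B₁ 0) (fromBlocks K₁ K₁₂ K₂₁ K₂) =
      fromBlocks (closedLoop A₁ B₁ K₁) (A₁₂ - B₁ * B₁ᵀ * K₁₂) 0 A₂ := by
  have hB : fromRows B₁ (0 : Matrix ι₂ (Fin m) ℝ) * (fromRows B₁ (0 : Matrix ι₂ (Fin m) ℝ))ᵀ =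
      fromBlocks (B₁ * B₁ᵀ) 0 0 0 := by
    rw [transpose_fromRows, fromRows_mul_fromCols]
    simp
  rw [closedLoop, hB]
  simp [fromBlocks_multiply, fromBlocks_sub', closedLoop]

lemma posSemidef_toBlocks₁₁ {S : Matrix (ι₁ ⊕ ι₂) (ι₁ ⊕ ι₂) ℝ} (hS : S.PosSemidef) :
    S.toBlocks₁₁.PosSemidef := hS.submatrix Sum.inl

lemma mulVec_eq_zero_of_posSemidef {ι : Type*} [Fintype ι] [DecidableEq ι] {S : Matrix ι ι ℝ}
    (hS : S.PosSemidef) {x : ι → ℝ} (h : x ⬝ᵥ S *ᵥ x = 0) : S *ᵥ x = 0 :=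
  (hS.dotProduct_mulVec_zero_iff x).mp (by simpa using h)

lemma elim_dotProduct_elim (x y : ι₁ → ℝ) (x' y' : ι₂ → ℝ) :
    Sum.elim x x' ⬝ᵥ Sum.elim y y' = x ⬝ᵥ y + x' ⬝ᵥ y' := by
  simp [dotProduct]

lemma elim_quadForm (S : Matrix (ι₁ ⊕ ι₂) (ι₁ ⊕ ι₂) ℝ) (x : ι₁ → ℝ) :
    Sum.elim x (0 : ι₂ → ℝ) ⬝ᵥ S *ᵥ Sum.elim x 0 = x ⬝ᵥ S.toBlocks₁₁ *ᵥ x := by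
  conv_lhs => rw [← fromBlocks_toBlocks S, fromBlocks_mulVec]
  rw [elim_dotProduct_elim]
  simp [Function.comp_def, ← Pi.zero_def]

end Blocks

/-! ### The subspace of undetected antistable motions -/

section Undetected

variable {m : ℕ} {ι₁ : Type} [Fintype ι₁] [DecidableEq ι₁] {A₁ Q₁ Km : Matrix ι₁ ι₁ ℝ}
  {B₁ : Matrix ι₁ (Fin m) ℝ} {L₁ : Submodule ℝ (ι₁ → ℝ)} {x : ι₁ → ℝ}

lemma mem_undetectedSubspace : x ∈ undetectedSubspace A₁ B₁ L₁ Km ↔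
    (∀ k : ℕ, (closedLoop A₁ B₁ Km ^ k) *ᵥ x ∈ L₁ ∧ Km *ᵥ ((closedLoop A₁ B₁ Km ^ k) *ᵥ x) = 0) ∧
      SpectrallyIn {z | 0 < z.re} (closedLoop A₁ B₁ Km) x := by
  rw [undetectedSubspace, Submodule.mem_inf, mem_invariantCore, specPos,
    mem_spectralSubspace isVertical_pos]
  rfl

lemma undetectedSubspace_spectrallyIn (hx : x ∈ undetectedSubspace A₁ B₁ L₁ Km) :
    SpectrallyIn {z | 0 < z.re} (closedLoop A₁ B₁ Km) x := (mem_undetectedSubspace.mp hx).2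

lemma undetectedSubspace_mulVec_eq_zero (hx : x ∈ undetectedSubspace A₁ B₁ L₁ Km) :
    Km *ᵥ x = 0 := by
  simpa using ((mem_undetectedSubspace.mp hx).1 0).2

lemma undetectedSubspace_le : undetectedSubspace A₁ B₁ L₁ Km ≤ L₁ := fun x hx => by
  simpa using ((mem_undetectedSubspace.mp hx).1 0).1

lemma closedLoop_mulVec_of_eq_zero (h : Km *ᵥ x = 0) : closedLoop A₁ B₁ Km *ᵥ x = A₁ *ᵥ x := by
  rw [closedLoop_mulVec, h, mulVec_zero, mulVec_zero, sub_zero]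

lemma closedLoop_mem_undetectedSubspace (hx : x ∈ undetectedSubspace A₁ B₁ L₁ Km) :
    closedLoop A₁ B₁ Km *ᵥ x ∈ undetectedSubspace A₁ B₁ L₁ Km := by
  rw [mem_undetectedSubspace] at hx ⊢
  refine ⟨fun k => ?_, hx.2.mulVec⟩
  rw [mulVec_mulVec, ← pow_succ]
  exact hx.1 (k + 1)

lemma mulVec_mem_undetectedSubspace (hx : x ∈ undetectedSubspace A₁ B₁ L₁ Km) :
    A₁ *ᵥ x ∈ undetectedSubspace A₁ B₁ L₁ Km := by
  rw [← closedLoop_mulVec_of_eq_zero (B₁ := B₁) (undetectedSubspace_mulVec_eq_zero hx)]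
  exact closedLoop_mem_undetectedSubspace hx

lemma undetectedSubspace_spectrallyIn' (hx : x ∈ undetectedSubspace A₁ B₁ L₁ Km) :
    SpectrallyIn {z | 0 < z.re} A₁ x :=
  (SpectrallyIn.congr (fun _ hy => closedLoop_mem_undetectedSubspace hy)
    (fun _ hy => (closedLoop_mulVec_of_eq_zero (undetectedSubspace_mulVec_eq_zero hy)).symm) hx).mpr
    (undetectedSubspace_spectrallyIn hx)

/-- An antistable motion of the uncontrolled system that stays in the target and in the kernel of
the weight is undetected. -/
lemma mem_undetectedSubspace_of_spectrallyIn (hKm : Km ∈ solARE A₁ B₁ Q₁)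
    (hneg : (-Km).PosSemidef) (hx : SpectrallyIn {z | 0 < z.re} A₁ x)
    (h : ∀ k : ℕ, (A₁ ^ k) *ᵥ x ∈ L₁ ∧ Q₁ *ᵥ ((A₁ ^ k) *ᵥ x) = 0) :
    x ∈ undetectedSubspace A₁ B₁ L₁ Km := by
  have hpow : ∀ k : ℕ, SpectrallyIn {z | 0 < z.re} A₁ ((A₁ ^ k) *ᵥ x) := fun k => by
    induction k with
    | zero => simpa using hx
    | succ k ih => rw [pow_succ', ← mulVec_mulVec]; exact ih.mulVec
  have hker : ∀ y, SpectrallyIn {z | 0 < z.re} A₁ y →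
      y ∈ invariantCore (LinearMap.ker Q₁.mulVecLin) A₁ → Km *ᵥ y = 0 := by
    intro y hy hyQ
    -- In reversed time the motion decays and never meets the weight, so the form of `Km` changes at
    -- the rate `-|B₁ᵀ Km y|²` and must be nonnegative at the start. As `Km ≤ 0`, it vanishes.
    have h1 : 0 ≤ y ⬝ᵥ Km *ᵥ y := by
      refine quadForm_nonneg_of_decay (A := -A₁) (hy.neg.mono fun z hz => by simpa using hz)
        fun t => ?_
      have h2 : flow (-A₁) t *ᵥ y ∈ invariantCore (LinearMap.ker Q₁.mulVecLin) A₁ := by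
        refine flow_mulVec_mem (fun v hv => ?_) hyQ t
        rw [neg_mulVec]
        refine Submodule.neg_mem _ ?_
        rw [mem_invariantCore] at hv ⊢
        intro k
        rw [mulVec_mulVec, ← pow_succ]
        exact hv (k + 1)
      have h3 : Q₁ *ᵥ (flow (-A₁) t *ᵥ y) = 0 := by
        simpa using mem_invariantCore.mp h2 0
      have h4 : (-A₁)ᵀ * Km + Km * -A₁ = Q₁ - (B₁ᵀ * Km)ᵀ * (B₁ᵀ * Km) := by
        have h5 := hKm.2
        rw [riccati] at h5
        rw [transpose_mul, transpose_transpose, hKm.1.eq, transpose_neg, Matrix.neg_mul,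
          Matrix.mul_neg, ← sub_eq_zero, ← neg_eq_zero, ← h5]
        simp only [Matrix.mul_assoc]
        abel
      rw [h4, sub_mulVec, dotProduct_sub, h3, dotProduct_zero, zero_sub, neg_nonpos]
      exact quadForm_mul_self_nonneg _ _
    have h5 := (posSemidef_iff_real.mp hneg).2 y
    rw [neg_mulVec, dotProduct_neg] at h5
    have h6 := mulVec_eq_zero_of_posSemidef hneg (x := y) (by
      rw [neg_mulVec, dotProduct_neg]; linarith)
    rwa [neg_mulVec, neg_eq_zero] at h6
  have hpowker : ∀ k : ℕ, Km *ᵥ ((A₁ ^ k) *ᵥ x) = 0 := fun k => by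
    refine hker _ (hpow k) (mem_invariantCore.mpr fun j => ?_)
    rw [mulVec_mulVec, ← pow_add]
    exact (h (j + k)).2
  have hY : x ∈ invariantCore (LinearMap.ker Km.mulVecLin) A₁ := mem_invariantCore.mpr hpowker
  have hinv : ∀ y ∈ invariantCore (LinearMap.ker Km.mulVecLin) A₁,
      A₁ *ᵥ y ∈ invariantCore (LinearMap.ker Km.mulVecLin) A₁ := fun y hy => by
    rw [mem_invariantCore] at hy ⊢
    intro k
    rw [mulVec_mulVec, ← pow_succ]
    exact hy (k + 1)
  have hcl : ∀ y ∈ invariantCore (LinearMap.ker Km.mulVecLin) A₁,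
      closedLoop A₁ B₁ Km *ᵥ y = A₁ *ᵥ y := fun y hy =>
    closedLoop_mulVec_of_eq_zero (by simpa using mem_invariantCore.mp hy 0)
  rw [mem_undetectedSubspace]
  refine ⟨fun k => ?_, (SpectrallyIn.congr hinv hcl hY).mpr hx⟩
  rw [(pow_mulVec_congr hinv hcl hY k).1]
  exact ⟨(h k).1, hpowker k⟩

end Undetected

/-! ### Changes of coordinates -/

namespace CoordChange

variable {n m : ℕ} {κ : Type} [Fintype κ] [DecidableEq κ] (c : CoordChange n κ)
  {A Q K : Matrix (Fin n) (Fin n) ℝ} {B : Matrix (Fin n) (Fin m) ℝ}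

lemma T_mulVec_Tinv_mulVec (x : Fin n → ℝ) : c.T *ᵥ (c.Tinv *ᵥ x) = x := by
  rw [mulVec_mulVec, c.T_mul_Tinv, one_mulVec]

lemma Tinv_mulVec_T_mulVec (y : κ → ℝ) : c.Tinv *ᵥ (c.T *ᵥ y) = y := by
  rw [mulVec_mulVec, c.Tinv_mul_T, one_mulVec]

lemma Tinv_mul : c.Tinv * A = c.sys A * c.Tinv := by
  rw [sys, Matrix.mul_assoc _ c.T, c.T_mul_Tinv, Matrix.mul_one]

lemma form_mulVec_dotProduct (y z : κ → ℝ) :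
    y ⬝ᵥ c.form Q *ᵥ z = (c.T *ᵥ y) ⬝ᵥ Q *ᵥ (c.T *ᵥ z) := by
  rw [form, Matrix.mul_assoc, ← mulVec_mulVec, ← mulVec_mulVec, dotProduct_mulVec, vecMul_transpose]

lemma form_isSymm (hQ : Q.IsSymm) : (c.form Q).IsSymm := by
  rw [IsSymm, form, transpose_mul, transpose_mul, transpose_transpose, hQ.eq, Matrix.mul_assoc]

lemma form_posSemidef (hQ : Q.PosSemidef) : (c.form Q).PosSemidef := by
  rw [posSemidef_iff_real] at hQ ⊢
  refine ⟨c.form_isSymm hQ.1, fun y => ?_⟩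
  rw [form_mulVec_dotProduct]
  exact hQ.2 _

lemma form_neg : c.form (-K) = -c.form K := by
  rw [form, form, Matrix.mul_neg, Matrix.neg_mul]

lemma Tinv_form : c.Tinvᵀ * c.form Q * c.Tinv = Q := by
  have h : c.Tinvᵀ * c.Tᵀ = 1 := by rw [← transpose_mul, c.T_mul_Tinv, transpose_one]
  simp only [form, ← Matrix.mul_assoc, h, Matrix.one_mul]
  rw [Matrix.mul_assoc, c.T_mul_Tinv, Matrix.mul_one]

lemma form_Tinv (S : Matrix κ κ ℝ) : c.form (c.Tinvᵀ * S * c.Tinv) = S := by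
  have h : c.Tᵀ * c.Tinvᵀ = 1 := by rw [← transpose_mul, c.Tinv_mul_T, transpose_one]
  simp only [form, ← Matrix.mul_assoc, h, Matrix.one_mul]
  rw [Matrix.mul_assoc, c.Tinv_mul_T, Matrix.mul_one]

lemma riccati_form :
    riccati (c.sys A) (c.inp B) (c.form Q) (c.form K) = c.form (riccati A B Q K) := by
  have h : c.Tinvᵀ * c.Tᵀ = 1 := by rw [← transpose_mul, c.T_mul_Tinv, transpose_one]
  have h1 : (c.sys A)ᵀ * c.form K = c.Tᵀ * (Aᵀ * K) * c.T := by
    simp only [sys, form, transpose_mul, Matrix.mul_assoc]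
    rw [← Matrix.mul_assoc c.Tinvᵀ, h, Matrix.one_mul]
  have h2 : c.form K * c.sys A = c.Tᵀ * (K * A) * c.T := by
    simp only [sys, form, Matrix.mul_assoc]
    rw [← Matrix.mul_assoc c.T, c.T_mul_Tinv, Matrix.one_mul]
  have h3 : c.form K * c.inp B = c.Tᵀ * (K * B) := by
    simp only [inp, form, Matrix.mul_assoc]
    rw [← Matrix.mul_assoc c.T, c.T_mul_Tinv, Matrix.one_mul]
  have h4 : (c.inp B)ᵀ * c.form K = Bᵀ * K * c.T := by
    simp only [inp, form, transpose_mul, Matrix.mul_assoc]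
    rw [← Matrix.mul_assoc c.Tinvᵀ, h, Matrix.one_mul]
  rw [riccati, h1, h2, h3, Matrix.mul_assoc _ (c.inp B)ᵀ, h4, form, form, riccati]
  simp only [Matrix.mul_add, Matrix.add_mul, Matrix.mul_sub, Matrix.sub_mul, Matrix.mul_assoc]

lemma form_mem_solARI (hK : K ∈ solARI A B Q) :
    c.form K ∈ solARI (c.sys A) (c.inp B) (c.form Q) :=
  ⟨c.form_isSymm hK.1, by rw [riccati_form]; exact c.form_posSemidef hK.2⟩

lemma form_mem_solARINeg (hK : K ∈ solARINeg A B Q) :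
    c.form K ∈ solARINeg (c.sys A) (c.inp B) (c.form Q) :=
  ⟨c.form_mem_solARI hK.1, by rw [← form_neg]; exact c.form_posSemidef hK.2⟩

lemma mem_solARE_iff : c.form K ∈ solARE (c.sys A) (c.inp B) (c.form Q) ↔ K ∈ solARE A B Q := by
  refine ⟨fun h => ⟨?_, ?_⟩, fun h => ⟨c.form_isSymm h.1, ?_⟩⟩
  · rw [← c.Tinv_form (Q := K), IsSymm, transpose_mul, transpose_mul, transpose_transpose, h.1.eq,
      Matrix.mul_assoc]
  · rw [← c.Tinv_form (Q := riccati A B Q K), ← riccati_form, h.2, Matrix.mul_zero, Matrix.zero_mul]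
  · rw [riccati_form, h.2, form, Matrix.mul_zero, Matrix.zero_mul]

end CoordChange

/-! ### Coordinates adapted to the controllable subspace. -/

section Controllable

variable {n m : ℕ} {A : Matrix (Fin n) (Fin n) ℝ} {B : Matrix (Fin n) (Fin m) ℝ}

lemma mulVec_pow_mem_controllableSubspace (u : Fin m → ℝ) (k : ℕ) :
    (A ^ k) *ᵥ (B *ᵥ u) ∈ controllableSubspace A B := by
  refine pow_mulVec_mem_of_forall_lt (fun j hj => ?_) k
  rw [Fintype.card_fin] at hj
  exact Submodule.mem_iSup_of_mem (⟨j, hj⟩ : Fin n) ⟨B *ᵥ u, ⟨u, rfl⟩, rfl⟩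

lemma controllableSubspace_le {V : Submodule ℝ (Fin n → ℝ)}
    (h : ∀ (u : Fin m → ℝ) (k : ℕ), (A ^ k) *ᵥ (B *ᵥ u) ∈ V) : controllableSubspace A B ≤ V := by
  refine iSup_le fun k => ?_
  rintro _ ⟨_, ⟨u, rfl⟩, rfl⟩
  exact h u k

lemma mulVec_mem_controllableSubspace {x : Fin n → ℝ} (hx : x ∈ controllableSubspace A B) :
    A *ᵥ x ∈ controllableSubspace A B := by
  refine controllableSubspace_le (V := (controllableSubspace A B).comap A.mulVecLin)
    (fun u k => ?_) hx
  rw [Submodule.mem_comap, mulVecLin_apply, mulVec_mulVec, ← pow_succ']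
  exact mulVec_pow_mem_controllableSubspace u (k + 1)

lemma inp_mem_controllableSubspace (u : Fin m → ℝ) : B *ᵥ u ∈ controllableSubspace A B := by
  simpa using mulVec_pow_mem_controllableSubspace (A := A) u 0

variable {ι₁ ι₂ : Type} [Fintype ι₁] [DecidableEq ι₁] [Fintype ι₂] [DecidableEq ι₂]
  {c : CoordChange n (ι₁ ⊕ ι₂)}

lemma T_mulVec_elim (y : ι₁ → ℝ) : c.T *ᵥ Sum.elim y 0 = c.T.toCols₁ *ᵥ y := by
  conv_lhs => rw [← fromCols_toCols c.T]
  rw [fromCols_mulVec]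
  simp [Function.comp_def, ← Pi.zero_def]

lemma Tinv_mulVec_of_mem {V : Submodule ℝ (Fin n → ℝ)}
    (hc : LinearMap.range c.T.toCols₁.mulVecLin = V) {x : Fin n → ℝ} (hx : x ∈ V) :
    c.Tinv *ᵥ x = Sum.elim ((c.Tinv *ᵥ x) ∘ Sum.inl) 0 := by
  rw [← hc] at hx
  obtain ⟨y, rfl⟩ := hx
  rw [mulVecLin_apply, ← T_mulVec_elim, c.Tinv_mulVec_T_mulVec]
  rfl

lemma sys_eq_fromBlocks (hc : LinearMap.range c.T.toCols₁.mulVecLin = controllableSubspace A B) :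
    c.sys A = fromBlocks (c.sys A).toBlocks₁₁ (c.sys A).toBlocks₁₂ 0 (c.sys A).toBlocks₂₂ := by
  conv_lhs => rw [← fromBlocks_toBlocks (c.sys A)]
  congr 1
  ext i j
  have h1 : c.T.toCols₁ *ᵥ Pi.single j 1 ∈ controllableSubspace A B := hc ▸ ⟨_, rfl⟩
  have h2 := congrFun (Tinv_mulVec_of_mem hc (mulVec_mem_controllableSubspace h1)) (Sum.inr i)
  rw [← T_mulVec_elim, mulVec_mulVec, mulVec_mulVec] at h2
  have h3 : (Sum.elim (Pi.single j 1) 0 : ι₁ ⊕ ι₂ → ℝ) = Pi.single (Sum.inl j) 1 :=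
    Sum.elim_single_zero j 1
  rw [h3, mulVec_single_one] at h2
  exact h2

lemma inp_eq_fromRows (hc : LinearMap.range c.T.toCols₁.mulVecLin = controllableSubspace A B) :
    c.inp B = fromRows (c.inp B).toRows₁ 0 := by
  conv_lhs => rw [← fromRows_toRows (c.inp B)]
  congr 1
  ext i j
  have h2 := congrFun (Tinv_mulVec_of_mem hc (inp_mem_controllableSubspace (Pi.single j 1)))
    (Sum.inr i)
  rw [mulVec_mulVec, mulVec_single_one] at h2
  exact h2

/-- The subsystem on the controllable subspace is controllable. -/
lemma isControllablePair_of_range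
    (hc : LinearMap.range c.T.toCols₁.mulVecLin = controllableSubspace A B) :
    IsControllablePair (c.sys A).toBlocks₁₁ (c.inp B).toRows₁ := by
  intro Y hY hYB
  have hA := sys_eq_fromBlocks hc
  have hB := inp_eq_fromRows hc
  set A₁ := (c.sys A).toBlocks₁₁
  set B₁ := (c.inp B).toRows₁
  rw [Submodule.eq_bot_iff]
  intro η hη
  have hpow : ∀ ζ ∈ Y, ∀ k : ℕ, (A₁ᵀ ^ k) *ᵥ ζ ∈ Y := fun ζ hζ k => by
    induction k with
    | zero => simpa using hζ
    | succ k ih => rw [pow_succ', ← mulVec_mulVec]; exact hY _ ih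
  have hlift : ∀ (k : ℕ) (u : Fin m → ℝ),
      c.Tinv *ᵥ ((A ^ k) *ᵥ (B *ᵥ u)) = Sum.elim ((A₁ ^ k) *ᵥ (B₁ *ᵥ u)) 0 := by
    intro k u
    induction k with
    | zero =>
      have h1 : c.Tinv *ᵥ (B *ᵥ u) = c.inp B *ᵥ u := by rw [mulVec_mulVec, CoordChange.inp]
      rw [pow_zero, one_mulVec, h1, hB, fromRows_mulVec, pow_zero, one_mulVec, zero_mulVec]
    | succ k ih =>
      rw [pow_succ', ← mulVec_mulVec, mulVec_mulVec, c.Tinv_mul, ← mulVec_mulVec, ih, hA,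
        fromBlocks_mulVec, pow_succ', ← mulVec_mulVec]
      simp [Function.comp_def, ← Pi.zero_def]
  -- `Y` is orthogonal to everything reachable, yet the first block of coordinates is entirely
  -- reachable; so each `η ∈ Y` is orthogonal to itself.
  have hle : controllableSubspace A B ≤ (orthComplement Y).comap (c.Tinv.toRows₁.mulVecLin) := by
    refine controllableSubspace_le fun u k => ?_
    intro ζ hζ
    have h1 : c.Tinv.toRows₁.mulVecLin ((A ^ k) *ᵥ (B *ᵥ u)) = (A₁ ^ k) *ᵥ (B₁ *ᵥ u) := by
      have h2 := congrArg (· ∘ Sum.inl) (hlift k u)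
      exact h2
    rw [h1, dotProduct_mulVec, ← mulVec_transpose, transpose_pow, dotProduct_mulVec,
      ← mulVec_transpose, hYB _ (hpow ζ hζ k), zero_dotProduct]
  have h4 : c.T.toCols₁ *ᵥ η ∈ controllableSubspace A B := hc ▸ ⟨_, rfl⟩
  have h5 := hle h4 η hη
  rw [← T_mulVec_elim] at h5
  have h6 : c.Tinv.toRows₁.mulVecLin (c.T *ᵥ Sum.elim η 0) = η := by
    have h7 := congrArg (· ∘ Sum.inl) (c.Tinv_mulVec_T_mulVec (Sum.elim η 0))
    exact h7
  rw [h6] at h5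
  exact dotProduct_self_eq_zero.mp h5

/-- The uncontrollable part of a stabilizable system is stable. -/
lemma stable_of_isStabilizable (hstab : IsStabilizable A B)
    (hc : LinearMap.range c.T.toCols₁.mulVecLin = controllableSubspace A B) :
    RootsIn {z | z.re < 0} (c.sys A).toBlocks₂₂.charpoly := by
  obtain ⟨F, hF⟩ := hstab
  have hroots : RootsIn {z | z.re < 0} (A + B * F).charpoly := by
    intro z hz
    refine hF z ?_
    rw [Matrix.mem_spectrum_iff_isRoot_charpoly, charpoly_map, IsRoot, eval_map_algebraMap]
    exact hz
  have hA := sys_eq_fromBlocks hc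
  have hB := inp_eq_fromRows hc
  -- The last coordinates do not see the input, so they intertwine every closed loop with the
  -- uncontrollable block.
  have hR : (c.sys A).toBlocks₂₂ * c.Tinv.toRows₂ = c.Tinv.toRows₂ * (A + B * F) := by
    have h1 : c.Tinv * (A + B * F) = c.sys A * c.Tinv + c.inp B * F := by
      rw [Matrix.mul_add, c.Tinv_mul, CoordChange.inp, Matrix.mul_assoc]
    have h2 : c.Tinv = fromRows c.Tinv.toRows₁ c.Tinv.toRows₂ := (fromRows_toRows _).symm
    rw [hA, hB, h2, fromRows_mul, fromBlocks_mul_fromRows, fromRows_mul] at h1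
    have h3 := congrArg toRows₂ h1
    ext i j
    have h4 := congrFun (congrFun h3 i) j
    simpa using h4.symm
  refine rootsIn_charpoly_of_forall fun y => ?_
  have h3 := (spectrallyIn_of_charpoly hroots (c.T *ᵥ Sum.elim 0 y)).map hR
  have h4 : c.Tinv.toRows₂ *ᵥ (c.T *ᵥ Sum.elim 0 y) = y := by
    have h7 := congrArg (· ∘ Sum.inr) (c.Tinv_mulVec_T_mulVec (Sum.elim 0 y))
    exact h7
  rwa [h4] at h3

end Controllable

/-! ### Quotients of the state space -/

section Quotient

variable {m : ℕ} {ι κ : Type*} [Fintype ι] [DecidableEq ι] [Fintype κ] [DecidableEq κ]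

/-- The Riccati map commutes with pulling forms back along a quotient map. -/
lemma riccati_congruence {A Q : Matrix ι ι ℝ} {B : Matrix ι (Fin m) ℝ} {E : Matrix κ ι ℝ}
    {A' Q' : Matrix κ κ ℝ} (hA : E * A = A' * E) (hQ : Q = Eᵀ * Q' * E) (K : Matrix κ κ ℝ) :
    riccati A B Q (Eᵀ * K * E) = Eᵀ * riccati A' (E * B) Q' K * E := by
  have hAt : Aᵀ * Eᵀ = Eᵀ * A'ᵀ := by rw [← transpose_mul, hA, transpose_mul]
  have h1 : Aᵀ * (Eᵀ * K * E) = Eᵀ * (A'ᵀ * K) * E := by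
    rw [← Matrix.mul_assoc, ← Matrix.mul_assoc, hAt]
    simp only [Matrix.mul_assoc]
  have h2 : Eᵀ * K * E * A = Eᵀ * (K * A') * E := by
    rw [Matrix.mul_assoc, hA]
    simp only [Matrix.mul_assoc]
  rw [riccati, h1, h2, hQ, riccati]
  simp only [Matrix.mul_add, Matrix.add_mul, Matrix.mul_sub, Matrix.sub_mul, Matrix.mul_assoc,
    transpose_mul]

variable {E : Matrix κ ι ℝ}

/-- With `E * Eᵀ = 1` the transpose is a section of the quotient map; matrices that respect the
kernel of `E` are recovered from their compressions. -/
lemma mulVec_sub_transpose_mulVec (hE : E * Eᵀ = 1) (v : ι → ℝ) :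
    E *ᵥ (v - Eᵀ *ᵥ (E *ᵥ v)) = 0 := by
  rw [mulVec_sub, mulVec_mulVec _ E Eᵀ, hE, one_mulVec, sub_self]

lemma quotient_intertwine (hE : E * Eᵀ = 1) {A : Matrix ι ι ℝ}
    (hA : ∀ v, E *ᵥ v = 0 → E *ᵥ (A *ᵥ v) = 0) : E * A = E * A * Eᵀ * E := by
  refine Matrix.ext_of_mulVec_single fun i => ?_
  have h1 := hA _ (mulVec_sub_transpose_mulVec hE (Pi.single i 1))
  rw [mulVec_sub, mulVec_sub, sub_eq_zero] at h1
  simp only [← mulVec_mulVec]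
  exact h1

lemma eq_quotient_form (hE : E * Eᵀ = 1) {S : Matrix ι ι ℝ} (hS : S.IsSymm)
    (h : ∀ v, E *ᵥ v = 0 → S *ᵥ v = 0) : S = Eᵀ * (E * S * Eᵀ) * E := by
  have h1 : S = S * Eᵀ * E := by
    refine Matrix.ext_of_mulVec_single fun i => ?_
    have h2 := h _ (mulVec_sub_transpose_mulVec hE (Pi.single i 1))
    rw [mulVec_sub, sub_eq_zero] at h2
    simp only [← mulVec_mulVec]
    exact h2
  have h3 : S = Eᵀ * (E * S) := by
    have := congrArg transpose h1
    rwa [transpose_mul, transpose_mul, transpose_transpose, hS.eq] at this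
  calc S = Eᵀ * (E * S) := h3
    _ = Eᵀ * (E * (S * Eᵀ * E)) := by rw [← h1]
    _ = _ := by simp only [Matrix.mul_assoc]

lemma quotient_form_isSymm {S : Matrix ι ι ℝ} (hS : S.IsSymm) : (E * S * Eᵀ).IsSymm := by
  rw [IsSymm, transpose_mul, transpose_mul, transpose_transpose, hS.eq, Matrix.mul_assoc]

lemma quotient_form_posSemidef {S : Matrix ι ι ℝ} (hS : S.PosSemidef) :
    (E * S * Eᵀ).PosSemidef := by
  have := hS.mul_mul_conjTranspose_same E
  rwa [conjTranspose_eq_transpose_of_trivial] at this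

lemma quotient_cancel (hE : E * Eᵀ = 1) (S : Matrix κ κ ℝ) : E * (Eᵀ * S * E) * Eᵀ = S := by
  simp only [← Matrix.mul_assoc, hE, Matrix.one_mul]
  rw [Matrix.mul_assoc, hE, Matrix.mul_one]

lemma riccati_quotient (hE : E * Eᵀ = 1) {A Q : Matrix ι ι ℝ} {B : Matrix ι (Fin m) ℝ}
    {A' Q' : Matrix κ κ ℝ} (hA : E * A = A' * E) (hQ : Q = Eᵀ * Q' * E) (K : Matrix κ κ ℝ) :
    riccati A' (E * B) Q' K = E * riccati A B Q (Eᵀ * K * E) * Eᵀ := by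
  rw [riccati_congruence hA hQ, quotient_cancel hE]

lemma mem_solARE_quotient (hE : E * Eᵀ = 1) {A Q : Matrix ι ι ℝ} {B : Matrix ι (Fin m) ℝ}
    {A' Q' : Matrix κ κ ℝ} (hA : E * A = A' * E) (hQ : Q = Eᵀ * Q' * E) {K : Matrix κ κ ℝ} :
    Eᵀ * K * E ∈ solARE A B Q ↔ K ∈ solARE A' (E * B) Q' := by
  refine ⟨fun h => ⟨?_, ?_⟩, fun h => ⟨?_, ?_⟩⟩
  · rw [← quotient_cancel hE K]
    exact quotient_form_isSymm h.1
  · rw [riccati_quotient hE hA hQ, h.2, Matrix.mul_zero, Matrix.zero_mul]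
  · have := quotient_form_isSymm (E := Eᵀ) h.1
    rwa [transpose_transpose] at this
  · rw [riccati_congruence hA hQ, h.2, Matrix.mul_zero, Matrix.zero_mul]

lemma mem_solARINeg_quotient (hE : E * Eᵀ = 1) {A Q : Matrix ι ι ℝ} {B : Matrix ι (Fin m) ℝ}
    {A' Q' : Matrix κ κ ℝ} (hA : E * A = A' * E) (hQ : Q = Eᵀ * Q' * E) {K : Matrix ι ι ℝ}
    (hK : K ∈ solARINeg A B Q) (hker : ∀ v, E *ᵥ v = 0 → K *ᵥ v = 0) :
    E * K * Eᵀ ∈ solARINeg A' (E * B) Q' := by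
  refine ⟨⟨quotient_form_isSymm hK.1.1, ?_⟩, ?_⟩
  · rw [riccati_quotient hE hA hQ, ← eq_quotient_form hE hK.1.1 hker]
    exact quotient_form_posSemidef hK.1.2
  · have := quotient_form_posSemidef (E := E) hK.2
    rwa [Matrix.mul_neg, Matrix.neg_mul] at this

end Quotient

/-! ### Selecting coordinates -/

section Selection

variable {ι κ μ : Type*} [Fintype ι] [DecidableEq ι] [Fintype κ] [DecidableEq κ]

/-- The matrix of `v ↦ v ∘ f`. -/
def selection (f : κ → ι) : Matrix κ ι ℝ := (1 : Matrix ι ι ℝ).submatrix f id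

lemma selection_mulVec (f : κ → ι) (v : ι → ℝ) : selection f *ᵥ v = v ∘ f := by
  ext i
  simp [selection, mulVec, dotProduct, one_apply]

lemma selection_mul (f : κ → ι) (M : Matrix ι μ ℝ) : selection f * M = M.submatrix f id := by
  ext i j
  simp [selection, Matrix.mul_apply, one_apply]

lemma mul_selection_transpose [Fintype μ] (f : κ → ι) (M : Matrix μ ι ℝ) :
    M * (selection f)ᵀ = M.submatrix id f := by
  ext i j
  simp [selection, Matrix.mul_apply, one_apply]

lemma selection_mul_transpose {f : κ → ι} (hf : Function.Injective f) :
    selection f * (selection f)ᵀ = 1 := by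
  rw [selection_mul]
  ext i j
  simp [selection, one_apply, hf.eq_iff]

lemma selection_mul_mul_transpose (f : κ → ι) (M : Matrix ι ι ℝ) :
    selection f * M * (selection f)ᵀ = M.submatrix f f := by
  rw [selection_mul, mul_selection_transpose, submatrix_submatrix]
  rfl

lemma mem_coordSubspace {e : κ → ι} {x : ι → ℝ} :
    x ∈ coordSubspace e ↔ ∀ i, i ∉ Set.range e → x i = 0 := by
  constructor
  · intro hx
    refine Submodule.span_induction (p := fun x _ => ∀ i, i ∉ Set.range e → x i = 0) ?_ ?_ ?_ ?_ hx
    · rintro _ ⟨k, rfl⟩ i hi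
      exact Pi.single_eq_of_ne (fun h => hi ⟨k, h.symm⟩) _
    · intro i _
      rfl
    · intro x y _ _ hx hy i hi
      rw [Pi.add_apply, hx i hi, hy i hi, add_zero]
    · intro a x _ hx i hi
      rw [Pi.smul_apply, hx i hi, smul_zero]
  · intro h
    rw [← Finset.univ_sum_single x]
    refine Submodule.sum_mem _ fun i _ => ?_
    by_cases hi : i ∈ Set.range e
    · obtain ⟨k, rfl⟩ := hi
      have : (Pi.single (e k) (x (e k)) : ι → ℝ) = x (e k) • Pi.single (e k) 1 := by
        rw [← Pi.single_smul', smul_eq_mul, mul_one]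
      rw [this]
      exact Submodule.smul_mem _ _ (Submodule.subset_span ⟨k, rfl⟩)
    · rw [h i hi, Pi.single_zero]
      exact Submodule.zero_mem _

end Selection

/-! ### Systems in coordinates adapted to the controllable subspace -/

section Triangular

variable {m : ℕ} {ι₁ ι₂ : Type} [Fintype ι₁] [DecidableEq ι₁] [Fintype ι₂] [DecidableEq ι₂]
  {A Q K K₀ : Matrix (ι₁ ⊕ ι₂) (ι₁ ⊕ ι₂) ℝ} {B : Matrix (ι₁ ⊕ ι₂) (Fin m) ℝ}

lemma riccati_toBlocks₁₁
    (hA : A = fromBlocks A.toBlocks₁₁ A.toBlocks₁₂ 0 A.toBlocks₂₂)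
    (hB : B = fromRows B.toRows₁ 0) (hQ : Q.IsSymm) (hK : K.IsSymm) :
    (riccati A B Q K).toBlocks₁₁ = riccati A.toBlocks₁₁ B.toRows₁ Q.toBlocks₁₁ K.toBlocks₁₁ := by
  obtain ⟨h1, -, -⟩ := eq_fromBlocks_of_isSymm hQ
  obtain ⟨h2, h3, -⟩ := eq_fromBlocks_of_isSymm hK
  conv_lhs => rw [hA, hB, h1, h2, riccati_fromBlocks _ _ _ _ _ _ _ h3]
  rw [toBlocks_fromBlocks₁₁]

lemma toBlocks₁₁_mem_solARI
    (hA : A = fromBlocks A.toBlocks₁₁ A.toBlocks₁₂ 0 A.toBlocks₂₂)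
    (hB : B = fromRows B.toRows₁ 0) (hQ : Q.IsSymm) (hK : K ∈ solARI A B Q) :
    K.toBlocks₁₁ ∈ solARI A.toBlocks₁₁ B.toRows₁ Q.toBlocks₁₁ :=
  ⟨(eq_fromBlocks_of_isSymm hK.1).2.1, by
    rw [← riccati_toBlocks₁₁ hA hB hQ hK.1]
    exact posSemidef_toBlocks₁₁ hK.2⟩

variable {Km : Matrix ι₁ ι₁ ℝ} {L₁ : Submodule ℝ (ι₁ → ℝ)}

/-- The minimal solution lies below every solution of the inequality, in particular below the block
of `K₀`, which is nonpositive. -/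
lemma IsMinimalElement.sub_posSemidef_and_neg
    (hA : A = fromBlocks A.toBlocks₁₁ A.toBlocks₁₂ 0 A.toBlocks₂₂)
    (hB : B = fromRows B.toRows₁ 0) (hQ : Q.IsSymm)
    (hc : IsControllablePair A.toBlocks₁₁ B.toRows₁)
    (hKm : IsMinimalElement (solARE A.toBlocks₁₁ B.toRows₁ Q.toBlocks₁₁) Km)
    (hK₀ : K₀ ∈ solARINeg A B Q) :
    (K₀.toBlocks₁₁ - Km).PosSemidef ∧ (-Km).PosSemidef := by
  have h1 : (K₀.toBlocks₁₁ - Km).PosSemidef :=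
    (hKm.antisemistable (eq_fromBlocks_of_isSymm hQ).2.1 hc.neg.hasStabilizer).2 _
      (toBlocks₁₁_mem_solARI hA hB hQ hK₀.1)
  refine ⟨h1, ?_⟩
  have h2 : (-K₀.toBlocks₁₁).PosSemidef := posSemidef_toBlocks₁₁ hK₀.2
  have h3 := h1.add h2
  rwa [sub_add_eq_add_sub, add_neg_cancel, zero_sub] at h3

lemma mulVec_elim_zero (hA : A = fromBlocks A.toBlocks₁₁ A.toBlocks₁₂ 0 A.toBlocks₂₂)
    (x : ι₁ → ℝ) : A *ᵥ Sum.elim x 0 = Sum.elim (A.toBlocks₁₁ *ᵥ x) 0 := by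
  conv_lhs => rw [hA, fromBlocks_mulVec]
  simp [Function.comp_def, ← Pi.zero_def]

/-- Undetected motions lie in the kernel of the weight and of every negative semidefinite solution
of the Riccati inequality. -/
lemma mulVec_eq_zero_of_mem_undetectedSubspace
    (hA : A = fromBlocks A.toBlocks₁₁ A.toBlocks₁₂ 0 A.toBlocks₂₂)
    (hB : B = fromRows B.toRows₁ 0) (hQ : Q.IsSymm)
    (hc : IsControllablePair A.toBlocks₁₁ B.toRows₁)
    (hKm : IsMinimalElement (solARE A.toBlocks₁₁ B.toRows₁ Q.toBlocks₁₁) Km)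
    (hK₀ : K₀ ∈ solARINeg A B Q) {x : ι₁ → ℝ}
    (hx : x ∈ undetectedSubspace A.toBlocks₁₁ B.toRows₁ L₁ Km) :
    K₀ *ᵥ Sum.elim x 0 = 0 ∧ Q *ᵥ Sum.elim x 0 = 0 := by
  obtain ⟨hgap, -⟩ := hKm.sub_posSemidef_and_neg hA hB hQ hc hK₀
  have hker : ∀ y ∈ undetectedSubspace A.toBlocks₁₁ B.toRows₁ L₁ Km, K₀ *ᵥ Sum.elim y 0 = 0 := by
    intro y hy
    have h1 := (posSemidef_iff_real.mp hgap).2 y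
    rw [sub_mulVec, undetectedSubspace_mulVec_eq_zero hy, sub_zero, ← elim_quadForm] at h1
    have h2 := (posSemidef_iff_real.mp hK₀.2).2 (Sum.elim y 0)
    rw [neg_mulVec, dotProduct_neg] at h2
    have h3 := mulVec_eq_zero_of_posSemidef hK₀.2 (x := Sum.elim y 0) (by
      rw [neg_mulVec, dotProduct_neg]; linarith)
    rwa [neg_mulVec, neg_eq_zero] at h3
  have hform : ∀ {ι : Type} [Fintype ι] [DecidableEq ι] {A Q K : Matrix ι ι ℝ}
      {B : Matrix ι (Fin m) ℝ} {v : ι → ℝ}, K.IsSymm → K *ᵥ v = 0 →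
      riccati A B Q K *ᵥ v = K *ᵥ (A *ᵥ v) + Q *ᵥ v ∧ v ⬝ᵥ riccati A B Q K *ᵥ v = v ⬝ᵥ Q *ᵥ v := by
    intro ι _ _ A Q K B v hK hv
    have h1 : riccati A B Q K *ᵥ v = K *ᵥ (A *ᵥ v) + Q *ᵥ v := by
      simp only [riccati, add_mulVec, sub_mulVec, ← mulVec_mulVec, hv, mulVec_zero, sub_zero,
        zero_add]
    refine ⟨h1, ?_⟩
    rw [h1, dotProduct_add, dotProduct_mulVec, ← mulVec_transpose, hK.eq, hv, zero_dotProduct,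
      zero_add]
  have h1 := hker x hx
  obtain ⟨h2, h3⟩ := hform (A := A) (Q := Q) (B := B) hK₀.1.1 h1
  -- Where `Km` vanishes, φ(Km) = 0 forces `xᵀ Q x = 0`. So φ(K₀) has zero form, hence vanishes, at
  -- `x`, and this leaves `Q x = -K₀ A x = 0` by invariance.
  obtain ⟨-, h4⟩ := hform (A := A.toBlocks₁₁) (Q := Q.toBlocks₁₁) (B := B.toRows₁) hKm.1.1
    (undetectedSubspace_mulVec_eq_zero hx)
  rw [hKm.1.2, zero_mulVec, dotProduct_zero] at h4
  rw [elim_quadForm Q, ← h4] at h3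
  have h5 := mulVec_eq_zero_of_posSemidef hK₀.1.2 h3
  rw [h2, mulVec_elim_zero hA, hker _ (mulVec_mem_undetectedSubspace hx), zero_add] at h5
  exact ⟨h1, h5⟩

end Triangular

/-! ### Block systems with an invariant first block. -/

section Split

variable {m : ℕ} {π ρ σ : Type} [Fintype π] [DecidableEq π] [Fintype ρ] [DecidableEq ρ]
  [Fintype σ] [DecidableEq σ]

lemma mem_coordSubspace_inl {x : π ⊕ ρ → ℝ} :
    x ∈ coordSubspace (Sum.inl : π → π ⊕ ρ) ↔ x ∘ Sum.inr = 0 := by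
  rw [mem_coordSubspace]
  constructor
  · intro h
    ext i
    exact h (Sum.inr i) (by simp)
  · rintro h (i | i) hi
    · simp at hi
    · exact congrFun h i

/-- Passing to a quotient preserves controllability. -/
lemma IsControllablePair.toBlocks₂₂ {A : Matrix (π ⊕ ρ) (π ⊕ ρ) ℝ}
    {B : Matrix (π ⊕ ρ) (Fin m) ℝ} (h : IsControllablePair A B) (hA : A.toBlocks₂₁ = 0) :
    IsControllablePair A.toBlocks₂₂ B.toRows₂ := by
  intro Y hY hYB
  rw [Submodule.eq_bot_iff]
  intro η hη
  set J : Matrix (π ⊕ ρ) ρ ℝ := fromRows 0 1 with hJ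
  have hJv : ∀ v, J *ᵥ v = Sum.elim (0 : π → ℝ) v := fun v => by
    rw [hJ, fromRows_mulVec, zero_mulVec, one_mulVec]
  have h1 : Y.map J.mulVecLin = ⊥ := by
    refine h _ ?_ ?_
    · rintro _ ⟨v, hv, rfl⟩
      refine ⟨A.toBlocks₂₂ᵀ *ᵥ v, hY v hv, ?_⟩
      rw [mulVecLin_apply, mulVecLin_apply, hJv, hJv]
      conv_rhs => rw [← fromBlocks_toBlocks A, hA, fromBlocks_transpose, fromBlocks_mulVec]
      simp [Function.comp_def, ← Pi.zero_def]
    · rintro _ ⟨v, hv, rfl⟩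
      rw [mulVecLin_apply, hJv, ← hYB v hv]
      conv_lhs => rw [← fromRows_toRows B, transpose_fromRows, fromCols_mulVec]
      simp [Function.comp_def, ← Pi.zero_def]
  have h2 : J *ᵥ η ∈ Y.map J.mulVecLin := ⟨η, hη, rfl⟩
  rw [h1, Submodule.mem_bot, hJv] at h2
  exact congrArg (· ∘ Sum.inr) h2

lemma hasStabilizer_fromBlocks {A₁ : Matrix ρ ρ ℝ} {A₁₂ : Matrix ρ σ ℝ} {A₂ : Matrix σ σ ℝ}
    {B₁ : Matrix ρ (Fin m) ℝ} (h : HasStabilizer A₁ B₁)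
    (hA₂ : RootsIn {z | z.re < 0} A₂.charpoly) :
    HasStabilizer (fromBlocks A₁ A₁₂ 0 A₂) (fromRows B₁ 0) := by
  obtain ⟨F, hF⟩ := h
  refine ⟨fromCols F 0, ?_⟩
  rw [fromRows_mul_fromCols, fromBlocks_add]
  simp only [Matrix.zero_mul, add_zero, Matrix.mul_zero]
  exact rootsIn_charpoly_fromBlocks hF hA₂

lemma rootsIn_charpoly_of_fromBlocks {R : Set ℂ} {A₁ : Matrix ρ ρ ℝ} {A₁₂ : Matrix ρ σ ℝ}
    {A₂ : Matrix σ σ ℝ} (h : RootsIn R (fromBlocks A₁ A₁₂ 0 A₂).charpoly) :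
    RootsIn R A₁.charpoly := by
  intro z hz
  refine h z ?_
  rw [charpoly_fromBlocks_zero₂₁, map_mul, hz, zero_mul]

end Split

/-! ### The value function in coordinates starting with the undetected subspace. -/

section Core

variable {n m : ℕ} {π ρ σ : Type} [Fintype π] [DecidableEq π] [Fintype ρ] [DecidableEq ρ]
  [Fintype σ] [DecidableEq σ]

/-- The projection that forgets the first block of coordinates. -/
abbrev dropFirst (π ρ σ : Type) [Fintype π] [DecidableEq π] [Fintype ρ] [DecidableEq ρ]
    [Fintype σ] [DecidableEq σ] : Matrix (ρ ⊕ σ) ((π ⊕ ρ) ⊕ σ) ℝ :=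
  selection (Sum.map Sum.inr id)

lemma dropFirst_mul_transpose : dropFirst π ρ σ * (dropFirst π ρ σ)ᵀ = 1 :=
  selection_mul_transpose (Sum.map_injective.mpr ⟨Sum.inr_injective, Function.injective_id⟩)

lemma dropFirst_mulVec_eq_zero {v : (π ⊕ ρ) ⊕ σ → ℝ} : dropFirst π ρ σ *ᵥ v = 0 ↔
    ∃ x ∈ coordSubspace (Sum.inl : π → π ⊕ ρ), v = Sum.elim x 0 := by
  rw [selection_mulVec]
  constructor
  · intro h
    refine ⟨v ∘ Sum.inl, mem_coordSubspace_inl.mpr ?_, ?_⟩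
    · ext i
      exact congrFun h (Sum.inl i)
    · ext (i | i)
      · rfl
      · exact congrFun h (Sum.inr i)
  · rintro ⟨x, hx, rfl⟩
    rw [mem_coordSubspace_inl] at hx
    ext (i | i)
    · exact congrFun hx i
    · rfl

lemma selection_inr_transpose_mul_mul (M : Matrix ρ ρ ℝ) :
    (selection (Sum.inr : ρ → π ⊕ ρ))ᵀ * M * selection (Sum.inr : ρ → π ⊕ ρ) =
      fromBlocks 0 0 0 M := by
  have h1 : selection (Sum.inr : ρ → π ⊕ ρ) = fromCols 0 1 := by
    ext i (j | j) <;> simp [selection, one_apply]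
  rw [h1, transpose_fromCols, fromRows_mul, fromRows_mul_fromCols]
  simp

lemma dropFirst_transpose_mul_mul (k₁ : Matrix ρ ρ ℝ) (k₁₂ : Matrix ρ σ ℝ) (k₂ : Matrix σ σ ℝ) :
    (dropFirst π ρ σ)ᵀ * fromBlocks k₁ k₁₂ k₁₂ᵀ k₂ * dropFirst π ρ σ =
      fromBlocks (fromBlocks 0 0 0 k₁) (fromRows 0 k₁₂) (fromRows 0 k₁₂)ᵀ k₂ := by
  have h1 : dropFirst π ρ σ = fromBlocks (selection Sum.inr) 0 0 1 := by
    ext (i | i) ((j | j) | j) <;> simp [selection, one_apply]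
  have h2 : (selection (Sum.inr : ρ → π ⊕ ρ))ᵀ * k₁₂ = fromRows 0 k₁₂ := by
    ext (i | i) j <;> simp [selection, Matrix.mul_apply, one_apply]
  rw [h1, fromBlocks_transpose, fromBlocks_multiply, fromBlocks_multiply, ← h2]
  simp [selection_inr_transpose_mul_mul]

variable {A Q : Matrix (Fin n) (Fin n) ℝ} {B : Matrix (Fin n) (Fin m) ℝ}
  {L : Submodule ℝ (Fin n → ℝ)} {c : CoordChange n ((π ⊕ ρ) ⊕ σ)}

/-- In coordinates whose first block spans the undetected subspace, the value function is the
quadratic form of a solution of the Riccati equation with vanishing first block, the second block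
of which is a given semistable solution. -/
theorem exists_form_valueFunction (hQ : Q.IsSymm) (hstab : IsStabilizable A B)
    (hneg : (solARINeg A B Q).Nonempty)
    (hc : LinearMap.range c.T.toCols₁.mulVecLin = controllableSubspace A B)
    {Km : Matrix (π ⊕ ρ) (π ⊕ ρ) ℝ}
    (hKm : IsMinimalElement
      (solARE (c.sys A).toBlocks₁₁ (c.inp B).toRows₁ (c.form Q).toBlocks₁₁) Km)
    (hN : undetectedSubspace (c.sys A).toBlocks₁₁ (c.inp B).toRows₁ (restrictedTarget L c) Km =
      coordSubspace Sum.inl)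
    {k : Matrix ρ ρ ℝ}
    (hk : fromBlocks 0 0 0 k ∈
      solARE (c.sys A).toBlocks₁₁ (c.inp B).toRows₁ (c.form Q).toBlocks₁₁)
    (hkst : RootsIn {z | z.re ≤ 0} (closedLoop (c.sys A).toBlocks₁₁ (c.inp B).toRows₁
      (fromBlocks 0 0 0 k)).toBlocks₂₂.charpoly) :
    ∃ (K₁₂ : Matrix ρ σ ℝ) (K₂ : Matrix σ σ ℝ) (K : Matrix (Fin n) (Fin n) ℝ),
      c.form K = fromBlocks (fromBlocks 0 0 0 k) (fromRows 0 K₁₂) (fromRows 0 K₁₂)ᵀ K₂ ∧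
      K ∈ solARE A B Q ∧
      ∀ x₀, valueFunction A B Q L x₀ = ((x₀ ⬝ᵥ K *ᵥ x₀ : ℝ) : EReal) := by
  obtain ⟨K₀, hK₀⟩ := hneg
  have hctrl := isControllablePair_of_range hc
  have hA := sys_eq_fromBlocks hc
  have hB := inp_eq_fromRows hc
  have hA₂ := stable_of_isStabilizable hstab hc
  have hQs := c.form_isSymm hQ
  have hK₀' := c.form_mem_solARINeg hK₀
  have hz := fun x hx => mulVec_eq_zero_of_mem_undetectedSubspace (L₁ := restrictedTarget L c)
    (x := x) hA hB hQs hctrl hKm hK₀' hx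
  have hinv := fun x hx => mulVec_mem_undetectedSubspace (A₁ := (c.sys A).toBlocks₁₁)
    (B₁ := (c.inp B).toRows₁) (L₁ := restrictedTarget L c) (Km := Km) (x := x) hx
  obtain ⟨-, hKmneg⟩ := hKm.sub_posSemidef_and_neg hA hB hQs hctrl hK₀'
  set A' := c.sys A with hA'
  set Q' := c.form Q with hQ'
  set A₁ := A'.toBlocks₁₁ with hA₁
  set B₁ := (c.inp B).toRows₁ with hB₁
  set d := A₁.toBlocks₂₂ with hd
  set E := dropFirst π ρ σ with hE
  have hEE : E * Eᵀ = 1 := dropFirst_mul_transpose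
  set At := fromBlocks d A'.toBlocks₁₂.toRows₂ 0 A'.toBlocks₂₂ with hAt
  -- the quotient system
  have hkerA : ∀ v, E *ᵥ v = 0 → E *ᵥ (A' *ᵥ v) = 0 := fun v hv => by
    obtain ⟨x, hx, rfl⟩ := dropFirst_mulVec_eq_zero.mp hv
    rw [mulVec_elim_zero hA]
    exact dropFirst_mulVec_eq_zero.mpr ⟨_, hN ▸ hinv x (hN ▸ hx), rfl⟩
  have hEA : E * A' = At * E := by
    rw [quotient_intertwine hEE hkerA, selection_mul_mul_transpose]
    congr 1
    ext (i | i) (j | j)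
    · rfl
    · rfl
    · exact congrFun (congrFun (congrArg toBlocks₂₁ hA) i) (Sum.inr j)
    · rfl
  have hEB : E * c.inp B = fromRows B₁.toRows₂ 0 := by
    rw [selection_mul]
    ext (i | i) j
    · rfl
    · exact congrFun (congrFun (congrArg toRows₂ hB) i) j
  have hkerQ : ∀ v, E *ᵥ v = 0 → Q' *ᵥ v = 0 := fun v hv => by
    obtain ⟨x, hx, rfl⟩ := dropFirst_mulVec_eq_zero.mp hv
    exact (hz x (hN ▸ hx)).2
  have hkerK : ∀ v, E *ᵥ v = 0 → c.form K₀ *ᵥ v = 0 := fun v hv => by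
    obtain ⟨x, hx, rfl⟩ := dropFirst_mulVec_eq_zero.mp hv
    exact (hz x (hN ▸ hx)).1
  have hEQ := eq_quotient_form hEE hQs hkerQ
  set Qt := E * Q' * Eᵀ with hQt
  have hQts : Qt.IsSymm := quotient_form_isSymm hQs
  have hKt := mem_solARINeg_quotient hEE hEA hEQ hK₀' hkerK
  rw [hEB] at hKt
  have hd21 : A₁.toBlocks₂₁ = 0 := by
    ext i j
    have h1 : (Pi.single (Sum.inl j) 1 : π ⊕ ρ → ℝ) ∈ coordSubspace (Sum.inl : π → π ⊕ ρ) :=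
      Submodule.subset_span ⟨j, rfl⟩
    have h2 := hinv _ (hN ▸ h1)
    rw [hN, mem_coordSubspace_inl, mulVec_single_one] at h2
    exact congrFun h2 i
  have hstabd : HasStabilizer d B₁.toRows₂ := (hctrl.toBlocks₂₂ hd21).hasStabilizer
  have hstabt : HasStabilizer At (fromRows B₁.toRows₂ 0) := hasStabilizer_fromBlocks hstabd hA₂
  obtain ⟨Kt, -, hKt1, hKtmax, hKtst, -⟩ := exists_maximal_solution hQts hstabt ⟨_, hKt.1⟩
  -- the first block of the semistable solution of the quotient system
  obtain ⟨hKt2, hKt11, -⟩ := eq_fromBlocks_of_isSymm hKt1.1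
  obtain ⟨hQt2, hQt11, -⟩ := eq_fromBlocks_of_isSymm hQts
  set S : Matrix ρ (π ⊕ ρ) ℝ := selection Sum.inr with hS
  have hSS : S * Sᵀ = 1 := selection_mul_transpose Sum.inr_injective
  have hSblock : ∀ M : Matrix ρ ρ ℝ, Sᵀ * M * S = fromBlocks 0 0 0 M :=
    selection_inr_transpose_mul_mul
  -- Both matrices solve the Riccati equation of the controllable part of the quotient with
  -- semistable closed loop, hence both equal its maximal solution.
  have hkeq : Kt.toBlocks₁₁ = k := by
    have h1 : riccati d B₁.toRows₂ Qt.toBlocks₁₁ Kt.toBlocks₁₁ = 0 := by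
      have h0 := riccati_toBlocks₁₁ (A := At) (B := fromRows B₁.toRows₂ 0)
        (by rw [hAt]; simp) (by simp) hQts hKt1.1
      rw [hKt1.2] at h0
      exact h0.symm
    have h2 : RootsIn {z | z.re ≤ 0} (closedLoop d B₁.toRows₂ Kt.toBlocks₁₁).charpoly := by
      rw [hKt2, hAt, closedLoop_fromBlocks] at hKtst
      exact rootsIn_charpoly_of_fromBlocks hKtst
    have hSA : S * A₁ = d * S := by
      rw [quotient_intertwine hSS fun v hv => ?_, selection_mul_mul_transpose]
      · rfl
      · rw [selection_mulVec, ← mem_coordSubspace_inl, ← hN] at hv ⊢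
        exact hinv v hv
    have hSB : S * B₁ = B₁.toRows₂ := selection_mul _ _
    have hSQ : Q'.toBlocks₁₁ = Sᵀ * Qt.toBlocks₁₁ * S := by
      have h3 := congrArg toBlocks₁₁ hEQ
      rw [hQt2, dropFirst_transpose_mul_mul, toBlocks_fromBlocks₁₁] at h3
      rw [h3, hSblock]
    have h4 : k ∈ solARE d B₁.toRows₂ Qt.toBlocks₁₁ := by
      rw [← hSB]
      refine (mem_solARE_quotient hSS hSA hSQ).mp ?_
      rwa [hSblock]
    have h5 : (closedLoop A₁ B₁ (fromBlocks 0 0 0 k)).toBlocks₂₂ = closedLoop d B₁.toRows₂ k := by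
      have h6 : (closedLoop A₁ B₁ (fromBlocks 0 0 0 k)).toBlocks₂₂ =
          S * closedLoop A₁ B₁ (Sᵀ * k * S) * Sᵀ := by
        rw [selection_mul_mul_transpose, hSblock]
        rfl
      rw [h6, closedLoop, Matrix.mul_sub, Matrix.sub_mul, hSA, Matrix.mul_assoc d, hSS,
        Matrix.mul_one, closedLoop, ← hSB]
      congr 1
      simp only [transpose_mul, Matrix.mul_assoc, hSS, Matrix.mul_one]
    rw [h5] at hkst
    obtain ⟨Kp, -, hKp, hKpmax, -⟩ := exists_maximal_solution hQt11 hstabd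
      ⟨k, solARE_subset_solARI h4⟩
    rw [← eq_of_semistable hstabd h4 hkst hKp (hKpmax _ (solARE_subset_solARI h4)),
      ← eq_of_semistable hstabd ⟨hKt11, h1⟩ h2 hKp (hKpmax _ (solARE_subset_solARI ⟨hKt11, h1⟩))]
  rw [hkeq] at hKt2
  have hform : c.form (c.Tinvᵀ * (Eᵀ * Kt * E) * c.Tinv) = Eᵀ * Kt * E := c.form_Tinv _
  refine ⟨Kt.toBlocks₁₂, Kt.toBlocks₂₂, c.Tinvᵀ * (Eᵀ * Kt * E) * c.Tinv, ?_, ?_, fun x₀ => ?_⟩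
  · rw [hform, hKt2, dropFirst_transpose_mul_mul]
    simp
  · rw [← c.mem_solARE_iff, hform, mem_solARE_quotient hEE hEA hEQ, hEB]
    exact hKt1
  · have hEG : E * c.Tinv * (c.T * Eᵀ) = 1 := by
      rw [Matrix.mul_assoc, ← Matrix.mul_assoc c.Tinv, c.Tinv_mul_T, Matrix.one_mul, hEE]
    have hEA' : E * c.Tinv * A = At * (E * c.Tinv) := by
      rw [Matrix.mul_assoc, c.Tinv_mul, ← Matrix.mul_assoc, ← hA', hEA, Matrix.mul_assoc]
    have hEB' : E * c.Tinv * B = fromRows B₁.toRows₂ 0 := by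
      rw [Matrix.mul_assoc, ← hEB, CoordChange.inp]
    have hcong : ∀ M : Matrix (ρ ⊕ σ) (ρ ⊕ σ) ℝ,
        (E * c.Tinv)ᵀ * M * (E * c.Tinv) = c.Tinvᵀ * (Eᵀ * M * E) * c.Tinv :=
      fun M => by simp only [transpose_mul, Matrix.mul_assoc]
    have hQ'' : (E * c.Tinv)ᵀ * Qt * (E * c.Tinv) = Q := by
      rw [hcong, ← hEQ, hQ', c.Tinv_form]
    have hTL : ∀ v, E *ᵥ v = 0 → c.T *ᵥ v ∈ L := fun v hv => by
      obtain ⟨x, hx, rfl⟩ := dropFirst_mulVec_eq_zero.mp hv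
      rw [T_mulVec_elim]
      exact undetectedSubspace_le (L₁ := restrictedTarget L c) (hN ▸ hx)
    have hval := valueFunction_eq_of_reduction (A := A) (B := B) (L := L) (K := Kt)
      (K₀ := E * c.form K₀ * Eᵀ) hEG hEA' hQts (fun x hx => ?_) (hEB' ▸ hstabt) (hEB' ▸ hKt1)
      (hEB' ▸ hKtst) (hEB' ▸ hKt) (fun y hy hy0 => ?_) x₀
    · rw [hQ'', hcong] at hval
      exact hval
    · have h1 := hTL (c.Tinv *ᵥ x) (by rw [mulVec_mulVec]; exact hx)
      rwa [c.T_mulVec_Tinv_mulVec] at h1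
    · -- an antistable motion of the quotient system comes from an undetected motion
      set R : Matrix σ (ρ ⊕ σ) ℝ := fromCols 0 1 with hR
      have hπ : A'.toBlocks₂₂ * R = R * At := by
        rw [hAt, hR, fromCols_mul_fromBlocks, mul_fromCols]
        simp
      -- The uncontrollable component of an antistable motion is antistable and stable at once.
      have h1 : y ∘ Sum.inr = 0 := by
        have h2 := (hy.map hπ).eq_zero (spectrallyIn_of_charpoly hA₂ _)
          (disjoint_pos_nonpos.mono_right fun z (hz : z.re < 0) => hz.le)
        simpa [hR, fromCols_mulVec] using h2
      set z : π ⊕ ρ → ℝ := Sum.elim 0 (y ∘ Sum.inl) with hzdef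
      set J : Matrix ((π ⊕ ρ) ⊕ σ) (π ⊕ ρ) ℝ := fromRows 1 0 with hJ
      have hJv : ∀ v, J *ᵥ v = Sum.elim v 0 := fun v => by
        rw [hJ, fromRows_mulVec, one_mulVec, zero_mulVec]
      have hAJ : A' * J = J * A₁ := by
        rw [hA, hJ, fromBlocks_mul_fromRows, fromRows_mul]
        simp
      have hEJ : At * (E * J) = E * J * A₁ := by
        rw [← Matrix.mul_assoc, ← hEA, Matrix.mul_assoc, hAJ, Matrix.mul_assoc]
      have hEJz : (E * J) *ᵥ z = y := by
        rw [← mulVec_mulVec, hJv, selection_mulVec]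
        ext (i | i)
        · rfl
        · exact (congrFun h1 i).symm
      have hlift : ∀ p : ℝ[X], aeval At p *ᵥ y = E *ᵥ Sum.elim (aeval A₁ p *ᵥ z) 0 := fun p => by
        rw [← hEJz, mulVec_mulVec, aeval_intertwine hEJ, ← mulVec_mulVec, ← mulVec_mulVec, hJv]
      -- A polynomial killing `y` sends the lift `z` into the undetected subspace. That subspace is
      -- itself antistable, so one more factor kills `z`.
      have hspec : SpectrallyIn {z | 0 < z.re} A₁ z := by
        obtain ⟨p, hp, hpy⟩ := hy
        rw [hlift, dropFirst_mulVec_eq_zero] at hpy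
        obtain ⟨w, hw, hpw⟩ := hpy
        have h3 : aeval A₁ p *ᵥ z = w := congrArg (· ∘ Sum.inl) hpw
        obtain ⟨q, hq, hqw⟩ := undetectedSubspace_spectrallyIn' (hN ▸ hw)
        exact ⟨q * p, hq.mul hp, by rw [aeval_mul_mulVec, h3, hqw]⟩
      have hzN : z ∈ undetectedSubspace A₁ B₁ (restrictedTarget L c) Km := by
        refine mem_undetectedSubspace_of_spectrallyIn hKm.1 hKmneg hspec fun k => ?_
        obtain ⟨-, h3, h4⟩ := hy0 k
        have h5 := hlift (X ^ k)
        rw [map_pow, map_pow, aeval_X, aeval_X] at h5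
        rw [h5] at h3 h4
        set w : (π ⊕ ρ) ⊕ σ → ℝ := Sum.elim ((A₁ ^ k) *ᵥ z) 0 with hw
        constructor
        · have h6 := hTL _ (mulVec_sub_transpose_mulVec hEE w)
          rw [mulVec_sub] at h6
          rw [← mulVec_mulVec] at h4
          have h7 := L.add_mem h6 h4
          rw [sub_add_cancel, hw, T_mulVec_elim] at h7
          exact h7
        · have h6 : Q' *ᵥ w = 0 := by
            rw [hEQ, ← mulVec_mulVec, ← mulVec_mulVec, h3, mulVec_zero]
          rw [← fromBlocks_toBlocks Q', hw, fromBlocks_mulVec] at h6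
          have h7 := congrArg (· ∘ Sum.inl) h6
          simpa [Function.comp_def, ← Pi.zero_def] using! h7
      rw [hN, mem_coordSubspace_inl] at hzN
      rw [← hEJz, ← mulVec_mulVec, hJv, selection_mulVec]
      ext (i | i)
      · exact congrFun hzN i
      · rfl

end Core

/-! ### The block structure of the projected solution -/

section Structure

variable {ι κ : Type} [Fintype ι] [DecidableEq ι] [Fintype κ] [DecidableEq κ]

lemma single_mem_coordSubspace (e : κ → ι) (k : κ) : Pi.single (e k) 1 ∈ coordSubspace e :=
  Submodule.subset_span ⟨k, rfl⟩

lemma apply_eq_zero_of_spectralSubspace {R : Set ℂ} (hR : IsVertical R) {M : Matrix ι ι ℝ}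
    {e : κ → ι} (h : spectralSubspace R M = coordSubspace e) {i : ι} (hi : i ∉ Set.range e) (k : κ) :
    M i (e k) = 0 := by
  have h1 := single_mem_coordSubspace e k
  rw [← h, mem_spectralSubspace hR] at h1
  have h2 := (mem_spectralSubspace hR M _).mpr h1.mulVec
  rw [h, mem_coordSubspace, mulVec_single_one] at h2
  exact h2 i hi

/-- The coordinate subspace is invariant, so its inclusion intertwines the diagonal block with `M`.
-/
lemma rootsIn_charpoly_submatrix {R : Set ℂ} (hR : IsVertical R) {M : Matrix ι ι ℝ} {e : κ → ι}
    (he : Function.Injective e) (h : spectralSubspace R M = coordSubspace e) :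
    RootsIn R (M.submatrix e e).charpoly := by
  have h1 : M * (selection e)ᵀ = (selection e)ᵀ * M.submatrix e e := by
    rw [mul_selection_transpose]
    ext i j
    rw [Matrix.mul_apply]
    by_cases hi : i ∈ Set.range e
    · obtain ⟨k, rfl⟩ := hi
      simp [selection, one_apply, he.eq_iff]
    · have h2 : ∀ k, e k ≠ i := fun k hk => hi ⟨k, hk⟩
      simp [selection, h2, apply_eq_zero_of_spectralSubspace hR h hi j]
  refine rootsIn_charpoly_of_forall fun y => ?_
  have h2 : (selection e)ᵀ *ᵥ y ∈ coordSubspace e := by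
    rw [mem_coordSubspace]
    intro i hi
    have h3 : ∀ k, e k ≠ i := fun k hk => hi ⟨k, hk⟩
    simp [mulVec, dotProduct, selection, h3]
  rw [← h, mem_spectralSubspace hR] at h2
  obtain ⟨p, hp, hpy⟩ := h2
  refine ⟨p, hp, ?_⟩
  rw [mulVec_mulVec, aeval_intertwine h1, ← mulVec_mulVec] at hpy
  have h3 := congrArg (selection e *ᵥ ·) hpy
  simpa only [mulVec_mulVec, ← Matrix.mul_assoc, selection_mul_transpose he, Matrix.one_mul,
    mulVec_zero] using h3

variable {m : ℕ} {π ρ σ : Type} [Fintype π] [DecidableEq π] [Fintype ρ] [DecidableEq ρ]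
  [Fintype σ] [DecidableEq σ]

lemma eq_fromBlocks_of_spectralSubspace {M : Matrix (π ⊕ ρ ⊕ σ) (π ⊕ ρ ⊕ σ) ℝ}
    (hpos : specPos M = coordSubspace Sum.inl) (hzero : specZero M = coordSubspace (Sum.inr ∘ Sum.inl))
    (hneg : specNeg M = coordSubspace (Sum.inr ∘ Sum.inr)) :
    M = fromBlocks M.toBlocks₁₁ 0 0
      (fromBlocks M.toBlocks₂₂.toBlocks₁₁ 0 0 M.toBlocks₂₂.toBlocks₂₂) := by
  have h1 := fun i hi k => apply_eq_zero_of_spectralSubspace isVertical_pos hpos (i := i) hi k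
  have h2 := fun i hi k => apply_eq_zero_of_spectralSubspace isVertical_zero hzero (i := i) hi k
  have h3 := fun i hi k => apply_eq_zero_of_spectralSubspace isVertical_neg hneg (i := i) hi k
  ext (i | i | i) (j | j | j)
  · rfl
  · exact h2 _ (by simp) j
  · exact h3 _ (by simp) j
  · exact h1 _ (by simp) j
  · rfl
  · exact h3 _ (by simp) j
  · exact h1 _ (by simp) j
  · exact h2 _ (by simp) j
  · rfl

lemma rootsIn_charpoly_toBlocks₂₂ {M : Matrix (π ⊕ ρ ⊕ σ) (π ⊕ ρ ⊕ σ) ℝ}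
    (hpos : specPos M = coordSubspace Sum.inl) (hzero : specZero M = coordSubspace (Sum.inr ∘ Sum.inl))
    (hneg : specNeg M = coordSubspace (Sum.inr ∘ Sum.inr)) :
    RootsIn {z | z.re = 0} M.toBlocks₂₂.toBlocks₁₁.charpoly ∧
      RootsIn {z | z.re < 0} M.toBlocks₂₂.toBlocks₂₂.charpoly ∧
      RootsIn {z | z.re ≤ 0} M.toBlocks₂₂.charpoly := by
  have h1 : RootsIn {z | z.re = 0} M.toBlocks₂₂.toBlocks₁₁.charpoly :=
    rootsIn_charpoly_submatrix (M := M) (e := Sum.inr ∘ Sum.inl) isVertical_zero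
      (Sum.inr_injective.comp Sum.inl_injective) hzero
  have h2 : RootsIn {z | z.re < 0} M.toBlocks₂₂.toBlocks₂₂.charpoly :=
    rootsIn_charpoly_submatrix (M := M) (e := Sum.inr ∘ Sum.inr) isVertical_neg
      (Sum.inr_injective.comp Sum.inr_injective) hneg
  refine ⟨h1, h2, ?_⟩
  have h3 := congrArg Matrix.toBlocks₂₂ (eq_fromBlocks_of_spectralSubspace hpos hzero hneg)
  rw [toBlocks_fromBlocks₂₂] at h3
  rw [h3]
  exact rootsIn_charpoly_fromBlocks (h1.mono fun z (hz : z.re = 0) => hz.le)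
    (h2.mono fun z (hz : z.re < 0) => hz.le)

/-- Column by column: on the antistable part the solution acts as `Km`, which vanishes there; on the
neutral part `Km` and `Kp` agree; on the stable part it acts as `Kp`. Symmetry fills in the
remaining entries. -/
lemma projectedSolution_eq_fromBlocks {A Q Km Kp P : Matrix (π ⊕ ρ ⊕ σ) (π ⊕ ρ ⊕ σ) ℝ}
    {B : Matrix (π ⊕ ρ ⊕ σ) (Fin m) ℝ} {N : Submodule ℝ (π ⊕ ρ ⊕ σ → ℝ)}
    (hP : IsProjectionAlong P N ((orthComplement N).comap (Kp - Km).mulVecLin))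
    (hm : Km ∈ solARE A B Q) (hp : Kp ∈ solARE A B Q) (hgap : (Kp - Km).PosSemidef)
    (hstab : HasStabilizer (-A) B)
    (hN : ∀ x ∈ N, closedLoop A B Km *ᵥ x ∈ N)
    (hNpos : ∀ x ∈ N, SpectrallyIn {z | 0 < z.re} (closedLoop A B Km) x)
    (hKmN : ∀ x ∈ N, Km *ᵥ x = 0) (hNc : N = coordSubspace Sum.inl)
    (hzero : specZero (closedLoop A B (projectedSolution Km Kp P)) =
      coordSubspace (Sum.inr ∘ Sum.inl))
    (hneg : specNeg (closedLoop A B (projectedSolution Km Kp P)) =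
      coordSubspace (Sum.inr ∘ Sum.inr)) :
    projectedSolution Km Kp P = fromBlocks 0 0 0
      (fromBlocks Km.toBlocks₂₂.toBlocks₁₁ Km.toBlocks₂₂.toBlocks₁₂ Km.toBlocks₂₂.toBlocks₁₂ᵀ
        Kp.toBlocks₂₂.toBlocks₂₂) := by
  have hs := projectedSolution_isSymm hP hm.1 hp.1
  have h1 : ∀ i j, projectedSolution Km Kp P i (Sum.inl j) = 0 := fun i j => by
    have hj : Pi.single (Sum.inl j) 1 ∈ N := hNc ▸ single_mem_coordSubspace Sum.inl j
    have h2 := projectedSolution_mulVec (Km := Km) (Kp := Kp) (P := P) (Pi.single (Sum.inl j) 1)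
    rw [hP.apply_left _ hj, hKmN _ hj, sub_self, mulVec_zero, add_zero, mulVec_single_one] at h2
    exact congrFun h2 i
  have h2 : ∀ i j, projectedSolution Km Kp P i (Sum.inr (Sum.inl j)) = Km i (Sum.inr (Sum.inl j)) :=
    fun i j => by
    have hj := single_mem_coordSubspace (Sum.inr ∘ Sum.inl : ρ → π ⊕ ρ ⊕ σ) j
    rw [← hzero, specZero, mem_spectralSubspace isVertical_zero] at hj
    have h3 := projectedSolution_mulVec_right hP
      (mem_right_of_spectrallyIn hP hm hp hN hNpos (hj.mono fun z (hz : z.re = 0) => hz.le)).1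
    have h4 := gap_mulVec_eq_zero_of_neutral hP hm hp hgap hstab hN hNpos hj
    rw [sub_mulVec, sub_eq_zero] at h4
    rw [h4, mulVec_single_one, mulVec_single_one] at h3
    exact congrFun h3 i
  have h3 : ∀ i j, projectedSolution Km Kp P i (Sum.inr (Sum.inr j)) = Kp i (Sum.inr (Sum.inr j)) :=
    fun i j => by
    have hj := single_mem_coordSubspace (Sum.inr ∘ Sum.inr : σ → π ⊕ ρ ⊕ σ) j
    rw [← hneg, specNeg, mem_spectralSubspace isVertical_neg] at hj
    have h3 := projectedSolution_mulVec_right hP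
      (mem_right_of_spectrallyIn hP hm hp hN hNpos (hj.mono fun z (hz : z.re < 0) => hz.le)).1
    rw [mulVec_single_one, mulVec_single_one] at h3
    exact congrFun h3 i
  ext (i | i) (j | j)
  · exact h1 _ j
  · rw [← hs.apply]
    exact h1 _ i
  · exact h1 _ j
  · rcases i with i | i <;> rcases j with j | j
    · exact h2 _ j
    · rw [← hs.apply, h2, hm.1.apply]
      rfl
    · rw [h2, ← hm.1.apply]
      rfl
    · exact h3 _ j

end Structure

/-! ### Consequences of adapted coordinates. -/

section AdaptedFacts

variable {n m p q r s : ℕ} {A Q : Matrix (Fin n) (Fin n) ℝ} {B : Matrix (Fin n) (Fin m) ℝ}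
  {L X₂ : Submodule ℝ (Fin n → ℝ)} {c : CoordChange n ((Fin p ⊕ Fin q ⊕ Fin r) ⊕ Fin s)}
  {Km Kp P : Matrix (Fin p ⊕ Fin q ⊕ Fin r) (Fin p ⊕ Fin q ⊕ Fin r) ℝ}

lemma IsAdapted.undetectedSubspace_eq (h : IsAdapted A B Q L X₂ c Km Kp P) (hQ : Q.IsSymm) :
    undetectedSubspace (c.sys A).toBlocks₁₁ (c.inp B).toRows₁ (restrictedTarget L c) Km =
      coordSubspace Sum.inl := by
  have hctrl := isControllablePair_of_range h.range_first
  have hQ₁ := (eq_fromBlocks_of_isSymm (c.form_isSymm hQ)).2.1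
  rw [← h.antistable]
  exact (specPos_projectedSolution h.projection h.minimal.1 h.maximal.1
    (h.maximal.semistable hQ₁ hctrl.hasStabilizer).1
    (fun _ => closedLoop_mem_undetectedSubspace) (fun _ => undetectedSubspace_spectrallyIn)).symm

lemma IsAdapted.projectedSolution_eq (h : IsAdapted A B Q L X₂ c Km Kp P) (hQ : Q.IsSymm) :
    projectedSolution Km Kp P = fromBlocks 0 0 0
      (fromBlocks Km.toBlocks₂₂.toBlocks₁₁ Km.toBlocks₂₂.toBlocks₁₂ Km.toBlocks₂₂.toBlocks₁₂ᵀ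
        Kp.toBlocks₂₂.toBlocks₂₂) := by
  have hctrl := isControllablePair_of_range h.range_first
  exact projectedSolution_eq_fromBlocks h.projection h.minimal.1 h.maximal.1
    (h.maximal.2 _ h.minimal.1) hctrl.neg.hasStabilizer
    (fun _ => closedLoop_mem_undetectedSubspace) (fun _ => undetectedSubspace_spectrallyIn)
    (fun _ => undetectedSubspace_mulVec_eq_zero) (h.undetectedSubspace_eq hQ) h.neutral h.stable

lemma IsAdapted.exists_valueFunction (h : IsAdapted A B Q L X₂ c Km Kp P) (hQ : Q.IsSymm)
    (hstab : IsStabilizable A B) (hneg : (solARINeg A B Q).Nonempty) :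
    ∃ (K₁₂ : Matrix (Fin q ⊕ Fin r) (Fin s) ℝ) (K₂ : Matrix (Fin s) (Fin s) ℝ)
      (K : Matrix (Fin n) (Fin n) ℝ),
      c.form K = fromBlocks (projectedSolution Km Kp P) (fromRows 0 K₁₂) (fromRows 0 K₁₂)ᵀ K₂ ∧
      K ∈ solARE A B Q ∧
      ∀ x₀, valueFunction A B Q L x₀ = ((x₀ ⬝ᵥ K *ᵥ x₀ : ℝ) : EReal) := by
  have hQ₁ := (eq_fromBlocks_of_isSymm (c.form_isSymm hQ)).2.1
  have hbar := h.projectedSolution_eq hQ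
  have hmem := projectedSolution_mem_solARE h.projection hQ₁ h.minimal.1 h.maximal.1
    (fun _ => closedLoop_mem_undetectedSubspace)
  have hst := (rootsIn_charpoly_toBlocks₂₂ h.antistable h.neutral h.stable).2.2
  rw [hbar] at hmem hst ⊢
  exact exists_form_valueFunction hQ hstab hneg h.range_first h.minimal
    (h.undetectedSubspace_eq hQ) hmem hst

end AdaptedFacts

/-! ### The block equations -/

section BlockEquations

lemma sylvester_iff {ι κ : Type} [Fintype ι] [DecidableEq ι] [Fintype κ] [DecidableEq κ]
    {R S : Set ℂ} {M : Matrix ι ι ℝ} {N : Matrix κ κ ℝ} (hM : RootsIn R M.charpoly)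
    (hN : RootsIn S N.charpoly) (hRS : ∀ z ∈ R, ∀ w ∈ S, z + w ≠ 0) {T Y₀ : Matrix ι κ ℝ}
    (h : Mᵀ * Y₀ + Y₀ * N = T) (Y : Matrix ι κ ℝ) : Mᵀ * Y + Y * N = T ↔ Y = Y₀ := by
  obtain ⟨Y₁, hY₁⟩ := existsUnique_sylvester (rootsIn_charpoly_transpose.mpr hM) hN hRS T
  rw [hY₁, (hY₁ Y₀).mp h]

variable {n m p q r s : ℕ} {A Q K : Matrix (Fin n) (Fin n) ℝ} {B : Matrix (Fin n) (Fin m) ℝ}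
  {L X₂ : Submodule ℝ (Fin n → ℝ)} {c : CoordChange n ((Fin p ⊕ Fin q ⊕ Fin r) ⊕ Fin s)}
  {Km Kp P : Matrix (Fin p ⊕ Fin q ⊕ Fin r) (Fin p ⊕ Fin q ⊕ Fin r) ℝ}

/-- The Riccati equation in adapted coordinates, block by block. -/
lemma IsAdapted.block_equations (h : IsAdapted A B Q L X₂ c Km Kp P) (hQ : Q.IsSymm)
    (hstab : IsStabilizable A B) (hK : K ∈ solARE A B Q)
    {K₁₂₂ : Matrix (Fin q) (Fin s) ℝ} {K₁₂₃ : Matrix (Fin r) (Fin s) ℝ}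
    {K₂ : Matrix (Fin s) (Fin s) ℝ}
    (hform : c.form K = fromBlocks (projectedSolution Km Kp P)
      (fromRows 0 (fromRows K₁₂₂ K₁₂₃)) (fromRows 0 (fromRows K₁₂₂ K₁₂₃))ᵀ K₂) :
    let A₁ := (c.sys A).toBlocks₁₁
    let A₁₂ := (c.sys A).toBlocks₁₂
    let A₂ := (c.sys A).toBlocks₂₂
    let B₁ := (c.inp B).toRows₁
    let Q₁₂ := (c.form Q).toBlocks₁₂
    let Q₂ := (c.form Q).toBlocks₂₂
    let Kbar := projectedSolution Km Kp P
    let Abar₂₂ := (closedLoop A₁ B₁ Kbar).toBlocks₂₂.toBlocks₁₁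
    let Abar₃₃ := (closedLoop A₁ B₁ Kbar).toBlocks₂₂.toBlocks₂₂
    let Km₂₂ := Km.toBlocks₂₂.toBlocks₁₁
    let Km₂₃ := Km.toBlocks₂₂.toBlocks₁₂
    let Kp₃₃ := Kp.toBlocks₂₂.toBlocks₂₂
    let K₁₂ : Matrix (Fin p ⊕ Fin q ⊕ Fin r) (Fin s) ℝ := fromRows 0 (fromRows K₁₂₂ K₁₂₃)
    (∀ X : Matrix (Fin q) (Fin s) ℝ,
      Abar₂₂ᵀ * X + X * A₂ =
          -(Q₁₂.toRows₂.toRows₁ + Km₂₂ * A₁₂.toRows₂.toRows₁ + Km₂₃ * A₁₂.toRows₂.toRows₂) ↔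
        X = K₁₂₂) ∧
    (∀ X : Matrix (Fin r) (Fin s) ℝ,
      Abar₃₃ᵀ * X + X * A₂ =
          -(Q₁₂.toRows₂.toRows₂ + Km₂₃ᵀ * A₁₂.toRows₂.toRows₁ + Kp₃₃ * A₁₂.toRows₂.toRows₂) ↔
        X = K₁₂₃) ∧
    (∀ X : Matrix (Fin s) (Fin s) ℝ,
      A₂ᵀ * X + X * A₂ = K₁₂ᵀ * B₁ * B₁ᵀ * K₁₂ - K₁₂ᵀ * A₁₂ - A₁₂ᵀ * K₁₂ - Q₂ ↔ X = K₂) := by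
  intro A₁ A₁₂ A₂ B₁ Q₁₂ Q₂ Kbar Abar₂₂ Abar₃₃ Km₂₂ Km₂₃ Kp₃₃ K₁₂
  have hA₂ : RootsIn {z | z.re < 0} A₂.charpoly := stable_of_isStabilizable hstab h.range_first
  obtain ⟨hr₂₂, hr₃₃, -⟩ := rootsIn_charpoly_toBlocks₂₂ h.antistable h.neutral h.stable
  have hKs : Kbar.IsSymm := projectedSolution_isSymm h.projection h.minimal.1.1 h.maximal.1.1
  have hric := (c.mem_solARE_iff.mpr hK).2
  rw [hform, sys_eq_fromBlocks h.range_first, inp_eq_fromRows h.range_first,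
    (eq_fromBlocks_of_isSymm (c.form_isSymm hQ)).1, riccati_fromBlocks _ _ _ _ _ _ _ hKs,
    ← fromBlocks_zero, fromBlocks_inj] at hric
  obtain ⟨-, h₁₂, -, h₂₂⟩ := hric
  have hAbar : closedLoop A₁ B₁ Kbar = fromBlocks (closedLoop A₁ B₁ Kbar).toBlocks₁₁ 0 0
      (fromBlocks Abar₂₂ 0 0 Abar₃₃) :=
    eq_fromBlocks_of_spectralSubspace h.antistable h.neutral h.stable
  have hKbar : Kbar = fromBlocks 0 0 0 (fromBlocks Km₂₂ Km₂₃ Km₂₃ᵀ Kp₃₃) := h.projectedSolution_eq hQ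
  have hA₁₂ : A₁₂ = fromRows A₁₂.toRows₁ (fromRows A₁₂.toRows₂.toRows₁ A₁₂.toRows₂.toRows₂) := by
    rw [fromRows_toRows, fromRows_toRows]
  have e₁ : (closedLoop A₁ B₁ Kbar)ᵀ * K₁₂ =
      fromRows 0 (fromRows (Abar₂₂ᵀ * K₁₂₂) (Abar₃₃ᵀ * K₁₂₃)) := by
    rw [hAbar]
    simp [K₁₂, fromBlocks_transpose, fromBlocks_mul_fromRows]
  have e₂ : K₁₂ * A₂ = fromRows 0 (fromRows (K₁₂₂ * A₂) (K₁₂₃ * A₂)) := by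
    simp [K₁₂, fromRows_mul]
  have e₃ : Kbar * A₁₂ = fromRows 0 (fromRows
      (Km₂₂ * A₁₂.toRows₂.toRows₁ + Km₂₃ * A₁₂.toRows₂.toRows₂)
      (Km₂₃ᵀ * A₁₂.toRows₂.toRows₁ + Kp₃₃ * A₁₂.toRows₂.toRows₂)) := by
    rw [hKbar]
    conv_lhs => rw [hA₁₂, fromBlocks_mul_fromRows, fromBlocks_mul_fromRows]
    simp only [Matrix.zero_mul, zero_add]
  change (closedLoop A₁ B₁ Kbar)ᵀ * K₁₂ + K₁₂ * A₂ + (Q₁₂ + Kbar * A₁₂) = 0 at h₁₂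
  rw [e₁, e₂, e₃] at h₁₂
  -- Solvability is unique because a neutral or stable eigenvalue plus a stable one is never zero.
  refine ⟨sylvester_iff hr₂₂ hA₂ (fun z (hz : z.re = 0) w (hw : w.re < 0) h0 => ?_) ?_,
    sylvester_iff hr₃₃ hA₂ (fun z (hz : z.re < 0) w (hw : w.re < 0) h0 => ?_) ?_,
    sylvester_iff hA₂ hA₂ (fun z (hz : z.re < 0) w (hw : w.re < 0) h0 => ?_) ?_⟩
  · have := congrArg Complex.re h0
    rw [Complex.add_re, Complex.zero_re] at this
    linarith
  · ext i j
    have h1 := congrFun (congrFun h₁₂ (Sum.inr (Sum.inl i))) j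
    simp only [Matrix.add_apply, fromRows_apply_inr, fromRows_apply_inl, Matrix.zero_apply] at h1
    simp only [Matrix.add_apply, Matrix.neg_apply]
    change _ + _ + (Q₁₂.toRows₂.toRows₁ i j + _) = 0 at h1
    linarith
  · have := congrArg Complex.re h0
    rw [Complex.add_re, Complex.zero_re] at this
    linarith
  · ext i j
    have h1 := congrFun (congrFun h₁₂ (Sum.inr (Sum.inr i))) j
    simp only [Matrix.add_apply, fromRows_apply_inr, Matrix.zero_apply] at h1
    simp only [Matrix.add_apply, Matrix.neg_apply]
    change _ + _ + (Q₁₂.toRows₂.toRows₂ i j + _) = 0 at h1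
    linarith
  · have := congrArg Complex.re h0
    rw [Complex.add_re, Complex.zero_re] at this
    linarith
  · exact sub_eq_zero.mp h₂₂

end BlockEquations

/-! ### Existence of adapted coordinates -/

namespace CoordChange

variable {n m : ℕ} {κ : Type} [Fintype κ] [DecidableEq κ] (c : CoordChange n κ)
  {A Q K Km Kp P : Matrix (Fin n) (Fin n) ℝ} {B : Matrix (Fin n) (Fin m) ℝ}

/-- The change of coordinates given by a basis. -/
noncomputable def ofBasis (b : Module.Basis κ ℝ (Fin n → ℝ)) : CoordChange n κ where
  T := (Pi.basisFun ℝ (Fin n)).toMatrix b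
  Tinv := b.toMatrix (Pi.basisFun ℝ (Fin n))
  T_mul_Tinv := Module.Basis.toMatrix_mul_toMatrix_flip _ _
  Tinv_mul_T := Module.Basis.toMatrix_mul_toMatrix_flip _ _

lemma ofBasis_T_mulVec_single (b : Module.Basis κ ℝ (Fin n → ℝ)) (k : κ) :
    (ofBasis b).T *ᵥ Pi.single k 1 = b k := by
  rw [mulVec_single_one]
  ext i
  simp [ofBasis, Module.Basis.toMatrix_apply]

lemma closedLoop_form :
    closedLoop (c.sys A) (c.inp B) (c.form K) = c.sys (closedLoop A B K) := by
  have h : (c.inp B)ᵀ * c.form K = Bᵀ * K * c.T := by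
    have h : c.Tinvᵀ * c.Tᵀ = 1 := by rw [← transpose_mul, c.T_mul_Tinv, transpose_one]
    simp only [inp, form, transpose_mul, Matrix.mul_assoc]
    rw [← Matrix.mul_assoc c.Tinvᵀ, h, Matrix.one_mul]
  rw [closedLoop, Matrix.mul_assoc, h, closedLoop, sys, sys, inp, Matrix.mul_sub, Matrix.sub_mul]
  simp only [Matrix.mul_assoc]

lemma T_mul_sys : A * c.T = c.T * c.sys A := by
  rw [sys, ← Matrix.mul_assoc, ← Matrix.mul_assoc, c.T_mul_Tinv, Matrix.one_mul]

lemma T_mulVec_sys_pow (k : ℕ) (y : κ → ℝ) :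
    c.T *ᵥ ((c.sys A ^ k) *ᵥ y) = (A ^ k) *ᵥ (c.T *ᵥ y) := by
  induction k with
  | zero => simp
  | succ k ih =>
    rw [pow_succ', pow_succ', ← mulVec_mulVec, ← mulVec_mulVec, ← ih, mulVec_mulVec, ← T_mul_sys,
      ← mulVec_mulVec]

lemma spectrallyIn_sys {R : Set ℂ} {y : κ → ℝ} :
    SpectrallyIn R (c.sys A) y ↔ SpectrallyIn R A (c.T *ᵥ y) := by
  refine ⟨fun h => h.map c.T_mul_sys, fun h => ?_⟩
  have := h.map (Y := c.Tinv) c.Tinv_mul.symm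
  rwa [c.Tinv_mulVec_T_mulVec] at this

lemma form_mulVec_eq_zero {y : κ → ℝ} : c.form K *ᵥ y = 0 ↔ K *ᵥ (c.T *ᵥ y) = 0 := by
  rw [form, Matrix.mul_assoc, ← mulVec_mulVec, ← mulVec_mulVec]
  refine ⟨fun h => ?_, fun h => by rw [h, mulVec_zero]⟩
  have := congrArg (c.Tinvᵀ *ᵥ ·) h
  rwa [mulVec_mulVec, ← transpose_mul, c.T_mul_Tinv, transpose_one, one_mulVec, mulVec_zero] at this

lemma exists_form_eq (S : Matrix κ κ ℝ) : ∃ K, c.form K = S := ⟨_, c.form_Tinv S⟩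

lemma form_sub (K K' : Matrix (Fin n) (Fin n) ℝ) : c.form (K - K') = c.form K - c.form K' := by
  simp only [form, Matrix.mul_sub, Matrix.sub_mul]

lemma isMinimalElement_form (h : IsMinimalElement (solARE A B Q) K) :
    IsMinimalElement (solARE (c.sys A) (c.inp B) (c.form Q)) (c.form K) := by
  refine ⟨c.mem_solARE_iff.mpr h.1, fun S hS => ?_⟩
  obtain ⟨S, rfl⟩ := c.exists_form_eq S
  rw [← form_sub]
  exact c.form_posSemidef (h.2 S (c.mem_solARE_iff.mp hS))

lemma isMaximalElement_form (h : IsMaximalElement (solARE A B Q) K) :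
    IsMaximalElement (solARE (c.sys A) (c.inp B) (c.form Q)) (c.form K) := by
  refine ⟨c.mem_solARE_iff.mpr h.1, fun S hS => ?_⟩
  obtain ⟨S, rfl⟩ := c.exists_form_eq S
  rw [← form_sub]
  exact c.form_posSemidef (h.2 S (c.mem_solARE_iff.mp hS))

lemma undetectedSubspace_comap (L₁ : Submodule ℝ (Fin n → ℝ)) :
    undetectedSubspace (c.sys A) (c.inp B) (L₁.comap c.T.mulVecLin) (c.form Km) =
      (undetectedSubspace A B L₁ Km).comap c.T.mulVecLin := by
  ext y
  simp only [Submodule.mem_comap, mulVecLin_apply, mem_undetectedSubspace, closedLoop_form,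
    spectrallyIn_sys, form_mulVec_eq_zero, T_mulVec_sys_pow]

lemma comap_orthComplement (N : Submodule ℝ (Fin n → ℝ)) :
    (orthComplement (N.comap c.T.mulVecLin)).comap (c.form K).mulVecLin =
      ((orthComplement N).comap K.mulVecLin).comap c.T.mulVecLin := by
  ext y
  simp only [Submodule.mem_comap, mulVecLin_apply, mem_orthComplement, form_mulVec_dotProduct]
  refine ⟨fun h v hv => ?_, fun h v hv => h _ hv⟩
  have := h (c.Tinv *ᵥ v)
  rw [T_mulVec_Tinv_mulVec] at this
  exact this hv

lemma isProjectionAlong_sys {V W : Submodule ℝ (Fin n → ℝ)} (h : IsProjectionAlong P V W) :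
    IsProjectionAlong (c.sys P) (V.comap c.T.mulVecLin) (W.comap c.T.mulVecLin) := by
  have hs : ∀ y, c.sys P *ᵥ y = c.Tinv *ᵥ (P *ᵥ (c.T *ᵥ y)) := fun y => by
    rw [sys, ← mulVec_mulVec, ← mulVec_mulVec]
  have h1 : ∀ v ∈ V.comap c.T.mulVecLin, c.sys P *ᵥ v = v := fun v hv => by
    rw [hs, h.apply_left (c.T *ᵥ v) hv, Tinv_mulVec_T_mulVec]
  have h2 : ∀ w ∈ W.comap c.T.mulVecLin, c.sys P *ᵥ w = 0 := fun w hw => by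
    rw [hs, h.apply_right (c.T *ᵥ w) hw, mulVec_zero]
  refine ⟨⟨Submodule.disjoint_def.mpr fun x hx hx' => by rw [← h1 x hx, h2 x hx'],
    codisjoint_iff.mpr (eq_top_iff.mpr fun x _ => ?_)⟩, h1, h2⟩
  have := h.mem_left (c.T *ᵥ x)
  refine Submodule.mem_sup.mpr ⟨c.Tinv *ᵥ (P *ᵥ (c.T *ᵥ x)), ?_,
    c.Tinv *ᵥ (c.T *ᵥ x - P *ᵥ (c.T *ᵥ x)), ?_, ?_⟩
  · rw [Submodule.mem_comap, mulVecLin_apply, T_mulVec_Tinv_mulVec]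
    exact this.1
  · rw [Submodule.mem_comap, mulVecLin_apply, T_mulVec_Tinv_mulVec]
    exact this.2
  · rw [← mulVec_add, add_sub_cancel, Tinv_mulVec_T_mulVec]

lemma projectedSolution_form :
    projectedSolution (c.form Km) (c.form Kp) (c.sys P) = c.form (projectedSolution Km Kp P) := by
  have h : ∀ K M : Matrix (Fin n) (Fin n) ℝ, c.form K * c.sys M = c.form (K * M) := fun K M => by
    simp only [form, sys, Matrix.mul_assoc]
    rw [← Matrix.mul_assoc c.T, c.T_mul_Tinv, Matrix.one_mul]
  have h1 : 1 - c.sys P = c.sys (1 - P) := by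
    rw [sys, sys, Matrix.mul_sub, Matrix.sub_mul, Matrix.mul_one, c.Tinv_mul_T]
  rw [projectedSolution, h1, h, h, projectedSolution, form, form, form, Matrix.mul_add,
    Matrix.add_mul]

end CoordChange

/-! ### Splitting into antistable, neutral and stable parts. -/

section SpectralSplitting

variable {ι : Type*} [Fintype ι] [DecidableEq ι]

/-- By Bezout the greatest common divisor of the two annihilating polynomials annihilates as well,
and its roots lie in both regions. -/
lemma SpectrallyIn.inter {R S : Set ℂ} {M : Matrix ι ι ℝ} {x : ι → ℝ} (h : SpectrallyIn R M x)
    (h' : SpectrallyIn S M x) : SpectrallyIn (R ∩ S) M x := by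
  obtain ⟨p, hp, hpx⟩ := h
  obtain ⟨q, hq, hqx⟩ := h'
  refine ⟨EuclideanDomain.gcd p q, fun z hz => ⟨hp z ?_, hq z ?_⟩, ?_⟩
  · obtain ⟨r, hr⟩ := EuclideanDomain.gcd_dvd_left p q
    rw [hr, map_mul, hz, zero_mul]
  · obtain ⟨r, hr⟩ := EuclideanDomain.gcd_dvd_right p q
    rw [hr, map_mul, hz, zero_mul]
  · rw [EuclideanDomain.gcd_eq_gcd_ab, mul_comm p, mul_comm q, map_add, add_mulVec,
      aeval_mul_mulVec, aeval_mul_mulVec, hpx, hqx, mulVec_zero, mulVec_zero, add_zero]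

lemma SpectrallyIn.add {R : Set ℂ} {M : Matrix ι ι ℝ} {x y : ι → ℝ} (h : SpectrallyIn R M x)
    (h' : SpectrallyIn R M y) : SpectrallyIn R M (x + y) := by
  obtain ⟨p, hp, hpx⟩ := h
  obtain ⟨q, hq, hqx⟩ := h'
  refine ⟨p * q, hp.mul hq, ?_⟩
  rw [mulVec_add, aeval_mul_mulVec, aeval_mul_mulVec, hqx, mulVec_zero, aeval_mulVec_comm, hpx,
    mulVec_zero, add_zero]

lemma SpectrallyIn.neg_vec {R : Set ℂ} {M : Matrix ι ι ℝ} {x : ι → ℝ} (h : SpectrallyIn R M x) :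
    SpectrallyIn R M (-x) := h.imp fun _ hp => ⟨hp.1, by rw [mulVec_neg, hp.2, neg_zero]⟩

lemma disjoint_zero_neg : Disjoint {z : ℂ | z.re = 0} {z | z.re < 0} :=
  Set.disjoint_left.mpr fun z (h : z.re = 0) (h' : z.re < 0) => h'.ne h

lemma eq_zero_of_spectral_sum {M : Matrix ι ι ℝ} {x y z : ι → ℝ}
    (hx : SpectrallyIn {z | 0 < z.re} M x) (hy : SpectrallyIn {z | z.re = 0} M y)
    (hz : SpectrallyIn {z | z.re < 0} M z) (h : x + (y + z) = 0) : x = 0 ∧ y = 0 ∧ z = 0 := by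
  have h1 : SpectrallyIn {z | z.re ≤ 0} M (y + z) :=
    (hy.mono fun w (hw : w.re = 0) => (hw.le : w.re ≤ 0)).add
      (hz.mono fun w (hw : w.re < 0) => (hw.le : w.re ≤ 0))
  have hx0 : x = 0 := by
    refine hx.eq_zero ?_ disjoint_pos_nonpos
    rw [eq_neg_of_add_eq_zero_left h]
    exact h1.neg_vec
  rw [hx0, zero_add] at h
  have hy0 : y = 0 := by
    refine hy.eq_zero ?_ disjoint_zero_neg
    rw [eq_neg_of_add_eq_zero_left h]
    exact hz.neg_vec
  rw [hy0, zero_add] at h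
  exact ⟨hx0, hy0, h⟩

lemma exists_spectral_sum (M : Matrix ι ι ℝ) (x : ι → ℝ) : ∃ a b c : ι → ℝ,
    SpectrallyIn {z | 0 < z.re} M a ∧ SpectrallyIn {z | z.re = 0} M b ∧
      SpectrallyIn {z | z.re < 0} M c ∧ a + (b + c) = x := by
  have key : ∀ {R : Set ℂ} (hR : IsVertical R) (x : ι → ℝ), ∃ a b,
      SpectrallyIn R M a ∧ SpectrallyIn Rᶜ M b ∧ a + b = x := fun {R} hR x => by
    have hx : x ∈ spectralSubspace R M ⊔ spectralSubspace Rᶜ M := by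
      rw [(isCompl_spectralSubspace hR M).sup_eq_top]; trivial
    obtain ⟨a, ha, b, hb, h⟩ := Submodule.mem_sup.mp hx
    exact ⟨a, b, (mem_spectralSubspace hR M a).mp ha, (mem_spectralSubspace hR.compl M b).mp hb, h⟩
  obtain ⟨a, y, ha, hy, rfl⟩ := key isVertical_pos x
  obtain ⟨b, c, hb, hc, rfl⟩ := key isVertical_zero y
  have hab : SpectrallyIn {z | 0 < z.re}ᶜ M b := by
    rw [compl_pos_eq]
    exact hb.mono fun w (hw : w.re = 0) => (hw.le : w.re ≤ 0)
  -- `c` is non-neutral by construction; as a difference of non-antistable vectors it is also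
  -- non-antistable, hence stable.
  have hcc : SpectrallyIn {z | 0 < z.re}ᶜ M c := by
    rw [show c = b + c + -b by abel]
    exact hy.add hab.neg_vec
  refine ⟨a, b, c, ha, hb, (hcc.inter hc).mono fun w hw => ?_, rfl⟩
  rw [compl_pos_eq] at hw
  exact lt_of_le_of_ne hw.1 hw.2

lemma mem_specPos {M : Matrix ι ι ℝ} {x : ι → ℝ} :
    x ∈ specPos M ↔ SpectrallyIn {z | 0 < z.re} M x := mem_spectralSubspace isVertical_pos M x

lemma mem_specZero {M : Matrix ι ι ℝ} {x : ι → ℝ} :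
    x ∈ specZero M ↔ SpectrallyIn {z | z.re = 0} M x := mem_spectralSubspace isVertical_zero M x

lemma mem_specNeg {M : Matrix ι ι ℝ} {x : ι → ℝ} :
    x ∈ specNeg M ↔ SpectrallyIn {z | z.re < 0} M x := mem_spectralSubspace isVertical_neg M x

/-- A basis adapted to the spectral splitting of a matrix. -/
lemma exists_spectral_basis (M : Matrix ι ι ℝ) : ∃ (p q r : ℕ)
    (b : Module.Basis (Fin p ⊕ Fin q ⊕ Fin r) ℝ (ι → ℝ)),
    (∀ i, b (Sum.inl i) ∈ specPos M) ∧ (∀ i, b (Sum.inr (Sum.inl i)) ∈ specZero M) ∧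
      ∀ i, b (Sum.inr (Sum.inr i)) ∈ specNeg M := by
  let f : (specPos M × specZero M × specNeg M) →ₗ[ℝ] (ι → ℝ) :=
    (specPos M).subtype.coprod ((specZero M).subtype.coprod (specNeg M).subtype)
  have hf : ∀ x, f x = (x.1 : ι → ℝ) + ((x.2.1 : ι → ℝ) + x.2.2) := fun x => by
    simp [f, LinearMap.coprod_apply]
  have hbij : Function.Bijective f := by
    refine ⟨(injective_iff_map_eq_zero f).mpr fun x hx => ?_, fun x => ?_⟩
    · rw [hf] at hx
      obtain ⟨h1, h2, h3⟩ := eq_zero_of_spectral_sum (mem_specPos.mp x.1.2)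
        (mem_specZero.mp x.2.1.2) (mem_specNeg.mp x.2.2.2) hx
      exact Prod.ext (Subtype.ext h1) (Prod.ext (Subtype.ext h2) (Subtype.ext h3))
    · obtain ⟨a, b, c, ha, hb, hc, h⟩ := exists_spectral_sum M x
      exact ⟨(⟨a, mem_specPos.mpr ha⟩, ⟨b, mem_specZero.mpr hb⟩, ⟨c, mem_specNeg.mpr hc⟩),
        (hf _).trans h⟩
  refine ⟨_, _, _, ((Module.finBasis ℝ (specPos M)).prod ((Module.finBasis ℝ (specZero M)).prod
    (Module.finBasis ℝ (specNeg M)))).map (LinearEquiv.ofBijective f hbij), fun i => ?_,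
    fun i => ?_, fun i => ?_⟩ <;> simp [hf]

end SpectralSplitting

/-- Three coordinate subspaces that span, contained in three independent subspaces, must exhaust
them. -/
lemma specSubspaces_eq_coordSubspace {p q r : ℕ}
    {M : Matrix (Fin p ⊕ Fin q ⊕ Fin r) (Fin p ⊕ Fin q ⊕ Fin r) ℝ}
    (h₁ : ∀ i, Pi.single (Sum.inl i) 1 ∈ specPos M)
    (h₂ : ∀ i, Pi.single (Sum.inr (Sum.inl i)) 1 ∈ specZero M)
    (h₃ : ∀ i, Pi.single (Sum.inr (Sum.inr i)) 1 ∈ specNeg M) :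
    specPos M = coordSubspace Sum.inl ∧ specZero M = coordSubspace (Sum.inr ∘ Sum.inl) ∧
      specNeg M = coordSubspace (Sum.inr ∘ Sum.inr) := by
  have l₁ : coordSubspace Sum.inl ≤ specPos M :=
    Submodule.span_le.mpr (Set.range_subset_iff.mpr h₁)
  have l₂ : coordSubspace (Sum.inr ∘ Sum.inl) ≤ specZero M :=
    Submodule.span_le.mpr (Set.range_subset_iff.mpr h₂)
  have l₃ : coordSubspace (Sum.inr ∘ Sum.inr) ≤ specNeg M :=
    Submodule.span_le.mpr (Set.range_subset_iff.mpr h₃)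
  have split : ∀ x : Fin p ⊕ Fin q ⊕ Fin r → ℝ, ∃ a ∈ coordSubspace Sum.inl,
      ∃ b ∈ coordSubspace (Sum.inr ∘ Sum.inl), ∃ c ∈ coordSubspace (Sum.inr ∘ Sum.inr),
      x = a + (b + c) := fun x => by
    refine ⟨Sum.elim (x ∘ Sum.inl) 0, ?_, Sum.elim 0 (Sum.elim (x ∘ Sum.inr ∘ Sum.inl) 0), ?_,
      Sum.elim 0 (Sum.elim 0 (x ∘ Sum.inr ∘ Sum.inr)), ?_, ?_⟩
    · rw [mem_coordSubspace]; rintro (i | i | i) hi <;> simp at hi ⊢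
    · rw [mem_coordSubspace]; rintro (i | i | i) hi <;> simp at hi ⊢
    · rw [mem_coordSubspace]; rintro (i | i | i) hi <;> simp at hi ⊢
    · ext (i | i | i) <;> simp
  have diff : ∀ x a b c : Fin p ⊕ Fin q ⊕ Fin r → ℝ, x = a + (b + c) →
      (a - x) + (b + c) = 0 ∧ a + ((b - x) + c) = 0 ∧ a + (b + (c - x)) = 0 := by
    rintro x a b c rfl
    refine ⟨?_, ?_, ?_⟩ <;> abel
  refine ⟨le_antisymm (fun x hx => ?_) l₁, le_antisymm (fun x hx => ?_) l₂,
    le_antisymm (fun x hx => ?_) l₃⟩ <;> obtain ⟨a, ha, b, hb, c, hc, h⟩ := split x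
  · have := eq_zero_of_spectral_sum (mem_specPos.mp (Submodule.sub_mem _ (l₁ ha) hx))
      (mem_specZero.mp (l₂ hb)) (mem_specNeg.mp (l₃ hc)) (diff x a b c h).1
    rwa [← sub_eq_zero.mp this.1]
  · have := eq_zero_of_spectral_sum (mem_specPos.mp (l₁ ha))
      (mem_specZero.mp (Submodule.sub_mem _ (l₂ hb) hx)) (mem_specNeg.mp (l₃ hc))
      (diff x a b c h).2.1
    rwa [← sub_eq_zero.mp this.2.1]
  · have := eq_zero_of_spectral_sum (mem_specPos.mp (l₁ ha))
      (mem_specZero.mp (l₂ hb)) (mem_specNeg.mp (Submodule.sub_mem _ (l₃ hc) hx))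
      (diff x a b c h).2.2
    rwa [← sub_eq_zero.mp this.2.2]

/-! ### Construction of adapted coordinates by refinement. -/

section Adapted

variable {n m : ℕ}

lemma exists_projectionMatrix {ι : Type*} [Fintype ι] [DecidableEq ι]
    {V W : Submodule ℝ (ι → ℝ)} (h : IsCompl V W) :
    ∃ P : Matrix ι ι ℝ, IsProjectionAlong P V W :=
  ⟨LinearMap.toMatrix' (V.projection W h), h,
    fun v hv => by
      rw [LinearMap.toMatrix'_mulVec, Submodule.projection_apply_of_mem_left h hv],
    fun w hw => by
      rw [LinearMap.toMatrix'_mulVec, (Submodule.projection_apply_eq_zero_iff h).mpr hw]⟩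

lemma range_mulVecLin_of_basis {κ : Type*} [Fintype κ] [DecidableEq κ]
    {V : Submodule ℝ (Fin n → ℝ)} (b : Module.Basis κ ℝ V) {M : Matrix (Fin n) κ ℝ}
    (h : ∀ k, M.col k = b k) : LinearMap.range M.mulVecLin = V := by
  rw [range_mulVecLin]
  have : M.col = V.subtype ∘ b := funext h
  rw [this, Set.range_comp, Submodule.span_image, b.span_eq, Submodule.map_top,
    Submodule.range_subtype]

/-- Coordinates adapted to a pair of complementary subspaces. -/
lemma exists_coordChange_of_isCompl {V W : Submodule ℝ (Fin n → ℝ)} (h : IsCompl V W) :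
    ∃ (k s : ℕ) (c : CoordChange n (Fin k ⊕ Fin s)),
      LinearMap.range c.T.toCols₁.mulVecLin = V ∧ LinearMap.range c.T.toCols₂.mulVecLin = W := by
  let b := ((Module.finBasis ℝ V).prod (Module.finBasis ℝ W)).map (Submodule.prodEquivOfIsCompl V W h)
  have hb : ∀ k, (CoordChange.ofBasis b).T.col k = b k := fun k => by
    rw [← CoordChange.ofBasis_T_mulVec_single, mulVec_single_one]
  refine ⟨_, _, CoordChange.ofBasis b, range_mulVecLin_of_basis (Module.finBasis ℝ V) fun k => ?_,
    range_mulVecLin_of_basis (Module.finBasis ℝ W) fun k => ?_⟩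
  · exact (hb (Sum.inl k)).trans (by simp [b])
  · exact (hb (Sum.inr k)).trans (by simp [b])

/-- The block diagonal matrix with diagonal blocks `M` and the identity. -/
abbrev blockDiagOne {κ κ' : Type*} (σ : Type*) [DecidableEq σ] (M : Matrix κ κ' ℝ) :
    Matrix (κ ⊕ σ) (κ' ⊕ σ) ℝ := fromBlocks M 0 0 1

/-- Refine a change of coordinates by a further change in the first block. -/
def CoordChange.refineFirst {k s : ℕ} {κ : Type} [Fintype κ] [DecidableEq κ]
    (c : CoordChange n (Fin k ⊕ Fin s)) (d : CoordChange k κ) : CoordChange n (κ ⊕ Fin s) where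
  T := c.T * blockDiagOne (Fin s) d.T
  Tinv := blockDiagOne (Fin s) d.Tinv * c.Tinv
  T_mul_Tinv := by
    rw [Matrix.mul_assoc, ← Matrix.mul_assoc _ _ c.Tinv, fromBlocks_multiply]
    simp [d.T_mul_Tinv, c.T_mul_Tinv]
  Tinv_mul_T := by
    rw [Matrix.mul_assoc, ← Matrix.mul_assoc c.Tinv, c.Tinv_mul_T, Matrix.one_mul,
      fromBlocks_multiply]
    simp [d.Tinv_mul_T]

namespace CoordChange

variable {k s : ℕ} {κ : Type} [Fintype κ] [DecidableEq κ]
  (c : CoordChange n (Fin k ⊕ Fin s)) (d : CoordChange k κ)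

lemma refineFirst_toCols₁ : (c.refineFirst d).T.toCols₁ = c.T.toCols₁ * d.T := by
  ext i j
  simp [refineFirst, Matrix.mul_apply]

lemma refineFirst_toCols₂ : (c.refineFirst d).T.toCols₂ = c.T.toCols₂ := by
  ext i j
  simp [refineFirst, Matrix.mul_apply, Matrix.one_apply]

lemma range_refineFirst_toCols₁ : LinearMap.range (c.refineFirst d).T.toCols₁.mulVecLin =
    LinearMap.range c.T.toCols₁.mulVecLin := by
  rw [refineFirst_toCols₁, mulVecLin_mul, LinearMap.range_comp_of_range_eq_top]
  exact LinearMap.range_eq_top.mpr fun x => ⟨d.Tinv *ᵥ x, d.T_mulVec_Tinv_mulVec x⟩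

lemma refineFirst_sys (A : Matrix (Fin n) (Fin n) ℝ) :
    ((c.refineFirst d).sys A).toBlocks₁₁ = d.sys (c.sys A).toBlocks₁₁ := by
  have : (c.refineFirst d).sys A = blockDiagOne (Fin s) d.Tinv * c.sys A * blockDiagOne (Fin s) d.T := by
    simp only [sys, refineFirst, Matrix.mul_assoc]
  rw [this, ← fromBlocks_toBlocks (c.sys A), blockDiagOne, blockDiagOne, fromBlocks_multiply, fromBlocks_multiply,
    toBlocks_fromBlocks₁₁, toBlocks_fromBlocks₁₁]
  simp [sys]

lemma refineFirst_form (Q : Matrix (Fin n) (Fin n) ℝ) :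
    ((c.refineFirst d).form Q).toBlocks₁₁ = d.form (c.form Q).toBlocks₁₁ := by
  have : (c.refineFirst d).form Q = (blockDiagOne (Fin s) d.T)ᵀ * c.form Q * blockDiagOne (Fin s) d.T := by
    simp only [form, refineFirst, transpose_mul, Matrix.mul_assoc]
  rw [this, ← fromBlocks_toBlocks (c.form Q), blockDiagOne, fromBlocks_transpose, fromBlocks_multiply,
    fromBlocks_multiply, toBlocks_fromBlocks₁₁, toBlocks_fromBlocks₁₁]
  simp [form]

lemma refineFirst_inp (B : Matrix (Fin n) (Fin m) ℝ) :
    ((c.refineFirst d).inp B).toRows₁ = d.inp (c.inp B).toRows₁ := by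
  have : (c.refineFirst d).inp B = blockDiagOne (Fin s) d.Tinv * c.inp B := by
    simp only [inp, refineFirst, Matrix.mul_assoc]
  rw [this, ← fromRows_toRows (c.inp B), blockDiagOne, fromBlocks_mul_fromRows, toRows₁_fromRows,
    toRows₁_fromRows]
  simp [inp]

lemma restrictedTarget_refineFirst (L : Submodule ℝ (Fin n → ℝ)) :
    restrictedTarget L (c.refineFirst d) = (restrictedTarget L c).comap d.T.mulVecLin := by
  rw [restrictedTarget, refineFirst_toCols₁, mulVecLin_mul, restrictedTarget, Submodule.comap_comp]

end CoordChange

/-- Adapted coordinates exist for every complement of the controllable subspace. -/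
theorem exists_isAdapted {A Q : Matrix (Fin n) (Fin n) ℝ} {B : Matrix (Fin n) (Fin m) ℝ}
    (L : Submodule ℝ (Fin n → ℝ)) (hQ : Q.IsSymm) (hne : (solARI A B Q).Nonempty)
    {X₂ : Submodule ℝ (Fin n → ℝ)} (hX : IsCompl (controllableSubspace A B) X₂) :
    ∃ (p q r s : ℕ) (c : CoordChange n ((Fin p ⊕ Fin q ⊕ Fin r) ⊕ Fin s))
      (Km Kp P : Matrix (Fin p ⊕ Fin q ⊕ Fin r) (Fin p ⊕ Fin q ⊕ Fin r) ℝ),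
      IsAdapted A B Q L X₂ c Km Kp P := by
  obtain ⟨k, s, c, hc₁, hc₂⟩ := exists_coordChange_of_isCompl hX
  have hQ₁ := (eq_fromBlocks_of_isSymm (c.form_isSymm hQ)).2.1
  have hctrl := isControllablePair_of_range hc₁
  obtain ⟨K₀, hK₀⟩ := hne
  have hK₁ := toBlocks₁₁_mem_solARI (sys_eq_fromBlocks hc₁) (inp_eq_fromRows hc₁)
    (c.form_isSymm hQ) (c.form_mem_solARI hK₀)
  obtain ⟨⟨Kp, hKp⟩, Km, hKm⟩ := exists_extremal_solutions hQ₁ hctrl ⟨_, hK₁⟩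
  obtain ⟨P, hP⟩ := exists_projectionMatrix (isCompl_comap_orthComplement hKm.1 hKp.1
    (hKp.2 Km hKm.1) (hKp.semistable hQ₁ hctrl.hasStabilizer).1
    (N := undetectedSubspace (c.sys A).toBlocks₁₁ (c.inp B).toRows₁ (restrictedTarget L c) Km)
    (fun _ => closedLoop_mem_undetectedSubspace) (fun _ => undetectedSubspace_spectrallyIn))
  -- The extremal solutions and the projection are found in arbitrary coordinates of the
  -- controllable subspace. Only then can the spectral basis of the resulting closed loop be chosen
  -- and everything transported to it.
  obtain ⟨p, q, r, b, hb₁, hb₂, hb₃⟩ := exists_spectral_basis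
    (closedLoop (c.sys A).toBlocks₁₁ (c.inp B).toRows₁ (projectedSolution Km Kp P))
  let d := CoordChange.ofBasis b
  have hloop : closedLoop ((c.refineFirst d).sys A).toBlocks₁₁ ((c.refineFirst d).inp B).toRows₁
      (projectedSolution (d.form Km) (d.form Kp) (d.sys P)) = d.sys
        (closedLoop (c.sys A).toBlocks₁₁ (c.inp B).toRows₁ (projectedSolution Km Kp P)) := by
    rw [c.refineFirst_sys, c.refineFirst_inp, d.projectedSolution_form, d.closedLoop_form]
  have hN : undetectedSubspace ((c.refineFirst d).sys A).toBlocks₁₁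
      ((c.refineFirst d).inp B).toRows₁ (restrictedTarget L (c.refineFirst d)) (d.form Km) =
      (undetectedSubspace (c.sys A).toBlocks₁₁ (c.inp B).toRows₁ (restrictedTarget L c) Km).comap
        d.T.mulVecLin := by
    rw [c.refineFirst_sys, c.refineFirst_inp, c.restrictedTarget_refineFirst,
      d.undetectedSubspace_comap]
  have hspec := specSubspaces_eq_coordSubspace (M := d.sys (closedLoop (c.sys A).toBlocks₁₁
    (c.inp B).toRows₁ (projectedSolution Km Kp P)))
    (fun i => by
      rw [mem_specPos, d.spectrallyIn_sys, CoordChange.ofBasis_T_mulVec_single]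
      exact mem_specPos.mp (hb₁ i))
    (fun i => by
      rw [mem_specZero, d.spectrallyIn_sys, CoordChange.ofBasis_T_mulVec_single]
      exact mem_specZero.mp (hb₂ i))
    (fun i => by
      rw [mem_specNeg, d.spectrallyIn_sys, CoordChange.ofBasis_T_mulVec_single]
      exact mem_specNeg.mp (hb₃ i))
  refine ⟨p, q, r, s, c.refineFirst d, d.form Km, d.form Kp, d.sys P, ⟨?_, ?_, ?_, ?_, ?_, ?_, ?_, ?_⟩⟩
  · rw [c.range_refineFirst_toCols₁, hc₁]
  · rw [c.refineFirst_toCols₂, hc₂]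
  · rw [c.refineFirst_sys, c.refineFirst_inp, c.refineFirst_form]
    exact d.isMinimalElement_form hKm
  · rw [c.refineFirst_sys, c.refineFirst_inp, c.refineFirst_form]
    exact d.isMaximalElement_form hKp
  · rw [hN, ← d.form_sub, d.comap_orthComplement]
    exact d.isProjectionAlong_sys hP
  · rw [hloop]; exact hspec.1
  · rw [hloop]; exact hspec.2.1
  · rw [hloop]; exact hspec.2.2

end Adapted

/-! ### The main theorem. -/

theorem theorem4p4 {n m : ℕ} (A : Matrix (Fin n) (Fin n) ℝ) (B : Matrix (Fin n) (Fin m) ℝ)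
    (Q : Matrix (Fin n) (Fin n) ℝ) (L : Submodule ℝ (Fin n → ℝ)) (hQ : Q.IsSymm)
    (hstab : IsStabilizable A B) (hneg : (solARINeg A B Q).Nonempty) :
    -- the value function is given by exactly one solution of the Riccati equation
    (∃! K : Matrix (Fin n) (Fin n) ℝ, K ∈ solARE A B Q ∧
      ∀ x₀ : Fin n → ℝ, valueFunction A B Q L x₀ = ((x₀ ⬝ᵥ K *ᵥ x₀ : ℝ) : EReal)) ∧
    -- the decomposition exists, for every complement of the controllable subspace
    (∀ X₂ : Submodule ℝ (Fin n → ℝ), IsCompl (controllableSubspace A B) X₂ →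
      ∃ (p q r s : ℕ) (c : CoordChange n ((Fin p ⊕ Fin q ⊕ Fin r) ⊕ Fin s))
        (Km Kp P : Matrix (Fin p ⊕ Fin q ⊕ Fin r) (Fin p ⊕ Fin q ⊕ Fin r) ℝ),
        IsAdapted A B Q L X₂ c Km Kp P) ∧
    -- the block form of that solution in every system of coordinates adapted to a decomposition
    (∀ Kstar : Matrix (Fin n) (Fin n) ℝ, Kstar ∈ solARE A B Q →
      (∀ x₀ : Fin n → ℝ, valueFunction A B Q L x₀ = ((x₀ ⬝ᵥ Kstar *ᵥ x₀ : ℝ) : EReal)) →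
      ∀ (X₂ : Submodule ℝ (Fin n → ℝ)) (p q r s : ℕ)
        (c : CoordChange n ((Fin p ⊕ Fin q ⊕ Fin r) ⊕ Fin s))
        (Km Kp P : Matrix (Fin p ⊕ Fin q ⊕ Fin r) (Fin p ⊕ Fin q ⊕ Fin r) ℝ),
        IsAdapted A B Q L X₂ c Km Kp P →
        let A₁ := (c.sys A).toBlocks₁₁
        let A₁₂ := (c.sys A).toBlocks₁₂
        let A₂ := (c.sys A).toBlocks₂₂
        let B₁ := (c.inp B).toRows₁
        let Q₁₂ := (c.form Q).toBlocks₁₂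
        let Q₂ := (c.form Q).toBlocks₂₂
        let Kbar := projectedSolution Km Kp P
        let Abar₂₂ := (closedLoop A₁ B₁ Kbar).toBlocks₂₂.toBlocks₁₁
        let Abar₃₃ := (closedLoop A₁ B₁ Kbar).toBlocks₂₂.toBlocks₂₂
        let Km₂₂ := Km.toBlocks₂₂.toBlocks₁₁
        let Km₂₃ := Km.toBlocks₂₂.toBlocks₁₂
        let Kp₃₃ := Kp.toBlocks₂₂.toBlocks₂₂
        (c.form Kstar).toBlocks₁₁ = Kbar ∧
        ∃ (K₁₂₂ : Matrix (Fin q) (Fin s) ℝ) (K₁₂₃ : Matrix (Fin r) (Fin s) ℝ)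
          (K₂ : Matrix (Fin s) (Fin s) ℝ),
          let K₁₂ : Matrix (Fin p ⊕ Fin q ⊕ Fin r) (Fin s) ℝ := fromRows 0 (fromRows K₁₂₂ K₁₂₃)
          c.form Kstar =
            fromBlocks (fromBlocks 0 0 0 (fromBlocks Km₂₂ Km₂₃ Km₂₃ᵀ Kp₃₃)) K₁₂ K₁₂ᵀ K₂ ∧
          (∀ X : Matrix (Fin q) (Fin s) ℝ,
            Abar₂₂ᵀ * X + X * A₂ =
                -(Q₁₂.toRows₂.toRows₁ + Km₂₂ * A₁₂.toRows₂.toRows₁ + Km₂₃ * A₁₂.toRows₂.toRows₂) ↔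
              X = K₁₂₂) ∧
          (∀ X : Matrix (Fin r) (Fin s) ℝ,
            Abar₃₃ᵀ * X + X * A₂ =
                -(Q₁₂.toRows₂.toRows₂ + Km₂₃ᵀ * A₁₂.toRows₂.toRows₁ + Kp₃₃ * A₁₂.toRows₂.toRows₂) ↔
              X = K₁₂₃) ∧
          (∀ X : Matrix (Fin s) (Fin s) ℝ,
            A₂ᵀ * X + X * A₂ = K₁₂ᵀ * B₁ * B₁ᵀ * K₁₂ - K₁₂ᵀ * A₁₂ - A₁₂ᵀ * K₁₂ - Q₂ ↔
              X = K₂)) 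
 := by
  have hne : (solARI A B Q).Nonempty := hneg.imp fun _ hK => hK.1
  -- The value function determines the quadratic form, and the form determines a symmetric matrix.
  -- Hence the solutions found in different adapted coordinates agree.
  have huniq : ∀ K K' : Matrix (Fin n) (Fin n) ℝ, K ∈ solARE A B Q → K' ∈ solARE A B Q →
      (∀ x₀, valueFunction A B Q L x₀ = ((x₀ ⬝ᵥ K *ᵥ x₀ : ℝ) : EReal)) →
      (∀ x₀, valueFunction A B Q L x₀ = ((x₀ ⬝ᵥ K' *ᵥ x₀ : ℝ) : EReal)) → K = K' :=
    fun K K' hK hK' h h' => eq_of_quadForm_eq hK.1 hK'.1 fun x =>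
      EReal.coe_injective ((h x).symm.trans (h' x))
  refine ⟨?_, fun X₂ hX => exists_isAdapted L hQ hne hX, ?_⟩
  · obtain ⟨X₂, hX⟩ := (controllableSubspace A B).exists_isCompl
    obtain ⟨p, q, r, s, c, Km, Kp, P, h⟩ := exists_isAdapted L hQ hne hX
    obtain ⟨-, -, K, -, hK, hval⟩ := h.exists_valueFunction hQ hstab hneg
    exact ⟨K, ⟨hK, hval⟩, fun K' hK' => huniq K' K hK'.1 hK hK'.2 hval⟩
  · intro Kstar hKstar hval X₂ p q r s c Km Kp P h
    obtain ⟨K₁₂, K₂, K, hform, hK, hval'⟩ := h.exists_valueFunction hQ hstab hneg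
    obtain rfl := huniq Kstar K hKstar hK hval hval'
    rw [← fromRows_toRows K₁₂] at hform
    refine ⟨by rw [hform, toBlocks_fromBlocks₁₁], K₁₂.toRows₁, K₁₂.toRows₂, K₂, ?_,
      h.block_equations hQ hstab hK hform⟩
    rw [hform, h.projectedSolution_eq hQ]
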